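/- **Setting.** Permutations are in one-line notation. A *gridded permutation* $g=(\pi,(c_1,\dots,c_n))$ is a permutation $\pi$ of length $n=|g|$ with cells $c_i=(\text{column},\text{row})\in\mathbb N\times\mathbb N$ such that the columns weakly increase with position and the rows weakly increase with value. It *contains* $h$ if $h$ occurs in it as a pattern in exactly the same cells. $(\pi,c)$ has all entries in cell $c$; a *point* is $(1,c)$. A *tiling* $\mathcal T=((t,u),\mathcal O,\mathcal R)$ represents the set $\mathrm{Grid}(\mathcal T)$ of gridded permutations with cells in $[0,t)\times[0,u)$ that avoid every obstruction in $\mathcal O$ and contain at least one member of every requirement list in $\mathcal R$; $|\mathcal T_n|$ counts those of size $n$. A cell of the tiling is *nonempty* if its point is not an obstruction. A tiling is *simplified* by rewriting $\mathcal O,\mathcal R$ without changing $\mathrm{Grid}(\mathcal T)$ and by deleting rows and columns that cannot contain entries. A *strategy* $S$ of arity $m$ consists of a decomposition function (giving $m$ children, or "does not apply"), a reliance profile $r(n)\in\mathbb Z^m$, and counting functions $c_n$ that must compute $|\mathcal A_n|$ from the terms of index at most $r^{(i)}(n)$ of the children $\mathcal B^{(i)}$ of $\mathcal A$, for every $\mathcal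 A$ to which $S$ applies. $S$ is *productive* if for all such $\mathcal A$ and all $i$: $j\le r^{(i)}(N)$ implies $j\le N$; and if $N\le r^{(i)}(N)$ for some $N$, then $|\mathcal A_n|\ge|\mathcal B^{(i)}_n|$ for all $n$, with strict inequality for some $n$. The strategies used are: * $\mathtt{ReqIns}_H$ (for $H$ a set of gridded permutations with cells in $[0,t)\times[0,u)$): children $((t,u),\mathcal O\cup H,\mathcal R)$ and $((t,u),\mathcal O,\mathcal R\cup\{H\})$, both required to be nonempty; $r(n)=(n,n)$, $c_n=a_n+b_n$. * $\mathtt{PointPl}_{h,\ell,d}$ (one child, $r(n)=n$, $c_n=a_n$), for a requirement list $\{h\}$ whose $\ell$-th entry is in the cell $c=(c_x,c_y)$ of the tiling: the row and the column of $c$ are each split into three. With $m=(c_x+1,c_y+1)$, and calling *multiplexes* of a gridded permutation those that become it when columns $c_x,c_x+1,c_x+2$ and rows $c_y,c_y+1,c_y+2$ are merged, the child has as obstructions all multiplexes of $\mathcal O$, $(12,m)$, $(21,m)$, the points of all other cells in the row and column of $m$, and the multiplexes of $h$ whose $\ell$-th entry lies further than $m$ in direction $d\in\{\leftarrow,\rightarrow,\uparrow,\downarrow\}$;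 its requirement lists are the sets of multiplexes of the lists other than $\{h\}$, the list $\{(1,m)\}$, and the list consisting of the multiplex of $h$ with its $\ell$-th entry in $m$ and no other entry in the row or column of $m$. * $\mathtt{RowSep}_{r,S}$ (one child, $r(n)=n$, $c_n=a_n$), for a nonempty set $S$ of nonempty cells of row $r$ such that for every $c\in S$ and every other nonempty cell $c'$ of the row, $\mathcal O$ contains $(21,(c,c'))$ if $c$ is to the left of $c'$ and $(12,(c',c))$ otherwise: these obstructions are dropped and the cells of $S$ move to a new row below the rest of row $r$. $\mathtt{ColSep}_{q,S}$ is the analogue for columns, $S$ moving to the left. * $\mathtt{Factor}_{P,S}$, for a partition $P$ of the nonempty cells into $m\ge2$ parts, no two of which share a row or a column or are both involved in one obstruction or in one requirement list: the children $\mathcal B^{(i)}$ are the subtilings on the parts, each required to contain a gridded permutation of size at least $1$; $S=\{i:|\mathcal B^{(j)}_0|=0\text{ for some }j\ne i\}$, $r^{(i)}(n)=n-1$ for $i\in S$ and $n$ otherwise, and $c_n=\sum b^{(1)}_{i_1}\cdots b^{(m)}_{i_m}$ over $i_1+\dots+i_m=n$ with $i_\ell\ne n$ for $\ell\in S$. *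 *Verification* $V_{\mathcal T}$: $\mathcal T$ has no children, and its counting sequence is given explicitly. Two tilings are *equivalent* if they are related by the equivalence relation generated by simplification, $\mathtt{PointPl}$, $\mathtt{RowSep}$ and $\mathtt{ColSep}$. **The tilings.** Write $B(c)=\{(1243,c),(1342,c),(2143,c)\}$ and, for cells $a,b$, $$\begin{aligned}\mathrm{Rt}(a,b)={}&B(a)\cup B(b)\cup\{(2143,babb),(213,aab),(123,aab),(123,abb)\},\\ \mathrm{Lt}(a,b)={}&B(a)\cup\{(1243,aaba),(1342,aaba),(1342,abba),(2143,aaba),(132,bbb),(231,bbb),(132,abb)\},\\ \mathrm{Pr}(a,b)={}&B(a)\cup\{(2143,aaab),(1243,aaab),(1342,aaab),(132,abb),(12,bb)\}.\end{aligned}$$ Here a word in $a,b$ lists the cells of the entries from left to right. Abbreviate the cell $(x,y)$ to $xy$; a pattern is always the first component of a pair. In each tiling below the listed *point cells* contain exactly one entry (obstructions $12$, $21$ and a point requirement), the listed *active* cells are unrestricted except as stated, and all other cells are empty (point obstruction); each requirement is a list of its own. * $\mathcal T_1$: $1\times1$, obstructions $B(00)$, no requirements. $\mathcal T_2$: $1\times1$,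 empty cell. $\mathcal T_3$: $\mathcal T_1$ with requirement $(1,00)$. $\mathcal T_4$: $1\times1$, obstruction $(12,00)$, requirement $(1,00)$. $\mathcal T_5$: $\mathcal T_1$ with requirement $(12,00)$. $\mathcal T_9$: $1\times1$, a point cell. $\mathcal T_{10}$: $1\times1$, obstruction $(12,00)$. * $\mathcal T_{11}'$: $3\times3$, point cell $11$, active $00,02,20$, obstructions $\mathrm{Rt}(00,02)$, $(12,(00,20))$, $(12,20)$. $\mathcal T_5'$: $\mathcal T_{11}'$ with requirement $(1,00)$. * $\mathcal T_5''$: $5\times5$, point cells $11,33$, active $04,20,22,24,40$, obstructions $\mathrm{Lt}(20,22)$, $\mathrm{Pr}(04,24)$, $(12,(20,40))$, $(12,(20,24))$, $(12,(22,24))$, $(12,40)$. * $\mathcal T_5'''$: $5\times6$, point cells $12,34$, active $05,21,23,25,40$, obstructions $\mathrm{Lt}(21,23)$, $\mathrm{Pr}(05,25)$, $(12,(21,25))$, $(12,(23,25))$, $(12,40)$. * $\mathcal T_6$: $6\times6$, point cells $12,44$, active $05,25,31,33,50$, obstructions $\mathrm{Lt}(31,33)$, $\mathrm{Pr}(05,25)$,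 $(12,50)$. * $\mathcal T_7$: $2\times1$, active $00,10$, obstructions $\mathrm{Pr}(00,10)$. $\mathcal T_{11}$: $\mathcal T_7$ with requirement $(1,10)$. * $\mathcal T_8$: $2\times3$, point cell $01$, active $10,12$, obstructions $\mathrm{Lt}(10,12)$. $\mathcal T_{13}$: $2\times3$, point cell $11$, active $00,02$, obstructions $\mathrm{Rt}(00,02)$. * $\mathcal T_{12}$: $3\times4$, point cell $12$, active $01,03,20$, obstructions $\mathrm{Rt}(01,03)$, $(12,20)$. **Theorem.** 1. Up to simplification of the children, the following rules are produced: $\mathcal T_1\leftarrow(\mathcal T_2,\mathcal T_3)$ by $\mathtt{ReqIns}_{\{(1,00)\}}$; $\mathcal T_3\leftarrow(\mathcal T_4,\mathcal T_5)$ by $\mathtt{ReqIns}_{\{(12,00)\}}$; $\mathcal T_7\leftarrow(\mathcal T_1,\mathcal T_{11})$ by $\mathtt{ReqIns}_{\{(1,10)\}}$; $\mathcal T_6\leftarrow(\mathcal T_7,\mathcal T_8,\mathcal T_9,\mathcal T_{10})$ by $\mathtt{Factor}_{P,\{1,2,3,4\}}$ with $P=\{05,25\},\{12,31,33\},\{44\},\{50\}$;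 $\mathcal T_{12}\leftarrow(\mathcal T_{13},\mathcal T_{10})$ by $\mathtt{Factor}_{P,\{2\}}$ with $P=\{01,03,12\},\{20\}$; and $\mathcal T_2,\mathcal T_4,\mathcal T_9,\mathcal T_{10}\leftarrow()$ by verification, with the counting sequences of $1$, $x/(1-x)$, $x$, $1/(1-x)$. 2. Up to simplification, $\mathtt{PointPl}_{(1,00),1,\leftarrow}$ sends $\mathcal T_3$ to $\mathcal T_8$ and $\mathtt{PointPl}_{(1,00),1,\rightarrow}$ sends $\mathcal T_3$ to $\mathcal T_{13}$; $\mathcal T_5$ is sent to $\mathcal T_5'$ by $\mathtt{PointPl}_{(12,00),2,\rightarrow}$, then to $\mathcal T_5''$ by $\mathtt{PointPl}_{(1,00),1,\leftarrow}$, then to $\mathcal T_5'''$ by $\mathtt{RowSep}_{0,\{40\}}$, then to $\mathcal T_6$ by $\mathtt{ColSep}_{2,\{25\}}$; $\mathcal T_{11}$ is sent to $\mathcal T_{11}'$ by $\mathtt{PointPl}_{(1,10),1,\leftarrow}$, then to $\mathcal T_{12}$ by $\mathtt{RowSep}_{0,\{20\}}$. 3. With $\mathcal E_3,\mathcal E_5,\mathcal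 E_{11}$ the equivalence classes of $\mathcal T_3,\mathcal T_5,\mathcal T_{11}$ (and each other tiling standing for its class), the nine rules $$\begin{gathered}\mathcal T_1\leftarrow(\mathcal T_2,\mathcal E_3),\quad \mathcal T_2\leftarrow(),\quad \mathcal E_3\leftarrow(\mathcal T_4,\mathcal E_5),\quad \mathcal T_4\leftarrow(),\quad \mathcal E_5\leftarrow(\mathcal T_7,\mathcal E_3,\mathcal T_9,\mathcal T_{10}),\\ \mathcal T_7\leftarrow(\mathcal T_1,\mathcal E_{11}),\quad \mathcal T_9\leftarrow(),\quad \mathcal T_{10}\leftarrow(),\quad \mathcal E_{11}\leftarrow(\mathcal E_3,\mathcal T_{10})\end{gathered}$$ form a valid combinatorial specification: equivalent tilings are equinumerous, the nine classes are distinct (so that each class occurs exactly once on a left-hand side), the nine strategies used satisfy the definition of a strategy above (their counting functions are correct for every tiling to which they apply), and each rule is produced by its strategy from a member of the class on the left, with children in the classes on the right. 4. All nine strategies are productive, and the specification is productive: the infinite system of equations given by its counting functions has exactly one solution in $(\mathbb C^{\mathbb N})^9$. That solution consists of the counting sequences of the nine classes. 5. For all $n$, $|(\mathcal T_1)_n|$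 is the number of permutations of length $n$ in $\mathrm{Av}(1243,1342,2143)$. 6. The generating function equations $$\begin{gathered}T_1=T_2+E_3,\quad T_2=1,\quad E_3=T_4+E_5,\quad T_4=\tfrac{x}{1-x},\quad E_5=T_7E_3T_9T_{10},\\ T_7=T_1+E_{11},\quad T_9=x,\quad T_{10}=\tfrac1{1-x},\quad E_{11}=E_3T_{10}\end{gathered}$$ have exactly one solution in formal power series over $\mathbb C$, namely the generating functions of the nine classes, and the generating function of $\mathrm{Av}(1243,1342,2143)$ is $$\frac{1+x-\sqrt{1-6x+5x^2}}{2x(2-x)},$$ where $\sqrt{1-6x+5x^2}$ is the formal power series square root with constant term $1$. -/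

import Mathlib

open scoped PowerSeries

namespace CombExp

/-! ### Permutations and permutation classes

A permutation of length `n` is an `Equiv.Perm (Fin n)`; positions and values are counted from `0`. -/

/-- `π` contains the pattern `σ`: some subsequence of `π` is order isomorphic to `σ`. -/
def PermContains {n k : ℕ} (π : Equiv.Perm (Fin n)) (σ : Equiv.Perm (Fin k)) : Prop :=
  ∃ f : Fin k ↪o Fin n, ∀ i j, σ i < σ j ↔ π (f i) < π (f j)

/-- A set of permutations (of arbitrary lengths), used as a basis. -/
abbrev PermSet : Type := Set (Σ k : ℕ, Equiv.Perm (Fin k))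

/-- The permutations of length `n` in the class `Av(B)`. -/
def Av (B : PermSet) (n : ℕ) : Set (Equiv.Perm (Fin n)) :=
  {π | ∀ σ ∈ B, ¬ PermContains π σ.2}

/-- The generating function `∑ |Av(B)_n| x^n`. -/
noncomputable def classGF (B : PermSet) : ℂ⟦X⟧ :=
  PowerSeries.mk fun n => ((Av B n).ncard : ℂ)

/-! The patterns that are needed, each given by its one-line notation and that of its inverse.
The increasing permutation of any length is `1`. -/

def p21 : Equiv.Perm (Fin 2) := ⟨![1, 0], ![1, 0], by decide, by decide⟩
def p132 : Equiv.Perm (Fin 3) := ⟨![0, 2, 1], ![0, 2, 1], by decide, by decide⟩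
def p213 : Equiv.Perm (Fin 3) := ⟨![1, 0, 2], ![1, 0, 2], by decide, by decide⟩
def p231 : Equiv.Perm (Fin 3) := ⟨![1, 2, 0], ![2, 0, 1], by decide, by decide⟩
def p1243 : Equiv.Perm (Fin 4) := ⟨![0, 1, 3, 2], ![0, 1, 3, 2], by decide, by decide⟩
def p1342 : Equiv.Perm (Fin 4) := ⟨![0, 2, 3, 1], ![0, 3, 1, 2], by decide, by decide⟩
def p2143 : Equiv.Perm (Fin 4) := ⟨![1, 0, 3, 2], ![1, 0, 3, 2], by decide, by decide⟩

/-- The basis `{1243, 1342, 2143}`. -/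
def basis : PermSet := {⟨4, p1243⟩, ⟨4, p1342⟩, ⟨4, p2143⟩}

/-! ### Gridded permutations -/

/-- A cell `(column, row)`: the unit square with this lower left corner. -/
abbrev Cell : Type := ℕ × ℕ

/-- The entries of `π` can be drawn in the prescribed cells: columns weakly increase from left to
right, and rows weakly increase from the bottom value to the top value. -/
def Consistent {n : ℕ} (π : Equiv.Perm (Fin n)) (c : Fin n → Cell) : Prop :=
  (∀ i j, i < j → (c i).1 ≤ (c j).1) ∧ (∀ i j, π i < π j → (c i).2 ≤ (c j).2)

/-- A gridded permutation: a permutation with a consistent placement of its entries in cells. -/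
structure GriddedPerm where
  size : ℕ
  perm : Equiv.Perm (Fin size)
  cell : Fin size → Cell
  consistent : Consistent perm cell

/-- `g.Contains h`: `h` occurs in `g` as a pattern, in exactly the same cells. -/
def GriddedPerm.Contains (g h : GriddedPerm) : Prop :=
  ∃ f : Fin h.size ↪o Fin g.size,
    (∀ i j, h.perm i < h.perm j ↔ g.perm (f i) < g.perm (f j)) ∧ ∀ i, g.cell (f i) = h.cell i

/-- All cells of `g` lie in `[0, t) × [0, u)`. -/
def GriddedPerm.InBox (t u : ℕ) (g : GriddedPerm) : Prop :=
  ∀ i, (g.cell i).1 < t ∧ (g.cell i).2 < u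

/-- The gridded permutation `(π, c)` localized in a single cell `c`. -/
def localized {n : ℕ} (π : Equiv.Perm (Fin n)) (c : Cell) : GriddedPerm :=
  ⟨n, π, fun _ => c, fun _ _ _ => le_rfl, fun _ _ _ => le_rfl⟩

/-- The gridded permutation of size `1` in cell `c`. -/
def point (c : Cell) : GriddedPerm := localized (1 : Equiv.Perm (Fin 1)) c

/-- The set consisting of the gridded permutation `(π, c)`; it is empty if this pair is not
consistent. -/
def gridded {n : ℕ} (π : Equiv.Perm (Fin n)) (c : Fin n → Cell) : Set GriddedPerm :=
  {g | ∃ h : Consistent π c, g = ⟨n, π, c, h⟩}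

theorem gridded_eq_singleton {n : ℕ} {π : Equiv.Perm (Fin n)} {c : Fin n → Cell}
    (h : Consistent π c) : gridded π c = {⟨n, π, c, h⟩} :=
  Set.ext fun _ => ⟨fun ⟨_, hg⟩ => hg, fun hg => ⟨h, hg⟩⟩

/-- Replace every cell `c` by `γ c` in each member of a set of gridded permutations, keeping the
underlying permutations (pairs that are not consistent are dropped). -/
def mapCells (γ : Cell → Cell) (A : Set GriddedPerm) : Set GriddedPerm :=
  ⋃ g ∈ A, gridded g.perm (γ ∘ g.cell)

/-! ### Tilings -/

/-- A tiling: dimensions `width × height`, a set of obstructions, a set of requirement lists. -/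
structure Tiling where
  width : ℕ
  height : ℕ
  obs : Set GriddedPerm
  req : Set (Set GriddedPerm)

/-- The gridded permutations in the box that avoid all obstructions and contain at least one member
of each requirement list. -/
def Tiling.Grid (T : Tiling) : Set GriddedPerm :=
  {g | g.InBox T.width T.height ∧ (∀ o ∈ T.obs, ¬ g.Contains o) ∧
    ∀ L ∈ T.req, ∃ r ∈ L, g.Contains r}

/-- The number of gridded permutations of size `n` on the tiling. -/
noncomputable def Tiling.count (T : Tiling) (n : ℕ) : ℕ :=
  {g | g ∈ T.Grid ∧ g.size = n}.ncard

/-- The generating function of the set of gridded permutations on the tiling. -/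
noncomputable def Tiling.gf (T : Tiling) : ℂ⟦X⟧ :=
  PowerSeries.mk fun n => (T.count n : ℂ)

/-- The nonempty cells: those in the box without a point obstruction. -/
def Tiling.nonemptyCells (T : Tiling) : Set Cell :=
  {c | c.1 < T.width ∧ c.2 < T.height ∧ point c ∉ T.obs}

/-- The `1 × 1` tiling of the class `Av(B)`. -/
def classTiling (B : PermSet) : Tiling where
  width := 1
  height := 1
  obs := {o | ∃ σ ∈ B, o = localized σ.2 (0, 0)}
  req := ∅

/-- `T'` is a simplification of `T`: the obstructions and requirements are rewritten without changing
the represented set of gridded permutations, and rows and columns in which there can be no entry may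
be deleted (the retained columns and rows are those in the ranges of `f` and `g`). -/
def Simplifies (T T' : Tiling) : Prop :=
  ∃ f g : ℕ → ℕ, StrictMono f ∧ StrictMono g ∧ T.Grid = mapCells (Prod.map f g) T'.Grid

/-! ### Strategies -/

/-- The data of a combinatorial strategy, acting on (representations of) combinatorial sets: the
decomposition function (`none` is "does not apply"), the reliance profile function, and the counting
functions. The `n`-th counting function takes for each child `i` the tuple of its terms of index
`0, …, r n i`, and is given uniformly over commutative semirings, so that it can be evaluated on
natural numbers and also yields equations between complex indeterminates. -/
structure Strategy (Z : Type) where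
  arity : ℕ
  d : Z → Option (Fin arity → Z)
  r : ℕ → Fin arity → ℤ
  c : (R : Type) → [CommSemiring R] → (n : ℕ) →
    ((i : Fin arity) → Fin (r n i + 1).toNat → R) → R

namespace Strategy

variable {Z : Type}

/-- The counting functions compute the counting sequence of the parent from those of the children,
for every input to which the strategy applies. -/
def IsStrategy (cnt : Z → ℕ → ℕ) (S : Strategy Z) : Prop :=
  ∀ A B, S.d A = some B → ∀ n, S.c ℕ n (fun i j => cnt (B i) j) = cnt A n

/-- Productive strategies; `A_N` relies on the `j`-th term of child `i` if `j ≤ r N i`. -/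
def IsProductive (cnt : Z → ℕ → ℕ) (S : Strategy Z) : Prop :=
  ∀ A B, S.d A = some B → ∀ i,
    (∀ N j : ℕ, (j : ℤ) ≤ S.r N i → j ≤ N) ∧
    ((∃ N : ℕ, (N : ℤ) ≤ S.r N i) →
      (∀ n, cnt (B i) n ≤ cnt A n) ∧ ∃ l, cnt (B i) l < cnt A l)

/-- The shape of an equivalence strategy: one child, `r n = (n)`, and counting functions `a_n`. -/
def unary (f : Z → Option Z) : Strategy Z where
  arity := 1
  d A := (f A).map fun B _ => B
  r n _ := n
  c _ _ n a := a 0 ⟨n, by omega⟩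

end Strategy

/-! #### Requirement insertion -/

open Classical in
/-- Requirement insertion of the set `H`. -/
noncomputable def reqIns (H : Set GriddedPerm) : Strategy Tiling where
  arity := 2
  d T :=
    let TO : Tiling := ⟨T.width, T.height, T.obs ∪ H, T.req⟩
    let TR : Tiling := ⟨T.width, T.height, T.obs, T.req ∪ {H}⟩
    if (∀ h ∈ H, h.InBox T.width T.height) ∧ TO.Grid.Nonempty ∧ TR.Grid.Nonempty then
      some ![TO, TR]
    else none
  r n _ := n
  c _ _ n a := a 0 ⟨n, by omega⟩ + a 1 ⟨n, by omega⟩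

/-! #### Point placement -/

/-- The four directions in which a point can be forced to be extreme. -/
inductive Direction
  | left
  | right
  | up
  | down

/-- The cell `a` is strictly further in the given direction than the cell `b`. -/
def Direction.Further : Direction → Cell → Cell → Prop
  | .left, a, b => a.1 < b.1
  | .right, a, b => b.1 < a.1
  | .up, a, b => b.2 < a.2
  | .down, a, b => a.2 < b.2

/-- Contract the indices `p`, `p + 1`, `p + 2` to `p`. -/
def contractIndex (p i : ℕ) : ℕ :=
  if i < p then i else if i ≤ p + 2 then p else i - 2

/-- Contract the `3 × 3` block of cells with lower left cell `c` to the cell `c`. -/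
def contractCell (c a : Cell) : Cell :=
  (contractIndex c.1 a.1, contractIndex c.2 a.2)

/-- The multiplexes of `g` around `c`: the same permutation, with cells that contract to those of
`g`. -/
def multiplexes (c : Cell) (g : GriddedPerm) : Set GriddedPerm :=
  {g' | ∃ c' : Fin g.size → Cell, (∀ k, contractCell c (c' k) = g.cell k) ∧
    g' ∈ gridded g.perm c'}

/-- The set of multiplexes of the members of `A`. -/
def multiplexSet (c : Cell) (A : Set GriddedPerm) : Set GriddedPerm :=
  ⋃ g ∈ A, multiplexes c g

/-- The middle cell of the `3 × 3` block with lower left cell `c`. -/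
def middle (c : Cell) : Cell := (c.1 + 1, c.2 + 1)

/-- The set consisting of the multiplex of `g`, around the cell of its entry `I`, that isolates this
entry in the middle cell, with no other entry in the column or the row of the middle cell. -/
def pointMultiplex (g : GriddedPerm) (I : Fin g.size) : Set GriddedPerm :=
  let c := g.cell I
  {g' | ∃ c' : Fin g.size → Cell, (∀ k, contractCell c (c' k) = g.cell k) ∧
    c' I = middle c ∧
    (∀ k, k ≠ I → (c' k).1 ≠ (middle c).1 ∧ (c' k).2 ≠ (middle c).2) ∧
    g' ∈ gridded g.perm c'}

/-- The multiplexes of `g`, around the cell of its entry `I`, in which this entry lies strictly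
further in direction `dir` than the middle cell. -/
def furtherMultiplexes (g : GriddedPerm) (I : Fin g.size) (dir : Direction) : Set GriddedPerm :=
  let c := g.cell I
  {g' | ∃ c' : Fin g.size → Cell, (∀ k, contractCell c (c' k) = g.cell k) ∧
    dir.Further (c' I) (middle c) ∧ g' ∈ gridded g.perm c'}

/-- The tiling obtained by placing the entry `I` of the requirement `h` as far as possible in
direction `dir`. -/
def placedTiling (h : GriddedPerm) (I : Fin h.size) (dir : Direction) (T : Tiling) : Tiling :=
  let c := h.cell I
  let m := middle c
  { width := T.width + 2
    height := T.height + 2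
    obs := multiplexSet c T.obs
      ∪ {localized (1 : Equiv.Perm (Fin 2)) m, localized p21 m}
      ∪ {o | ∃ j, j < T.height + 2 ∧ j ≠ m.2 ∧ o = point (m.1, j)}
      ∪ {o | ∃ i, i < T.width + 2 ∧ i ≠ m.1 ∧ o = point (i, m.2)}
      ∪ furtherMultiplexes h I dir
    req := {L | ∃ L₀ ∈ T.req, L₀ ≠ {h} ∧ L = multiplexSet c L₀}
      ∪ {{point m}, pointMultiplex h I} }

open Classical in
/-- Point placement. It applies if `{h}` is one of the requirement lists (and the cell of the entry
that is placed is a cell of the tiling). -/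
noncomputable def pointPl (h : GriddedPerm) (I : Fin h.size) (dir : Direction) : Strategy Tiling :=
  Strategy.unary fun T =>
    if {h} ∈ T.req ∧ (h.cell I).1 < T.width ∧ (h.cell I).2 < T.height then
      some (placedTiling h I dir T)
    else none

/-! #### Row and column separation -/

/-- The critical row patterns, for the cells of row `r` whose columns lie in `S` and the remaining
nonempty cells of that row: an entry in one of the former lies above an entry in one of the latter. -/
def criticalRow (T : Tiling) (r : ℕ) (S : Set ℕ) : Set GriddedPerm :=
  {o | ∃ i ∈ S, ∃ i', i' ∉ S ∧ (i', r) ∈ T.nonemptyCells ∧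
    ((i < i' ∧ o ∈ gridded p21 ![(i, r), (i', r)]) ∨
     (i' < i ∧ o ∈ gridded (1 : Equiv.Perm (Fin 2)) ![(i', r), (i, r)]))}

open Classical in
/-- The cell map of row separation. -/
noncomputable def rowShift (r : ℕ) (S : Set ℕ) (c : Cell) : Cell :=
  if c.2 < r ∨ (c.2 = r ∧ c.1 ∈ S) then c else (c.1, c.2 + 1)

open Classical in
/-- Row separation: the cells of row `r` with columns in `S` are moved to a separate row below the
other cells of that row. -/
noncomputable def rowSep (r : ℕ) (S : Set ℕ) : Strategy Tiling :=
  Strategy.unary fun T =>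
    if S.Nonempty ∧ (∀ i ∈ S, (i, r) ∈ T.nonemptyCells) ∧ criticalRow T r S ⊆ T.obs then
      some
        { width := T.width
          height := T.height + 1
          obs := mapCells (rowShift r S) (T.obs \ criticalRow T r S)
            ∪ {o | ∃ i, i < T.width ∧ i ∉ S ∧ o = point (i, r)}
            ∪ {o | ∃ i ∈ S, o = point (i, r + 1)}
          req := mapCells (rowShift r S) '' T.req }
    else none

/-- The critical column patterns, for the cells of column `q` whose rows lie in `S` and the remaining
nonempty cells of that column: an entry in one of the former lies to the right of an entry in one of
the latter. -/
def criticalCol (T : Tiling) (q : ℕ) (S : Set ℕ) : Set GriddedPerm :=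
  {o | ∃ j ∈ S, ∃ j', j' ∉ S ∧ (q, j') ∈ T.nonemptyCells ∧
    ((j < j' ∧ o ∈ gridded p21 ![(q, j'), (q, j)]) ∨
     (j' < j ∧ o ∈ gridded (1 : Equiv.Perm (Fin 2)) ![(q, j'), (q, j)]))}

open Classical in
/-- The cell map of column separation. -/
noncomputable def colShift (q : ℕ) (S : Set ℕ) (c : Cell) : Cell :=
  if c.1 < q ∨ (c.1 = q ∧ c.2 ∈ S) then c else (c.1 + 1, c.2)

open Classical in
/-- Column separation: the cells of column `q` with rows in `S` are moved to a separate column to the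
left of the other cells of that column. -/
noncomputable def colSep (q : ℕ) (S : Set ℕ) : Strategy Tiling :=
  Strategy.unary fun T =>
    if S.Nonempty ∧ (∀ j ∈ S, (q, j) ∈ T.nonemptyCells) ∧ criticalCol T q S ⊆ T.obs then
      some
        { width := T.width + 1
          height := T.height
          obs := mapCells (colShift q S) (T.obs \ criticalCol T q S)
            ∪ {o | ∃ j, j < T.height ∧ j ∉ S ∧ o = point (q, j)}
            ∪ {o | ∃ j ∈ S, o = point (q + 1, j)}
          req := mapCells (colShift q S) '' T.req }
    else none

/-! #### Factor -/

/-- Some entry of `h` lies in a cell of `p`. -/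
def GriddedPerm.Involves (h : GriddedPerm) (p : Set Cell) : Prop := ∃ k, h.cell k ∈ p

/-- All entries of `h` lie in cells of `p`. -/
def GriddedPerm.Within (h : GriddedPerm) (p : Set Cell) : Prop := ∀ k, h.cell k ∈ p

/-- The sets of cells `p` and `q` do not interact: they share no row and no column, and no
obstruction and no requirement list involves cells of both. -/
def NonInteracting (T : Tiling) (p q : Set Cell) : Prop :=
  (∀ a ∈ p, ∀ b ∈ q, a.1 ≠ b.1 ∧ a.2 ≠ b.2) ∧
  (∀ o ∈ T.obs, ¬ (o.Involves p ∧ o.Involves q)) ∧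
  (∀ L ∈ T.req, ¬ ((∃ h ∈ L, h.Involves p) ∧ ∃ h ∈ L, h.Involves q))

/-- The subtiling on the part `P i`: all other cells are made empty, and the obstructions and the
requirement lists on this part are retained. -/
def subtiling {m : ℕ} (P : Fin m → Set Cell) (T : Tiling) (i : Fin m) : Tiling where
  width := T.width
  height := T.height
  obs := {o | o ∈ T.obs ∧ o.Within (P i)}
    ∪ {o | ∃ c : Cell, c.1 < T.width ∧ c.2 < T.height ∧ c ∉ P i ∧ o = point c}
  req := {L | ∃ L₀ ∈ T.req, (∀ j, j ≠ i → ∀ h ∈ L₀, ¬ h.Involves (P j)) ∧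
    L = {h | h ∈ L₀ ∧ h.Within (P i)}}

open Classical in
/-- The factor strategy for the partition `P` of the nonempty cells into `m ≥ 2` parts. The set `S`
consists of those `i` such that some factor other than the `i`-th has no gridded permutation of size
`0`; then the count at `n` does not rely on the `n`-th term of the `i`-th factor. -/
noncomputable def factor {m : ℕ} (P : Fin m → Set Cell) (S : Finset (Fin m)) : Strategy Tiling where
  arity := m
  d T :=
    if 2 ≤ m ∧ (⋃ i, P i) = T.nonemptyCells ∧
        (∀ i j, i ≠ j → Disjoint (P i) (P j) ∧ NonInteracting T (P i) (P j)) ∧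
        (∀ i, ∃ g ∈ (subtiling P T i).Grid, 1 ≤ g.size) ∧
        (∀ i, i ∈ S ↔ ∃ j, j ≠ i ∧ (subtiling P T j).count 0 = 0) then
      some (subtiling P T)
    else none
  r n i := if i ∈ S then (n : ℤ) - 1 else n
  c _ _ n b := ∑ k : (i : Fin m) → Fin ((if i ∈ S then (n : ℤ) - 1 else n) + 1).toNat,
    if ∑ i, (k i : ℕ) = n then ∏ i, b i (k i) else 0

/-! #### Verification -/

open Classical in
/-- The verification strategy for the combinatorial set represented by `A`, which is known to have
the counting sequence `a`. -/
noncomputable def verify (A : Tiling) (a : ℕ → ℕ) : Strategy Tiling where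
  arity := 0
  d T := if T.Grid = A.Grid then some ![] else none
  r _ := ![]
  c _ _ n _ := (a n : ℕ)

/-! ### Rules, equivalence classes, specifications -/

/-- The rule `T ← (B 0, …, B (m - 1))` is produced by `S`, up to simplification of the children. -/
def Produces (S : Strategy Tiling) (T : Tiling) (B : Fin S.arity → Tiling) : Prop :=
  ∃ B', S.d T = some B' ∧ ∀ i, Simplifies (B' i) (B i)

/-- The rules produced by the equivalence strategies. -/
inductive EquivRule : Tiling → Tiling → Prop
  | simplify (T T' : Tiling) : Simplifies T T' → EquivRule T T'
  | pointPl (h : GriddedPerm) (I : Fin h.size) (dir : Direction) (T : Tiling)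
      (B : Fin (pointPl h I dir).arity → Tiling) (i : Fin (pointPl h I dir).arity) :
      (pointPl h I dir).d T = some B → EquivRule T (B i)
  | rowSep (r : ℕ) (S : Set ℕ) (T : Tiling)
      (B : Fin (rowSep r S).arity → Tiling) (i : Fin (rowSep r S).arity) :
      (rowSep r S).d T = some B → EquivRule T (B i)
  | colSep (q : ℕ) (S : Set ℕ) (T : Tiling)
      (B : Fin (colSep q S).arity → Tiling) (i : Fin (colSep q S).arity) :
      (colSep q S).d T = some B → EquivRule T (B i)

/-- The equivalence relation generated by the rules of the equivalence strategies. -/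
def Equivalent : Tiling → Tiling → Prop := Relation.EqvGen EquivRule

/-- A family of rules, one for each vertex. A vertex stands for the equivalence class of its
representative; its rule names a strategy and, for each child, a vertex. Hence every class on the
right-hand side of a rule is on the left-hand side of a rule. -/
structure Specification (Z : Type) where
  Vertex : Type
  rep : Vertex → Z
  strategy : Vertex → Strategy Z
  child : (v : Vertex) → Fin (strategy v).arity → Vertex

namespace Specification

variable {Z : Type}

/-- The specification is valid: equivalent objects are equinumerous, different vertices are
different classes (so no class is on the left-hand side of two rules), the strategies that are used
are combinatorial strategies, and the rule of each vertex is produced by its strategy from a member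
of the class of the vertex, with children in the classes of the child vertices. -/
structure IsValid (rel : Z → Z → Prop) (cnt : Z → ℕ → ℕ) (P : Specification Z) : Prop where
  equinumerous : ∀ A B, rel A B → cnt A = cnt B
  distinct : ∀ v w, rel (P.rep v) (P.rep w) → v = w
  isStrategy : ∀ v, (P.strategy v).IsStrategy cnt
  produced : ∀ v, ∃ A B, rel A (P.rep v) ∧ (P.strategy v).d A = some B ∧
    ∀ i, rel (B i) (P.rep (P.child v i))

/-- `b` solves the infinite system of equations given by the counting functions. -/
def IsSolution (P : Specification Z) (b : P.Vertex → ℕ → ℂ) : Prop :=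
  ∀ v n, b v n = (P.strategy v).c ℂ n fun i j => b (P.child v i) j

/-- The specification is productive: its system has exactly one solution in complex sequences. -/
def IsProductive (P : Specification Z) : Prop := ∃! b, P.IsSolution b

end Specification

/-! ### The tilings of the proof tree -/

/-- The tiling shown by a picture of dimensions `t × u`: the cells in `pts` hold exactly one entry,
the cells that are neither in `pts` nor in `cells` are empty, and the obstructions `obs` and the
requirements `req` (each a requirement list of its own) are drawn. -/
def drawn (t u : ℕ) (pts cells : Set Cell) (obs req : Set GriddedPerm) : Tiling where
  width := t
  height := u
  obs := obs
    ∪ {o | ∃ c : Cell, c.1 < t ∧ c.2 < u ∧ c ∉ pts ∧ c ∉ cells ∧ o = point c}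
    ∪ {o | ∃ c ∈ pts, o = localized (1 : Equiv.Perm (Fin 2)) c ∨ o = localized p21 c}
  req := {L | ∃ h ∈ req, L = {h}} ∪ {L | ∃ c ∈ pts, L = {point c}}

/-- The pattern `12` with entries in the given cells. -/
def obs12 (a b : Cell) : Set GriddedPerm := gridded (1 : Equiv.Perm (Fin 2)) ![a, b]

/-- The three basis patterns, localized in cell `c`. -/
def basisAt (c : Cell) : Set GriddedPerm :=
  {localized p1243 c, localized p1342 c, localized p2143 c}

/-- The obstructions in the cells `lo` and `hi` (in a common column) to the left of a rightmost
point, below and above it. -/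
def rightmostObs (lo hi : Cell) : Set GriddedPerm :=
  basisAt lo ∪ basisAt hi
    ∪ gridded p2143 ![hi, lo, hi, hi]
    ∪ gridded p213 ![lo, lo, hi]
    ∪ gridded (1 : Equiv.Perm (Fin 3)) ![lo, lo, hi]
    ∪ gridded (1 : Equiv.Perm (Fin 3)) ![lo, hi, hi]

/-- The obstructions in the cells `lo` and `hi` (in a common column) to the right of a leftmost
point, below and above it. -/
def leftmostObs (lo hi : Cell) : Set GriddedPerm :=
  basisAt lo
    ∪ gridded p1243 ![lo, lo, hi, lo]
    ∪ gridded p1342 ![lo, lo, hi, lo]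
    ∪ gridded p1342 ![lo, hi, hi, lo]
    ∪ gridded p2143 ![lo, lo, hi, lo]
    ∪ {localized p132 hi, localized p231 hi}
    ∪ gridded p132 ![lo, hi, hi]

/-- The obstructions in two cells `a` and `b` of a common row, with `a` to the left of `b`. -/
def pairObs (a b : Cell) : Set GriddedPerm :=
  basisAt a
    ∪ gridded p2143 ![a, a, a, b]
    ∪ gridded p1243 ![a, a, a, b]
    ∪ gridded p1342 ![a, a, a, b]
    ∪ gridded p132 ![a, b, b]
    ∪ obs12 b b

def T1 : Tiling := classTiling basis

def T2 : Tiling := drawn 1 1 ∅ ∅ ∅ ∅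

def T3 : Tiling := drawn 1 1 ∅ {(0, 0)} (basisAt (0, 0)) {point (0, 0)}

def T4 : Tiling := drawn 1 1 ∅ {(0, 0)} (obs12 (0, 0) (0, 0)) {point (0, 0)}

/-- The gridded permutation `12` localized in cell `(0, 0)`. -/
def req12 : GriddedPerm := localized (1 : Equiv.Perm (Fin 2)) (0, 0)

def T5 : Tiling := drawn 1 1 ∅ {(0, 0)} (basisAt (0, 0)) {req12}

/-- The obstructions of `T5'` and of `T11'`. -/
def obsT11' : Set GriddedPerm :=
  rightmostObs (0, 0) (0, 2) ∪ obs12 (0, 0) (2, 0) ∪ obs12 (2, 0) (2, 0)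

def T5' : Tiling :=
  drawn 3 3 {(1, 1)} {(0, 0), (0, 2), (2, 0)} obsT11' {point (0, 0)}

def T5'' : Tiling :=
  drawn 5 5 {(1, 1), (3, 3)} {(0, 4), (2, 0), (2, 2), (2, 4), (4, 0)}
    (leftmostObs (2, 0) (2, 2) ∪ pairObs (0, 4) (2, 4) ∪ obs12 (2, 0) (4, 0)
      ∪ obs12 (2, 0) (2, 4) ∪ obs12 (2, 2) (2, 4) ∪ obs12 (4, 0) (4, 0)) ∅

/-- The tiling between `T5''` and `T6`, after the row separation. -/
def T5''' : Tiling :=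
  drawn 5 6 {(1, 2), (3, 4)} {(0, 5), (2, 1), (2, 3), (2, 5), (4, 0)}
    (leftmostObs (2, 1) (2, 3) ∪ pairObs (0, 5) (2, 5)
      ∪ obs12 (2, 1) (2, 5) ∪ obs12 (2, 3) (2, 5) ∪ obs12 (4, 0) (4, 0)) ∅

def T6 : Tiling :=
  drawn 6 6 {(1, 2), (4, 4)} {(0, 5), (2, 5), (3, 1), (3, 3), (5, 0)}
    (leftmostObs (3, 1) (3, 3) ∪ pairObs (0, 5) (2, 5) ∪ obs12 (5, 0) (5, 0)) ∅

def T7 : Tiling := drawn 2 1 ∅ {(0, 0), (1, 0)} (pairObs (0, 0) (1, 0)) ∅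

def T8 : Tiling := drawn 2 3 {(0, 1)} {(1, 0), (1, 2)} (leftmostObs (1, 0) (1, 2)) ∅

def T9 : Tiling := drawn 1 1 {(0, 0)} ∅ ∅ ∅

def T10 : Tiling := drawn 1 1 ∅ {(0, 0)} (obs12 (0, 0) (0, 0)) ∅

def T11 : Tiling := drawn 2 1 ∅ {(0, 0), (1, 0)} (pairObs (0, 0) (1, 0)) {point (1, 0)}

def T11' : Tiling := drawn 3 3 {(1, 1)} {(0, 0), (0, 2), (2, 0)} obsT11' ∅

def T12 : Tiling :=
  drawn 3 4 {(1, 2)} {(0, 1), (0, 3), (2, 0)}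
    (rightmostObs (0, 1) (0, 3) ∪ obs12 (2, 0) (2, 0)) ∅

def T13 : Tiling := drawn 2 3 {(1, 1)} {(0, 0), (0, 2)} (rightmostObs (0, 0) (0, 2)) ∅

/-! ### The specification -/

/-- The partition of the nonempty cells of `T6`. -/
def partsT6 : Fin 4 → Set Cell :=
  ![{(0, 5), (2, 5)}, {(1, 2), (3, 1), (3, 3)}, {(4, 4)}, {(5, 0)}]

/-- The partition of the nonempty cells of `T12`. -/
def partsT12 : Fin 2 → Set Cell :=
  ![{(0, 1), (0, 3), (1, 2)}, {(2, 0)}]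

noncomputable def insPoint : Strategy Tiling := reqIns {point (0, 0)}
noncomputable def ins12 : Strategy Tiling := reqIns {req12}
noncomputable def insRightPoint : Strategy Tiling := reqIns {point (1, 0)}
noncomputable def factorT6 : Strategy Tiling := factor partsT6 Finset.univ
noncomputable def factorT12 : Strategy Tiling := factor partsT12 {1}
noncomputable def verifyT2 : Strategy Tiling := verify T2 fun n => if n = 0 then 1 else 0
noncomputable def verifyT4 : Strategy Tiling := verify T4 fun n => if n = 0 then 0 else 1
noncomputable def verifyT9 : Strategy Tiling := verify T9 fun n => if n = 1 then 1 else 0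
noncomputable def verifyT10 : Strategy Tiling := verify T10 fun _ => 1

/-- The nine vertices: `e3`, `e5`, `e11` are the classes of `T3`, `T5`, `T11`. -/
inductive V
  | t1
  | t2
  | e3
  | t4
  | e5
  | t7
  | t9
  | t10
  | e11

/-- The representatives of the nine classes. -/
def vertexRep : V → Tiling
  | .t1 => T1
  | .t2 => T2
  | .e3 => T3
  | .t4 => T4
  | .e5 => T5
  | .t7 => T7
  | .t9 => T9
  | .t10 => T10
  | .e11 => T11

/-- The strategies of the nine rules. -/
noncomputable def vertexStrategy : V → Strategy Tiling
  | .t1 => insPoint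
  | .t2 => verifyT2
  | .e3 => ins12
  | .t4 => verifyT4
  | .e5 => factorT6
  | .t7 => insRightPoint
  | .t9 => verifyT9
  | .t10 => verifyT10
  | .e11 => factorT12

/-- The right-hand sides of the nine rules. -/
noncomputable def vertexChild : (v : V) → Fin (vertexStrategy v).arity → V
  | .t1 => (![.t2, .e3] : Fin 2 → V)
  | .t2 => (![] : Fin 0 → V)
  | .e3 => (![.t4, .e5] : Fin 2 → V)
  | .t4 => (![] : Fin 0 → V)
  | .e5 => (![.t7, .e3, .t9, .t10] : Fin 4 → V)
  | .t7 => (![.t1, .e11] : Fin 2 → V)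
  | .t9 => (![] : Fin 0 → V)
  | .t10 => (![] : Fin 0 → V)
  | .e11 => (![.e3, .t10] : Fin 2 → V)

/-- The specification for `Av(1243, 1342, 2143)`. -/
noncomputable def spec : Specification Tiling where
  Vertex := V
  rep := vertexRep
  strategy := vertexStrategy
  child := vertexChild

/-- The system of generating function equations of the specification. -/
def GFSystem (F : V → ℂ⟦X⟧) : Prop :=
  F .t1 = F .t2 + F .e3 ∧
  F .t2 = 1 ∧
  F .e3 = F .t4 + F .e5 ∧
  F .t4 = PowerSeries.X * (1 - PowerSeries.X)⁻¹ ∧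
  F .e5 = F .t7 * F .e3 * F .t9 * F .t10 ∧
  F .t7 = F .t1 + F .e11 ∧
  F .t9 = PowerSeries.X ∧
  F .t10 = (1 - PowerSeries.X)⁻¹ ∧
  F .e11 = F .e3 * F .t10

end CombExp

open CombExp

/-! ### Size-preserving bijections behind the equivalence strategies -/

namespace CombExp

/-! ### Gridded permutations up to isomorphism, and finiteness -/

/-! Each strategy is a statement about a map of gridded permutations. Merging the two rows (or
columns) made by a separation is a bijection onto the original grid: its inverse pushes the cells
apart, and avoiding the critical patterns is what keeps the result consistent (`rowSep_spec`,
`colSep_spec`). Contracting the `3 × 3` block made by a point placement is a bijection too: the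
placed point has to be the extreme one among all occurrences of the requirement, hence is
determined, and once it is known every other entry has only one possible cell
(`placedTiling_count`). Together with `simplifies_count` this yields `equivalent_count`. Restricting
to the parts of a factorization and merging back are mutually inverse, so counts of factors convolve
(`count_eq_sum_prod`); the terms left out by the reliance profile contain a factor with no object of
size `0` and vanish.

That the strategies lead to exactly the drawn tilings is a finite computation. Gridded permutations
become lists of values and cells, tilings become finite descriptions (`Desc`), and each strategy
becomes an operation on descriptions (`Desc.avoid`, `Desc.require`, `Desc.place`, `Desc.pull`,
`Desc.part`). Two descriptions are compared by `Desc.equiv`. A pattern is refuted by inserting the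
required points into it in every possible way and finding an obstruction or a forbidden cell in each
result. The test is only sound, not complete, but it succeeds on every rule, so each rule is settled
by evaluation in the kernel. The carriers are `contains_iff_has`, `Desc.Mem.of_implies`,
`Tiling.DescribedBy.mem_grid_iff` and the lemmas `produces_reqIns`, `produces_pointPl`,
`produces_rowSep`, `produces_colSep`, `produces_factor`.

The infinite system is solved through generating functions. In any complex solution the initial
terms of `e5` and `e3` are forced to be `0` by the shape of the reliance profiles, so the truncated
sums are full Cauchy products and the solution satisfies `GFSystem` (`gfSystem_of_isSolution`).
Elimination leaves `E = x u (1 + E (1 + E (1 + u)))` with `u = 1 / (1 - x)`. The difference of two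
solutions is annihilated by a power series with constant term `1`, so `E` is unique, and with it
everything else. Since the counting sequences are a solution, productivity of the specification and
the generating function statement follow. The same quadratic gives the first coefficients, which
separate the nine classes, and, after completing the square, the closed form. -/

theorem GriddedPerm.eq_of_iso {g h : GriddedPerm} (e : Fin g.size ≃ Fin h.size)
    (hp : ∀ i j, i < j ↔ e i < e j)
    (hv : ∀ i j, g.perm i < g.perm j ↔ h.perm (e i) < h.perm (e j))
    (hc : ∀ i, h.cell (e i) = g.cell i) : g = h := by
  obtain ⟨n, π, c, hg⟩ := g
  obtain ⟨m, σ, d, hh⟩ := h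
  dsimp only at *
  obtain rfl : n = m := by simpa using Fintype.card_congr e
  have iso_id : ∀ f : Fin n ≃ Fin n, (∀ i j, i < j ↔ f i < f j) → ∀ i, f i = i := by
    intro f hf i
    have : (⟨f, fun {a b} => by
      simpa only [not_lt] using (not_congr (hf b a)).symm⟩ : Fin n ≃o Fin n) =
      OrderIso.refl _ := Subsingleton.elim _ _
    exact congrArg (fun F : Fin n ≃o Fin n => F i) this
  have he : ∀ i, e i = i := iso_id e hp
  obtain rfl : π = σ := by
    have := iso_id (π.symm.trans σ) (fun i j => by
      have := hv (π.symm i) (π.symm j)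
      simpa [he] using this)
    ext i
    have h2 := this (π i)
    simp only [Equiv.trans_apply, Equiv.symm_apply_apply] at h2
    rw [h2]
  obtain rfl : c = d := by
    funext i
    rw [← hc i, he]
  rfl

theorem finite_inBox (t u n : ℕ) : {g : GriddedPerm | g.InBox t u ∧ g.size = n}.Finite := by
  classical
  let F : Equiv.Perm (Fin n) × (Fin n → Fin t × Fin u) → GriddedPerm := fun x =>
    if h : Consistent x.1 (fun i => (((x.2 i).1 : ℕ), ((x.2 i).2 : ℕ))) then ⟨n, x.1, _, h⟩
    -- The value on inconsistent data is irrelevant: it can only enlarge the finite range.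
    else point (0, 0)
  refine (Set.finite_range F).subset ?_
  rintro ⟨m, π, c, h⟩ ⟨hb, rfl⟩
  refine ⟨(π, fun i => (⟨(c i).1, (hb i).1⟩, ⟨(c i).2, (hb i).2⟩)), ?_⟩
  exact dif_pos h

/-- Counts are `ncard`s, which are meaningful for positivity and for disjoint unions only once the
sets are known to be finite. -/
theorem Tiling.finite_grid (T : Tiling) (n : ℕ) : {g | g ∈ T.Grid ∧ g.size = n}.Finite :=
  (finite_inBox T.width T.height n).subset fun _ h => ⟨h.1.1, h.2⟩

theorem Tiling.count_congr {T T' : Tiling} (h : T.Grid = T'.Grid) : T.count = T'.count := by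
  funext n
  simp only [Tiling.count, h]

theorem Tiling.count_eq_of_bijOn {T T' : Tiling} (F : GriddedPerm → GriddedPerm)
    (hF : Set.BijOn F T.Grid T'.Grid) (hs : ∀ g, (F g).size = g.size) : T.count = T'.count := by
  funext n
  refine Set.ncard_congr (fun g _ => F g) ?_ ?_ ?_
  · rintro g ⟨h1, rfl⟩
    exact ⟨hF.mapsTo h1, hs g⟩
  · rintro a b ⟨ha, _⟩ ⟨hb, _⟩ h
    exact hF.injOn ha hb h
  · rintro b ⟨hb, rfl⟩
    obtain ⟨a, ha, rfl⟩ := hF.surjOn hb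
    exact ⟨a, ⟨ha, (hs a).symm⟩, rfl⟩

/-! ### Relabelling the cells by monotone maps -/

/-- Relabel columns by `a` and rows by `b`. -/
def GriddedPerm.mapMono (a b : ℕ →o ℕ) (g : GriddedPerm) : GriddedPerm :=
  ⟨g.size, g.perm, Prod.map a b ∘ g.cell,
    fun _ _ h => a.monotone (g.consistent.1 _ _ h), fun _ _ h => b.monotone (g.consistent.2 _ _ h)⟩

theorem mapMono_cell (a b : ℕ →o ℕ) (g : GriddedPerm) (k : Fin (g.mapMono a b).size) :
    (g.mapMono a b).cell k = Prod.map a b (g.cell k) := rfl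

theorem GriddedPerm.mk_congr {n : ℕ} {π : Equiv.Perm (Fin n)} {c d : Fin n → Cell}
    {hc : Consistent π c} {hd : Consistent π d} (h : ∀ k, c k = d k) :
    (⟨n, π, c, hc⟩ : GriddedPerm) = ⟨n, π, d, hd⟩ := by
  obtain rfl : c = d := funext h
  rfl

/-- Relabelling keeps size and permutation, so two preimages differ in their cells only. Writing the
second one over the data of the first avoids heterogeneous equalities in the injectivity proofs. -/
theorem exists_cell_of_mapMono_eq {a b : ℕ →o ℕ} {g h : GriddedPerm}
    (hgh : g.mapMono a b = h.mapMono a b) :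
    ∃ (c : Fin g.size → Cell) (hc : Consistent g.perm c), h = ⟨g.size, g.perm, c, hc⟩ ∧
      ∀ k, Prod.map a b (c k) = Prod.map a b (g.cell k) := by
  obtain ⟨n, π, c, hc⟩ := g
  obtain ⟨m, σ, d, hd⟩ := h
  obtain ⟨h1, h2, h3⟩ := GriddedPerm.mk.inj hgh
  dsimp only at h1
  subst h1
  obtain rfl := eq_of_heq h2
  exact ⟨d, hd, rfl, fun k => (congrFun (eq_of_heq h3) k).symm⟩

theorem GriddedPerm.consistent_comp {g : GriddedPerm} {k : ℕ} {σ : Equiv.Perm (Fin k)}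
    (f : Fin k ↪o Fin g.size) (hf : ∀ i j, σ i < σ j ↔ g.perm (f i) < g.perm (f j)) :
    Consistent σ (g.cell ∘ f) :=
  ⟨fun _ _ h => g.consistent.1 _ _ (f.lt_iff_lt.2 h),
    fun i j h => g.consistent.2 _ _ ((hf i j).1 h)⟩

/-- The cells `c'` are those that an occurrence visits in `g`; their consistency is inherited from
`g`. -/
theorem mapMono_contains_iff (a b : ℕ →o ℕ) (g o : GriddedPerm) :
    (g.mapMono a b).Contains o ↔ ∃ c' : Fin o.size → Cell,
      (∀ k, Prod.map a b (c' k) = o.cell k) ∧ ∃ h : Consistent o.perm c',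
        g.Contains ⟨o.size, o.perm, c', h⟩ := by
  constructor
  · rintro ⟨f, hf, hc⟩
    exact ⟨g.cell ∘ f, hc, GriddedPerm.consistent_comp (g := g) f hf, f, hf, fun _ => rfl⟩
  · rintro ⟨c', h1, h, f, hf, hc⟩
    refine ⟨f, hf, fun i => ?_⟩
    rw [← h1 i]
    exact congrArg (Prod.map a b) (hc i)

theorem contains_point_iff (g : GriddedPerm) (c : Cell) :
    g.Contains (point c) ↔ ∃ i, g.cell i = c := by
  constructor
  · rintro ⟨f, _, hc⟩
    exact ⟨_, hc (0 : Fin 1)⟩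
  · rintro ⟨i, hi⟩
    refine ⟨⟨⟨fun _ => i, fun a b _ => ?_⟩, ?_⟩, ?_, fun _ => hi⟩
    · exact Subsingleton.elim (α := Fin 1) a b
    · intro a b
      have : a = b := Subsingleton.elim (α := Fin 1) a b
      simp [this]
    · intro a b
      have : a = b := Subsingleton.elim (α := Fin 1) a b
      simp [this]

theorem mem_mapCells {γ : Cell → Cell} {A : Set GriddedPerm} {g : GriddedPerm} :
    g ∈ mapCells γ A ↔
      ∃ o ∈ A, ∃ h : Consistent o.perm (γ ∘ o.cell), g = ⟨o.size, o.perm, γ ∘ o.cell, h⟩ := by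
  simp only [mapCells, Set.mem_iUnion, gridded, Set.mem_ofPred_eq, exists_prop]

/-- If `γ` is a section of a monotone relabelling on the cells of `g`, then patterns of the
relabelled permutation are the images of patterns under `γ`. -/
theorem mapMono_contains_iff_of_section {γ : Cell → Cell} {a b : ℕ →o ℕ}
    (hγ : ∀ c, Prod.map a b (γ c) = c) {g : GriddedPerm}
    (hg : ∀ i, γ (Prod.map a b (g.cell i)) = g.cell i) (o : GriddedPerm) :
    (g.mapMono a b).Contains o ↔
      ∃ h : Consistent o.perm (γ ∘ o.cell), g.Contains ⟨o.size, o.perm, γ ∘ o.cell, h⟩ := by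
  rw [mapMono_contains_iff]
  constructor
  · rintro ⟨c', h1, h, f, hf, hc⟩
    have : c' = γ ∘ o.cell := by
      funext k
      rw [Function.comp_apply, ← h1 k]
      have := hg (f k)
      rw [hc k] at this
      exact this.symm
    subst this
    exact ⟨h, f, hf, hc⟩
  · rintro ⟨h, hc⟩
    exact ⟨_, fun k => hγ _, h, hc⟩

/-! ### Simplification preserves counting sequences -/

/-- Strictly monotone relabellings are injective on cells, so inserting the deleted rows and columns
is a bijection. -/
theorem simplifies_count {T T' : Tiling} (h : Simplifies T T') : T.count = T'.count := by
  obtain ⟨f, g, hf, hg, h⟩ := h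
  refine (Tiling.count_eq_of_bijOn
    (GriddedPerm.mapMono ⟨f, hf.monotone⟩ ⟨g, hg.monotone⟩) ⟨?_, ?_, ?_⟩ fun _ => rfl).symm
  · intro x hx
    rw [h, mem_mapCells]
    exact ⟨x, hx, (GriddedPerm.mapMono ⟨f, hf.monotone⟩ ⟨g, hg.monotone⟩ x).consistent, rfl⟩
  · intro x _ y _ hxy
    obtain ⟨c, hc, rfl, h2⟩ := exists_cell_of_mapMono_eq hxy
    exact GriddedPerm.mk_congr fun k => (hf.injective.prodMap hg.injective (h2 k)).symm
  · intro x hx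
    rw [h, mem_mapCells] at hx
    obtain ⟨o, ho, hc, rfl⟩ := hx
    exact ⟨o, ho, rfl⟩

/-! ### Row and column separation -/

section Separation

variable {T T' : Tiling} {γ : Cell → Cell} {a b : ℕ →o ℕ} {C E : Set GriddedPerm}

/-- Common core of row and column separation: `a, b` merge the split lines, `γ` tells where each old
cell goes, `E` are the new point obstructions and `C` the dropped critical patterns. The
obstructions `E` confine the cells to the range of `γ`, where patterns before and after merging
correspond; the patterns in `C` may be dropped since the new geometry already excludes them. -/
theorem separation_grid (hγ : ∀ c, Prod.map a b (γ c) = c)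
    (hobs : T'.obs = mapCells γ (T.obs \ C) ∪ E) (hreq : T'.req = mapCells γ '' T.req)
    (hE : ∀ g : GriddedPerm, (g.InBox T'.width T'.height ∧ ∀ o ∈ E, ¬ g.Contains o) ↔
      ((g.mapMono a b).InBox T.width T.height ∧ ∀ i, γ (Prod.map a b (g.cell i)) = g.cell i))
    (hC : ∀ g : GriddedPerm, (∀ i, γ (Prod.map a b (g.cell i)) = g.cell i) →
      ∀ o ∈ C, ¬ (g.mapMono a b).Contains o) (g : GriddedPerm) :
    g ∈ T'.Grid ↔ (∀ i, γ (Prod.map a b (g.cell i)) = g.cell i) ∧ g.mapMono a b ∈ T.Grid := by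
  have key : (g.InBox T'.width T'.height ∧ ∀ o ∈ E, ¬ g.Contains o) →
      (∀ i, γ (Prod.map a b (g.cell i)) = g.cell i) := fun h => ((hE g).1 h).2
  have h1 : g ∈ T'.Grid ↔ (g.InBox T'.width T'.height ∧ ∀ o ∈ E, ¬ g.Contains o) ∧
      (∀ o ∈ mapCells γ (T.obs \ C), ¬ g.Contains o) ∧
      ∀ L ∈ T.req, ∃ r ∈ mapCells γ L, g.Contains r := by
    simp only [Tiling.Grid, Set.mem_ofPred_eq, hobs, hreq, Set.mem_union, Set.forall_mem_image,
      or_imp, forall_and]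
    tauto
  rw [h1, hE]
  have h2 : (∀ i, γ (Prod.map a b (g.cell i)) = g.cell i) →
      (((∀ o ∈ mapCells γ (T.obs \ C), ¬ g.Contains o) ↔
        ∀ o ∈ T.obs, ¬ (g.mapMono a b).Contains o) ∧
      ((∀ L ∈ T.req, ∃ r ∈ mapCells γ L, g.Contains r) ↔
        ∀ L ∈ T.req, ∃ r ∈ L, (g.mapMono a b).Contains r)) := by
    intro hs
    constructor
    · constructor
      · intro h o ho
        by_cases hoC : o ∈ C
        · exact hC g hs o hoC
        · rw [mapMono_contains_iff_of_section hγ hs]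
          rintro ⟨hc, hcont⟩
          exact h _ (mem_mapCells.2 ⟨o, ⟨ho, hoC⟩, hc, rfl⟩) hcont
      · intro h o' ho' hcont
        obtain ⟨o, ho, hc, rfl⟩ := mem_mapCells.1 ho'
        exact h o ho.1 ((mapMono_contains_iff_of_section hγ hs o).2 ⟨hc, hcont⟩)
    · refine forall₂_congr fun L _ => ?_
      constructor
      · rintro ⟨r', hr', hcont⟩
        obtain ⟨r, hr, hc, rfl⟩ := mem_mapCells.1 hr'
        exact ⟨r, hr, (mapMono_contains_iff_of_section hγ hs r).2 ⟨hc, hcont⟩⟩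
      · rintro ⟨r, hr, hcont⟩
        obtain ⟨hc, hcont⟩ := (mapMono_contains_iff_of_section hγ hs r).1 hcont
        exact ⟨_, mem_mapCells.2 ⟨r, hr, hc, rfl⟩, hcont⟩
  constructor
  · rintro ⟨⟨hb, hs⟩, ho, hr⟩
    exact ⟨hs, hb, (h2 hs).1.1 ho, (h2 hs).2.1 hr⟩
  · rintro ⟨hs, hb, ho, hr⟩
    exact ⟨⟨hb, hs⟩, (h2 hs).1.2 ho, (h2 hs).2.2 hr⟩

/-- Merging is inverted by applying `γ` to the cells. Only the consistency of the result is not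
formal, and `hcons` asks for it on the grid of `T`, where the critical patterns are avoided. -/
theorem separation_count (hγ : ∀ c, Prod.map a b (γ c) = c)
    (hcons : ∀ g ∈ T.Grid, Consistent g.perm (γ ∘ g.cell))
    (hgrid : ∀ g : GriddedPerm, g ∈ T'.Grid ↔
      (∀ i, γ (Prod.map a b (g.cell i)) = g.cell i) ∧ g.mapMono a b ∈ T.Grid) :
    T.count = T'.count := by
  refine (Tiling.count_eq_of_bijOn (GriddedPerm.mapMono a b) ⟨?_, ?_, ?_⟩ fun _ => rfl).symm
  · exact fun g hg => ((hgrid g).1 hg).2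
  · intro x hx y hy hxy
    obtain ⟨c, hc, rfl, h2⟩ := exists_cell_of_mapMono_eq hxy
    refine GriddedPerm.mk_congr fun k => ?_
    have s1 := ((hgrid _).1 hx).1 k
    have s2 : γ (Prod.map a b (c k)) = c k := ((hgrid _).1 hy).1 k
    rw [← s1, ← s2, h2]
  · rintro g hg
    have hmap : GriddedPerm.mapMono a b ⟨g.size, g.perm, γ ∘ g.cell, hcons g hg⟩ = g :=
      GriddedPerm.mk_congr fun k => hγ _
    refine ⟨_, (hgrid _).2 ⟨fun i => ?_, ?_⟩, hmap⟩
    · exact congrArg γ (hγ _)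
    · rw [hmap]
      exact hg

end Separation

/-- Merge the indices `r` and `r + 1`. -/
def mergeIndex (r : ℕ) : ℕ →o ℕ where
  toFun y := if y ≤ r then y else y - 1
  monotone' x y h := by
    dsimp only
    split_ifs <;> omega

theorem mergeIndex_apply (r y : ℕ) : mergeIndex r y = if y ≤ r then y else y - 1 := rfl

theorem Tiling.cell_mem_nonemptyCells {T : Tiling} {g : GriddedPerm} (hg : g ∈ T.Grid)
    (i : Fin g.size) : g.cell i ∈ T.nonemptyCells :=
  ⟨(hg.1 i).1, (hg.1 i).2, fun h => hg.2.1 _ h ((contains_point_iff _ _).2 ⟨i, rfl⟩)⟩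

/-- Two entries of `g` at increasing positions form an occurrence of a pattern of size two. -/
theorem contains_pair {g : GriddedPerm} {i j : Fin g.size} (hij : i < j)
    {σ : Equiv.Perm (Fin 2)} (hσ : σ 0 < σ 1 ↔ g.perm i < g.perm j)
    (hc : Consistent σ ![g.cell i, g.cell j]) : g.Contains ⟨2, σ, _, hc⟩ := by
  refine ⟨OrderEmbedding.ofStrictMono ![i, j] ?_, ?_, ?_⟩
  · intro a b hab
    fin_cases a <;> fin_cases b <;> simp_all
  · have hne : σ 0 ≠ σ 1 := by simp
    have hne' : g.perm i ≠ g.perm j := by simp [hij.ne]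
    intro a b
    fin_cases a <;> fin_cases b
    · simp
    · exact hσ
    · have h1 : σ 1 < σ 0 ↔ ¬ σ 0 < σ 1 := by
        rw [not_lt]; exact ⟨le_of_lt, fun h => lt_of_le_of_ne h hne.symm⟩
      have h2 : g.perm j < g.perm i ↔ ¬ g.perm i < g.perm j := by
        rw [not_lt]; exact ⟨le_of_lt, fun h => lt_of_le_of_ne h hne'.symm⟩
      exact h1.trans ((not_congr hσ).trans h2.symm)
    · simp
  · intro a
    fin_cases a <;> rfl

theorem consistent_pair {g : GriddedPerm} {i j : Fin g.size} (hij : i < j)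
    {σ : Equiv.Perm (Fin 2)} (hσ : σ 0 < σ 1 ↔ g.perm i < g.perm j) :
    Consistent σ ![g.cell i, g.cell j] := by
  have hne : σ 0 ≠ σ 1 := by simp
  have hne' : g.perm i ≠ g.perm j := by simp [hij.ne]
  constructor
  · intro a b hab
    fin_cases a <;> fin_cases b <;> simp at hab ⊢
    exact g.consistent.1 _ _ hij
  · intro a b hab
    fin_cases a <;> fin_cases b
    · exact le_rfl
    · exact g.consistent.2 _ _ (hσ.1 hab)
    · refine g.consistent.2 _ _ (lt_of_le_of_ne (not_lt.1 fun h => ?_) hne'.symm)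
      exact lt_asymm hab (hσ.2 h)
    · exact le_rfl

theorem Strategy.unary_d_eq_some {Z : Type} {f : Z → Option Z} {T : Z}
    {B : Fin (Strategy.unary f).arity → Z} (h : (Strategy.unary f).d T = some B)
    (i : Fin (Strategy.unary f).arity) : f T = some (B i) := by
  obtain ⟨x, hx, rfl⟩ := Option.map_eq_some_iff.1 h
  exact hx

/-- If an entry in a cell of `S` were above an entry of row `r` outside `S`, the two would form a
critical pattern; so the cells of `S` can be moved below the others. Besides the counts, the grid
itself is characterized, because the list descriptions need it. -/
theorem rowSep_spec {T T' : Tiling} {r : ℕ} {S : Set ℕ} {B : Fin (rowSep r S).arity → Tiling}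
    (h : (rowSep r S).d T = some B) (i : Fin (rowSep r S).arity) (hT' : T' = B i) :
    T.count = T'.count ∧ ∀ g : GriddedPerm, g ∈ T'.Grid ↔
      (∀ i, rowShift r S (Prod.map OrderHom.id (mergeIndex r) (g.cell i)) = g.cell i) ∧
        g.mapMono OrderHom.id (mergeIndex r) ∈ T.Grid := by
  classical
  have h := Strategy.unary_d_eq_some h i
  rw [← hT'] at h
  split_ifs at h with hcond
  obtain ⟨hS, hne, hcrit⟩ := hcond
  replace h := (Option.some.inj h).symm
  have hr : r < T.height := by
    obtain ⟨j, hj⟩ := hS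
    exact (hne j hj).2.1
  have hγ : ∀ c : Cell, Prod.map (OrderHom.id : ℕ →o ℕ) (mergeIndex r) (rowShift r S c) = c := by
    rintro ⟨x, y⟩
    by_cases hc : y < r ∨ (y = r ∧ x ∈ S)
    · have : y ≤ r := by omega
      simp [rowShift, hc, mergeIndex_apply, this]
    · have : ¬ y + 1 ≤ r := by
        push Not at hc; omega
      simp [rowShift, hc, mergeIndex_apply, this]
  have hgrid : ∀ g : GriddedPerm, g ∈ T'.Grid ↔
      (∀ i, rowShift r S (Prod.map OrderHom.id (mergeIndex r) (g.cell i)) = g.cell i) ∧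
        g.mapMono OrderHom.id (mergeIndex r) ∈ T.Grid := by
    subst h
    refine separation_grid (C := criticalRow T r S) hγ (Set.union_assoc _ _ _) rfl ?_ ?_
    · intro g
      have hpt : ∀ x y, (x, y) ∈ Set.range g.cell → g.Contains (point (x, y)) := fun x y h =>
        (contains_point_iff _ _).2 h
      constructor
      · rintro ⟨hb, hE⟩
        have hE1 : ∀ k, (g.cell k).2 = r → (g.cell k).1 ∈ S := by
          intro k hk
          by_contra hS'
          refine hE (point (g.cell k)) (Or.inl ⟨(g.cell k).1, (hb k).1, hS', ?_⟩) (hpt _ _ ⟨k, rfl⟩)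
          rw [← hk]
        have hE2 : ∀ k, (g.cell k).2 = r + 1 → (g.cell k).1 ∉ S := by
          intro k hk hS'
          refine hE (point (g.cell k)) (Or.inr ⟨(g.cell k).1, hS', ?_⟩) (hpt _ _ ⟨k, rfl⟩)
          rw [← hk]
        constructor
        · intro k
          refine ⟨(hb k).1, ?_⟩
          have := (hb k).2
          simp only [mapMono_cell, Prod.map_snd, mergeIndex_apply] at this ⊢
          split_ifs <;> omega
        · intro k
          have h1 := hE1 k
          have h2 := hE2 k
          generalize g.cell k = c at h1 h2 ⊢
          obtain ⟨x, y⟩ := c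
          simp only [Prod.map_apply, OrderHom.id_coe, id_eq, mergeIndex_apply, rowShift]
            at h1 h2 ⊢
          rcases lt_trichotomy y r with hy | hy | hy
          · simp [hy, hy.le]
          · simp [hy, h1 hy]
          · have h3 : ¬ y ≤ r := by omega
            rw [if_neg h3, if_neg]
            · simp; omega
            · rintro (h | ⟨h, h'⟩)
              · omega
              · exact h2 (by omega) h'
      · rintro ⟨hb, hs⟩
        have hb' : g.InBox T.width (T.height + 1) := by
          intro k
          refine ⟨(hb k).1, ?_⟩
          have : mergeIndex r (g.cell k).2 < T.height := (hb k).2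
          rw [mergeIndex_apply] at this
          split_ifs at this <;> omega
        refine ⟨hb', ?_⟩
        rintro o (⟨i, _, hi, rfl⟩ | ⟨i, hi, rfl⟩) hc
        · obtain ⟨k, hk⟩ := (contains_point_iff _ _).1 hc
          have := hs k
          rw [hk] at this
          simp [mergeIndex_apply, rowShift, hi] at this
        · obtain ⟨k, hk⟩ := (contains_point_iff _ _).1 hc
          have := hs k
          rw [hk] at this
          simp [mergeIndex_apply, rowShift, hi] at this
    -- A critical pattern has its higher entry in `S`, hence in row `r`, and its lower entry in row
    -- `r + 1`, against consistency of `g`.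
    · rintro g hs o ⟨i, hi, i', hi', -, hcase⟩ hc
      have hlow : ∀ k, Prod.map (OrderHom.id : ℕ →o ℕ) (mergeIndex r) (g.cell k) = (i, r) →
          (g.cell k).2 = r := by
        intro k hk
        rw [← hs k, hk]
        simp [rowShift, hi]
      have hhigh : ∀ k, Prod.map (OrderHom.id : ℕ →o ℕ) (mergeIndex r) (g.cell k) = (i', r) →
          (g.cell k).2 = r + 1 := by
        intro k hk
        rw [← hs k, hk]
        simp [rowShift, hi']
      rcases hcase with ⟨-, hcons, rfl⟩ | ⟨-, hcons, rfl⟩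
      · obtain ⟨f, hf, hfc⟩ := hc
        have h1 := hlow _ (hfc 0)
        have h2 := hhigh _ (hfc 1)
        have h3 := g.consistent.2 _ _ ((hf 1 0).1 (by change p21 1 < p21 0; decide))
        omega
      · obtain ⟨f, hf, hfc⟩ := hc
        have h1 := hhigh _ (hfc 0)
        have h2 := hlow _ (hfc 1)
        have h3 := g.consistent.2 _ _
          ((hf 0 1).1 (by change (1 : Equiv.Perm (Fin 2)) 0 < (1 : Equiv.Perm (Fin 2)) 1; decide))
        omega
  refine ⟨separation_count hγ ?_ hgrid, hgrid⟩
  intro g hg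
  constructor
  · intro i j hij
    have := g.consistent.1 i j hij
    simp only [Function.comp_apply, rowShift]
    split_ifs <;> exact this
  · intro i j hij
    have h2 := g.consistent.2 i j hij
    have hi := Tiling.cell_mem_nonemptyCells hg i
    have hne' : i ≠ j := by rintro rfl; exact lt_irrefl _ hij
    simp only [Function.comp_apply, rowShift]
    split_ifs with h3 h4 h4
    · exact h2
    · exact h2.trans (Nat.le_succ _)
    -- The only way to lose consistency: `i` moves up although the higher entry `j` stays. Then both
    -- were in row `r`, with `j` in `S` and `i` outside, and they form a critical pattern.
    · exfalso
      have hjr : (g.cell j).2 = r := by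
        push Not at h3
        rcases h4 with h4 | h4
        · omega
        · exact h4.1
      have hir : (g.cell i).2 = r := by
        push Not at h3; omega
      have hiS : (g.cell i).1 ∉ S := by
        push Not at h3; exact h3.2 hir
      have hjS : (g.cell j).1 ∈ S := by
        rcases h4 with h4 | h4
        · omega
        · exact h4.2
      have ei : g.cell i = ((g.cell i).1, r) := by rw [← hir]
      have ej : g.cell j = ((g.cell j).1, r) := by rw [← hjr]
      have hicol : (g.cell i).1 ≠ (g.cell j).1 := fun h => hiS (h ▸ hjS)
      rw [ei] at hi
      rcases lt_or_gt_of_ne hne' with hlt | hlt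
      · have hσ : (1 : Equiv.Perm (Fin 2)) 0 < (1 : Equiv.Perm (Fin 2)) 1 ↔
            g.perm i < g.perm j := iff_of_true (by decide) hij
        refine hg.2.1 _ (hcrit ?_) (contains_pair hlt hσ (consistent_pair hlt hσ))
        refine ⟨_, hjS, _, hiS, hi, Or.inr ⟨lt_of_le_of_ne (g.consistent.1 _ _ hlt) hicol, ?_⟩⟩
        rw [← ei, ← ej]
        exact ⟨_, rfl⟩
      · have hσ : p21 0 < p21 1 ↔ g.perm j < g.perm i := iff_of_false (by decide) hij.asymm
        refine hg.2.1 _ (hcrit ?_) (contains_pair hlt hσ (consistent_pair hlt hσ))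
        refine ⟨_, hjS, _, hiS, hi, Or.inl ⟨lt_of_le_of_ne (g.consistent.1 _ _ hlt) hicol.symm, ?_⟩⟩
        rw [← ei, ← ej]
        exact ⟨_, rfl⟩
    · exact Nat.succ_le_succ h2

/-- Mirror image of `rowSep_spec`, with positions in place of values. -/
theorem colSep_spec {T T' : Tiling} {r : ℕ} {S : Set ℕ} {B : Fin (colSep r S).arity → Tiling}
    (h : (colSep r S).d T = some B) (i : Fin (colSep r S).arity) (hT' : T' = B i) :
    T.count = T'.count ∧ ∀ g : GriddedPerm, g ∈ T'.Grid ↔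
      (∀ i, colShift r S (Prod.map (mergeIndex r) OrderHom.id (g.cell i)) = g.cell i) ∧
        g.mapMono (mergeIndex r) OrderHom.id ∈ T.Grid := by
  classical
  have h := Strategy.unary_d_eq_some h i
  rw [← hT'] at h
  split_ifs at h with hcond
  obtain ⟨hS, hne, hcrit⟩ := hcond
  replace h := (Option.some.inj h).symm
  have hr : r < T.width := by
    obtain ⟨j, hj⟩ := hS
    exact (hne j hj).1
  have hγ : ∀ c : Cell, Prod.map (mergeIndex r) (OrderHom.id : ℕ →o ℕ) (colShift r S c) = c := by
    rintro ⟨x, y⟩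
    by_cases hc : x < r ∨ (x = r ∧ y ∈ S)
    · have : x ≤ r := by omega
      simp [colShift, hc, mergeIndex_apply, this]
    · have : ¬ x + 1 ≤ r := by
        push Not at hc; omega
      simp [colShift, hc, mergeIndex_apply, this]
  have hgrid : ∀ g : GriddedPerm, g ∈ T'.Grid ↔
      (∀ i, colShift r S (Prod.map (mergeIndex r) OrderHom.id (g.cell i)) = g.cell i) ∧
        g.mapMono (mergeIndex r) OrderHom.id ∈ T.Grid := by
    subst h
    refine separation_grid (C := criticalCol T r S) hγ (Set.union_assoc _ _ _) rfl ?_ ?_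
    · intro g
      have hpt : ∀ x y, (x, y) ∈ Set.range g.cell → g.Contains (point (x, y)) := fun x y h =>
        (contains_point_iff _ _).2 h
      constructor
      · rintro ⟨hb, hE⟩
        have hE1 : ∀ k, (g.cell k).1 = r → (g.cell k).2 ∈ S := by
          intro k hk
          by_contra hS'
          refine hE (point (g.cell k)) (Or.inl ⟨(g.cell k).2, (hb k).2, hS', ?_⟩) (hpt _ _ ⟨k, rfl⟩)
          rw [← hk]
        have hE2 : ∀ k, (g.cell k).1 = r + 1 → (g.cell k).2 ∉ S := by
          intro k hk hS'
          refine hE (point (g.cell k)) (Or.inr ⟨(g.cell k).2, hS', ?_⟩) (hpt _ _ ⟨k, rfl⟩)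
          rw [← hk]
        constructor
        · intro k
          refine ⟨?_, (hb k).2⟩
          have := (hb k).1
          simp only [mapMono_cell, Prod.map_fst, mergeIndex_apply] at this ⊢
          split_ifs <;> omega
        · intro k
          have h1 := hE1 k
          have h2 := hE2 k
          generalize g.cell k = c at h1 h2 ⊢
          obtain ⟨x, y⟩ := c
          simp only [Prod.map_apply, OrderHom.id_coe, id_eq, mergeIndex_apply, colShift]
            at h1 h2 ⊢
          rcases lt_trichotomy x r with hy | hy | hy
          · simp [hy, hy.le]
          · simp [hy, h1 hy]
          · have h3 : ¬ x ≤ r := by omega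
            rw [if_neg h3, if_neg]
            · simp; omega
            · rintro (h | ⟨h, h'⟩)
              · omega
              · exact h2 (by omega) h'
      · rintro ⟨hb, hs⟩
        have hb' : g.InBox (T.width + 1) T.height := by
          intro k
          refine ⟨?_, (hb k).2⟩
          have : mergeIndex r (g.cell k).1 < T.width := (hb k).1
          rw [mergeIndex_apply] at this
          split_ifs at this <;> omega
        refine ⟨hb', ?_⟩
        rintro o (⟨i, _, hi, rfl⟩ | ⟨i, hi, rfl⟩) hc
        · obtain ⟨k, hk⟩ := (contains_point_iff _ _).1 hc
          have := hs k
          rw [hk] at this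
          simp [mergeIndex_apply, colShift, hi] at this
        · obtain ⟨k, hk⟩ := (contains_point_iff _ _).1 hc
          have := hs k
          rw [hk] at this
          simp [mergeIndex_apply, colShift, hi] at this
    · rintro g hs o ⟨i, hi, i', hi', -, hcase⟩ hc
      have hlow : ∀ k, Prod.map (mergeIndex r) (OrderHom.id : ℕ →o ℕ) (g.cell k) = (r, i) →
          (g.cell k).1 = r := by
        intro k hk
        rw [← hs k, hk]
        simp [colShift, hi]
      have hhigh : ∀ k, Prod.map (mergeIndex r) (OrderHom.id : ℕ →o ℕ) (g.cell k) = (r, i') →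
          (g.cell k).1 = r + 1 := by
        intro k hk
        rw [← hs k, hk]
        simp [colShift, hi']
      rcases hcase with ⟨-, hcons, rfl⟩ | ⟨-, hcons, rfl⟩
      · obtain ⟨f, hf, hfc⟩ := hc
        have h1 := hhigh _ (hfc 0)
        have h2 := hlow _ (hfc 1)
        have h3 := g.consistent.1 _ _ (f.lt_iff_lt.2 (show (0 : Fin 2) < 1 by decide))
        omega
      · obtain ⟨f, hf, hfc⟩ := hc
        have h1 := hhigh _ (hfc 0)
        have h2 := hlow _ (hfc 1)
        have h3 := g.consistent.1 _ _ (f.lt_iff_lt.2 (show (0 : Fin 2) < 1 by decide))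
        omega
  refine ⟨separation_count hγ ?_ hgrid, hgrid⟩
  intro g hg
  constructor
  · intro i j hij
    have h2 := g.consistent.1 i j hij
    have hi := Tiling.cell_mem_nonemptyCells hg i
    simp only [Function.comp_apply, colShift]
    split_ifs with h3 h4 h4
    · exact h2
    · exact h2.trans (Nat.le_succ _)
    · exfalso
      have hjr : (g.cell j).1 = r := by
        push Not at h3
        rcases h4 with h4 | h4
        · omega
        · exact h4.1
      have hir : (g.cell i).1 = r := by
        push Not at h3; omega
      have hiS : (g.cell i).2 ∉ S := by
        push Not at h3; exact h3.2 hir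
      have hjS : (g.cell j).2 ∈ S := by
        rcases h4 with h4 | h4
        · omega
        · exact h4.2
      have ei : g.cell i = (r, (g.cell i).2) := by rw [← hir]
      have ej : g.cell j = (r, (g.cell j).2) := by rw [← hjr]
      have hirow : (g.cell i).2 ≠ (g.cell j).2 := fun h => hiS (h ▸ hjS)
      have hne' : g.perm i ≠ g.perm j := fun h => hij.ne (g.perm.injective h)
      rw [ei] at hi
      rcases lt_or_gt_of_ne hne' with hlt | hlt
      · have hσ : (1 : Equiv.Perm (Fin 2)) 0 < (1 : Equiv.Perm (Fin 2)) 1 ↔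
            g.perm i < g.perm j := iff_of_true (by decide) hlt
        refine hg.2.1 _ (hcrit ?_) (contains_pair hij hσ (consistent_pair hij hσ))
        refine ⟨_, hjS, _, hiS, hi, Or.inr ⟨lt_of_le_of_ne (g.consistent.2 _ _ hlt) hirow, ?_⟩⟩
        rw [← ei, ← ej]
        exact ⟨_, rfl⟩
      · have hσ : p21 0 < p21 1 ↔ g.perm i < g.perm j := iff_of_false (by decide) hlt.asymm
        refine hg.2.1 _ (hcrit ?_) (contains_pair hij hσ (consistent_pair hij hσ))
        refine ⟨_, hjS, _, hiS, hi, Or.inl ⟨lt_of_le_of_ne (g.consistent.2 _ _ hlt) hirow.symm, ?_⟩⟩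
        rw [← ei, ← ej]
        exact ⟨_, rfl⟩
    · exact Nat.succ_le_succ h2
  · intro i j hij
    have := g.consistent.2 i j hij
    simp only [Function.comp_apply, colShift]
    split_ifs <;> exact this

end CombExp
namespace CombExp

/-! ### Point placement -/

/-- The map `contractIndex p` as a monotone map. -/
def contractHom (p : ℕ) : ℕ →o ℕ where
  toFun := contractIndex p
  monotone' x y h := by
    unfold contractIndex
    split_ifs <;> omega

/-- Contract the `3 × 3` block with lower left cell `c`. -/
def GriddedPerm.contract (c : Cell) (g : GriddedPerm) : GriddedPerm :=
  g.mapMono (contractHom c.1) (contractHom c.2)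

theorem contract_contains_iff (c : Cell) (g o : GriddedPerm) :
    (g.contract c).Contains o ↔ ∃ o' ∈ multiplexes c o, g.Contains o' := by
  refine (mapMono_contains_iff _ _ _ _).trans ⟨?_, ?_⟩
  · rintro ⟨c', h1, h, hc⟩
    exact ⟨_, ⟨c', h1, h, rfl⟩, hc⟩
  · rintro ⟨_, ⟨c', h1, h, rfl⟩, hc⟩
    exact ⟨c', h1, h, hc⟩

/-- `f` is an occurrence of the pattern `h` in `g`. -/
def GriddedPerm.IsOcc (g h : GriddedPerm) (f : Fin h.size ↪o Fin g.size) : Prop :=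
  (∀ i j, h.perm i < h.perm j ↔ g.perm (f i) < g.perm (f j)) ∧ ∀ i, g.cell (f i) = h.cell i

/-- The entry `p` lies in the cell `m`, and is the only entry in the column and the row of `m`. -/
def GriddedPerm.Isolated (g : GriddedPerm) (p : Fin g.size) (m : Cell) : Prop :=
  g.cell p = m ∧ ∀ k, k ≠ p → (g.cell k).1 ≠ m.1 ∧ (g.cell k).2 ≠ m.2

theorem contains_localized_pair {g : GriddedPerm} {i j : Fin g.size} {m : Cell} (hij : i < j)
    {σ : Equiv.Perm (Fin 2)} (hσ : σ 0 < σ 1 ↔ g.perm i < g.perm j) (hi : g.cell i = m)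
    (hj : g.cell j = m) : g.Contains (localized σ m) := by
  have := contains_pair hij hσ (consistent_pair hij hσ)
  convert this using 1
  refine GriddedPerm.mk_congr fun k => ?_
  fin_cases k
  · exact hi.symm
  · exact hj.symm

theorem contains_localized_pair_or {g : GriddedPerm} {i j : Fin g.size} {m : Cell} (hij : i ≠ j)
    (hi : g.cell i = m) (hj : g.cell j = m) :
    g.Contains (localized (1 : Equiv.Perm (Fin 2)) m) ∨ g.Contains (localized p21 m) := by
  wlog h : i < j generalizing i j
  · exact this hij.symm hj hi (lt_of_le_of_ne (not_lt.1 h) hij.symm)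
  by_cases h' : g.perm i < g.perm j
  · exact Or.inl (contains_localized_pair h (iff_of_true (by decide) h') hi hj)
  · exact Or.inr (contains_localized_pair h (iff_of_false (by decide) h') hi hj)

theorem not_contains_localized_pair {g : GriddedPerm} {m : Cell}
    (h : ∀ i j, g.cell i = m → g.cell j = m → i = j) (σ : Equiv.Perm (Fin 2)) :
    ¬ g.Contains (localized σ m) := by
  rintro ⟨f, -, hc⟩
  have := h _ _ (hc (0 : Fin 2)) (hc (1 : Fin 2))
  exact absurd (f.injective this) (show ¬ (0 : Fin 2) = 1 by decide)

/-- The obstructions `12`, `21` allow at most one entry in `m`, the point requirement provides one,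
and the point obstructions empty the rest of the row and column. The box bound matters because those
point obstructions are imposed only inside the box. -/
theorem exists_isolated_iff {g : GriddedPerm} {t u : ℕ} {m : Cell} (hb : g.InBox t u) :
    ((¬ g.Contains (localized (1 : Equiv.Perm (Fin 2)) m) ∧ ¬ g.Contains (localized p21 m)) ∧
      (∀ j, j < u → j ≠ m.2 → ¬ g.Contains (point (m.1, j))) ∧
      (∀ i, i < t → i ≠ m.1 → ¬ g.Contains (point (i, m.2))) ∧ g.Contains (point m)) ↔
    ∃ p, g.Isolated p m := by
  simp only [contains_point_iff]
  constructor
  · rintro ⟨h1, h2, h3, p, hp⟩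
    have hpm : ∀ k, g.cell k = m → k = p := by
      intro k hk
      by_contra hne
      have := contains_localized_pair_or hne hk hp
      tauto
    have hcol : ∀ k, (g.cell k).1 = m.1 → k = p := by
      intro k hk
      by_contra hne
      have h4 : (g.cell k).2 ≠ m.2 := fun h => hne (hpm k (Prod.ext hk h))
      exact h2 _ (hb k).2 h4 ⟨k, Prod.ext hk rfl⟩
    have hrow : ∀ k, (g.cell k).2 = m.2 → k = p := by
      intro k hk
      by_contra hne
      have h4 : (g.cell k).1 ≠ m.1 := fun h => hne (hpm k (Prod.ext h hk))
      exact h3 _ (hb k).1 h4 ⟨k, Prod.ext rfl hk⟩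
    exact ⟨p, hp, fun k hk => ⟨fun h => hk (hcol k h), fun h => hk (hrow k h)⟩⟩
  · rintro ⟨p, hp, h⟩
    have hcol : ∀ k, (g.cell k).1 = m.1 → k = p := fun k hk => by
      by_contra hne
      exact (h k hne).1 hk
    have hrow : ∀ k, (g.cell k).2 = m.2 → k = p := fun k hk => by
      by_contra hne
      exact (h k hne).2 hk
    have huniq : ∀ i j, g.cell i = m → g.cell j = m → i = j := fun i j hi hj => by
      rw [hcol i (by rw [hi]), hcol j (by rw [hj])]
    refine ⟨⟨not_contains_localized_pair huniq _, not_contains_localized_pair huniq _⟩,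
      ?_, ?_, p, hp⟩
    · rintro j _ hj ⟨k, hk⟩
      obtain rfl := hcol k (by rw [hk])
      rw [hp] at hk
      exact hj (by rw [hk])
    · rintro i _ hi ⟨k, hk⟩
      obtain rfl := hrow k (by rw [hk])
      rw [hp] at hk
      exact hi (by rw [hk])

/-- Multiplexes of a pattern occur in `g` exactly when the pattern occurs in the contraction, so all
multiplexed conditions are conditions on the contraction. What remains about `g` itself is the
isolated point, that no occurrence of `h` has its entry `I` beyond it, and that some occurrence has
its entry `I` there. -/
theorem placedTiling_grid (h : GriddedPerm) (I : Fin h.size) (dir : Direction) (T : Tiling)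
    (g : GriddedPerm) : g ∈ (placedTiling h I dir T).Grid ↔
      g.InBox (T.width + 2) (T.height + 2) ∧
      (∀ o ∈ T.obs, ¬ (g.contract (h.cell I)).Contains o) ∧
      (∃ p, g.Isolated p (middle (h.cell I))) ∧
      (∀ f, (g.contract (h.cell I)).IsOcc h f →
        ¬ dir.Further (g.cell (f I)) (middle (h.cell I))) ∧
      (∀ L ∈ T.req, L ≠ {h} → ∃ r ∈ L, (g.contract (h.cell I)).Contains r) ∧
      ∃ f, (g.contract (h.cell I)).IsOcc h f ∧ g.cell (f I) = middle (h.cell I) := by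
  set c := h.cell I with hc
  set m := middle c with hm
  have h1 : (∀ o ∈ multiplexSet c T.obs, ¬ g.Contains o) ↔
      ∀ o ∈ T.obs, ¬ (g.contract c).Contains o := by
    simp only [contract_contains_iff, multiplexSet, Set.mem_iUnion]
    constructor
    · rintro H o ho ⟨o', ho', hgo'⟩
      exact H o' ⟨o, ho, ho'⟩ hgo'
    · rintro H o' ⟨o, ho, ho'⟩ hgo'
      exact H o ho ⟨o', ho', hgo'⟩
  have h2 : (∀ o ∈ furtherMultiplexes h I dir, ¬ g.Contains o) ↔
      ∀ f, (g.contract c).IsOcc h f → ¬ dir.Further (g.cell (f I)) m := by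
    constructor
    · intro H f hf hfur
      exact H _ ⟨g.cell ∘ f, fun k => hf.2 k, hfur,
        GriddedPerm.consistent_comp (g := g) f hf.1, rfl⟩
        ⟨f, hf.1, fun _ => rfl⟩
    · rintro H _ ⟨c', hc', hfur, hcons, rfl⟩ ⟨f, hf, hfc⟩
      refine H f ⟨hf, fun k => ?_⟩ ?_
      · rw [← hc' k]
        exact congrArg (contractCell c) (hfc k)
      · exact (congrArg (fun x => dir.Further x m) (hfc I)).mpr hfur
  have h3 : (∀ L ∈ {L | ∃ L₀ ∈ T.req, L₀ ≠ {h} ∧ L = multiplexSet c L₀}, ∃ r ∈ L, g.Contains r) ↔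
      ∀ L ∈ T.req, L ≠ {h} → ∃ r ∈ L, (g.contract c).Contains r := by
    have aux : ∀ L, (∃ r ∈ multiplexSet c L, g.Contains r) ↔
        ∃ r ∈ L, (g.contract c).Contains r := by
      intro L
      simp only [contract_contains_iff, multiplexSet, Set.mem_iUnion]
      constructor
      · rintro ⟨r', ⟨r, hr, hr'⟩, hgr⟩
        exact ⟨r, hr, r', hr', hgr⟩
      · rintro ⟨r, hr, r', hr', hgr⟩
        exact ⟨r', ⟨r, hr, hr'⟩, hgr⟩
    constructor
    · intro H L hL hne
      exact (aux L).1 (H _ ⟨L, hL, hne, rfl⟩)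
    · rintro H _ ⟨L, hL, hne, rfl⟩
      exact (aux L).2 (H L hL hne)
  -- `pointMultiplex` also asks the other entries to avoid the row and column of `m`. This is
  -- automatic: they differ from `p` by injectivity of the occurrence.
  have h4 : ∀ p, g.Isolated p m → ((∃ r ∈ pointMultiplex h I, g.Contains r) ↔
      ∃ f, (g.contract c).IsOcc h f ∧ g.cell (f I) = m) := by
    rintro p ⟨hp, hiso⟩
    constructor
    · rintro ⟨_, ⟨c', hc', hI, _, hcons, rfl⟩, f, hf, hfc⟩
      refine ⟨f, ⟨hf, fun k => ?_⟩, (hfc I).trans hI⟩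
      rw [← hc' k]
      exact congrArg (contractCell c) (hfc k)
    · rintro ⟨f, hf, hfI⟩
      have hfp : f I = p := by
        by_contra hne
        exact (hiso _ hne).1 (by rw [hfI])
      refine ⟨_, ⟨g.cell ∘ f, fun k => hf.2 k, hfI, fun k hk => hiso (f k) ?_,
        GriddedPerm.consistent_comp (g := g) f hf.1, rfl⟩, f, hf.1, fun _ => rfl⟩
      rw [← hfp]
      exact fun h => hk (f.injective h)
  have h5 : g ∈ (placedTiling h I dir T).Grid ↔ g.InBox (T.width + 2) (T.height + 2) ∧
      (∀ o ∈ multiplexSet c T.obs, ¬ g.Contains o) ∧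
      ((¬ g.Contains (localized (1 : Equiv.Perm (Fin 2)) m) ∧ ¬ g.Contains (localized p21 m)) ∧
      (∀ j, j < T.height + 2 → j ≠ m.2 → ¬ g.Contains (point (m.1, j))) ∧
      (∀ i, i < T.width + 2 → i ≠ m.1 → ¬ g.Contains (point (i, m.2))) ∧ g.Contains (point m)) ∧
      (∀ o ∈ furtherMultiplexes h I dir, ¬ g.Contains o) ∧
      (∀ L ∈ {L | ∃ L₀ ∈ T.req, L₀ ≠ {h} ∧ L = multiplexSet c L₀}, ∃ r ∈ L, g.Contains r) ∧
      (∃ r ∈ pointMultiplex h I, g.Contains r) := by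
    constructor
    · rintro ⟨hb, ho, hr⟩
      refine ⟨hb, fun o h => ho o (Or.inl (Or.inl (Or.inl (Or.inl h)))), ⟨⟨?_, ?_⟩, ?_, ?_, ?_⟩,
        fun o h => ho o (Or.inr h), fun L h => hr L (Or.inl h), ?_⟩
      · exact ho _ (Or.inl (Or.inl (Or.inl (Or.inr (Or.inl rfl)))))
      · exact ho _ (Or.inl (Or.inl (Or.inl (Or.inr (Or.inr rfl)))))
      · exact fun j h1 h2 => ho _ (Or.inl (Or.inl (Or.inr ⟨j, h1, h2, rfl⟩)))
      · exact fun i h1 h2 => ho _ (Or.inl (Or.inr ⟨i, h1, h2, rfl⟩))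
      · obtain ⟨r, hr1, hr2⟩ := hr {point m} (Or.inr (Or.inl rfl))
        rwa [Set.mem_singleton_iff.1 hr1] at hr2
      · exact hr _ (Or.inr (Or.inr rfl))
    · rintro ⟨hb, k1, ⟨⟨k2, k3⟩, k4, k5, k6⟩, k7, k8, k9⟩
      refine ⟨hb, ?_, ?_⟩
      · rintro o ((((h | h | h) | ⟨j, hj, hj', h⟩) | ⟨i, hi, hi', h⟩) | h)
        · exact k1 o h
        · rw [h]; exact k2
        · rw [Set.mem_singleton_iff.1 h]; exact k3
        · rw [h]; exact k4 j hj hj'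
        · rw [h]; exact k5 i hi hi'
        · exact k7 o h
      · rintro L (h | h | h)
        · exact k8 L h
        · rw [h]; exact ⟨_, rfl, k6⟩
        · rw [Set.mem_singleton_iff.1 h]; exact k9
  rw [h5, h1, h2, h3]
  refine and_congr_right fun hb => and_congr_right fun _ => ?_
  rw [exists_isolated_iff hb]
  refine and_congr_right fun ⟨p, hp⟩ => ?_
  rw [h4 p hp]

/-- A rank function on the entries that increases against the direction: the extreme entries are
those of least rank. -/
def Direction.rank : Direction → (g : GriddedPerm) → Fin g.size → ℤ
  | .left, _, x => (x : ℕ)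
  | .right, _, x => -((x : ℕ) : ℤ)
  | .up, g, x => -((g.perm x : ℕ) : ℤ)
  | .down, g, x => ((g.perm x : ℕ) : ℤ)

theorem Direction.rank_injective (dir : Direction) (g : GriddedPerm) :
    Function.Injective (dir.rank g) := by
  intro x y h
  cases dir <;> simp only [Direction.rank, neg_inj, Nat.cast_inj, Fin.val_inj] at h
  · exact h
  · exact h
  · exact g.perm.injective h
  · exact g.perm.injective h

theorem GriddedPerm.lt_iff_of_col {g : GriddedPerm} {x p : Fin g.size}
    (h : (g.cell x).1 ≠ (g.cell p).1) : (g.cell x).1 < (g.cell p).1 ↔ x < p := by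
  refine ⟨fun h1 => not_le.1 fun h2 => ?_, fun h1 => lt_of_le_of_ne (g.consistent.1 _ _ h1) h⟩
  rcases h2.lt_or_eq with h2 | h2
  · exact absurd (g.consistent.1 _ _ h2) (not_le.2 h1)
  · exact h (by rw [h2])

theorem GriddedPerm.lt_iff_of_row {g : GriddedPerm} {x p : Fin g.size}
    (h : (g.cell x).2 ≠ (g.cell p).2) : (g.cell x).2 < (g.cell p).2 ↔ g.perm x < g.perm p := by
  refine ⟨fun h1 => not_le.1 fun h2 => ?_, fun h1 => lt_of_le_of_ne (g.consistent.2 _ _ h1) h⟩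
  rcases h2.lt_or_eq with h2 | h2
  · exact absurd (g.consistent.2 _ _ h2) (not_le.2 h1)
  · exact h (by rw [g.perm.injective h2])

/-- An entry other than `p` is in another column and another row, so comparing cells amounts to
comparing positions or values. -/
theorem GriddedPerm.Isolated.further_iff {g : GriddedPerm} {p : Fin g.size} {m : Cell}
    (hp : g.Isolated p m) (dir : Direction) (x : Fin g.size) :
    dir.Further (g.cell x) m ↔ dir.rank g x < dir.rank g p := by
  obtain ⟨rfl, hiso⟩ := hp
  by_cases hx : x = p
  · subst hx
    cases dir <;> simp [Direction.Further]
  · obtain ⟨h1, h2⟩ := hiso x hx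
    have e1 := GriddedPerm.lt_iff_of_col h1
    have e2 := GriddedPerm.lt_iff_of_row h2
    have e1' := GriddedPerm.lt_iff_of_col h1.symm
    have e2' := GriddedPerm.lt_iff_of_row h2.symm
    cases dir <;> simp only [Direction.Further, Direction.rank, neg_lt_neg_iff, Nat.cast_lt,
      Fin.val_fin_lt, e1, e2, e1', e2']

/-- The index into which `i` is expanded when the block of `c` is split, `lo` telling whether the
entry precedes the placed point. -/
def expandIndex (c i : ℕ) (lo : Prop) [Decidable lo] : ℕ :=
  if i < c then i else if i = c then (if lo then c else c + 2) else i + 2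

theorem contractIndex_expandIndex (c i : ℕ) (lo : Prop) [Decidable lo] :
    contractIndex c (expandIndex c i lo) = i := by
  unfold contractIndex expandIndex
  split_ifs <;> omega

theorem contractIndex_middle (c : ℕ) : contractIndex c (c + 1) = c := by
  unfold contractIndex
  split_ifs <;> omega

theorem eq_expandIndex {c j : ℕ} {lo : Prop} [Decidable lo] (h : j ≠ c + 1) (hlo : j < c + 1 ↔ lo) :
    j = expandIndex c (contractIndex c j) lo := by
  by_cases h' : lo
  · have := hlo.2 h'
    unfold contractIndex expandIndex
    simp only [h', if_true]
    split_ifs <;> omega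
  · have := mt hlo.1 h'
    unfold contractIndex expandIndex
    simp only [h', if_false]
    split_ifs <;> omega

open Classical in
/-- The cells of the multiplex of `g` around `c` with `p` isolated in the middle cell. -/
noncomputable def expandCell (c : Cell) (g : GriddedPerm) (p k : Fin g.size) : Cell :=
  if k = p then middle c else
    (expandIndex c.1 (g.cell k).1 (k < p), expandIndex c.2 (g.cell k).2 (g.perm k < g.perm p))

/-- Isolation leaves no freedom: an entry contracted into the split column lies left or right of the
middle according to its position relative to `p`, and likewise for rows and values. This is the
source of injectivity of the contraction. -/
theorem GriddedPerm.Isolated.cell_eq {c : Cell} {g : GriddedPerm} {p : Fin g.size}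
    (hp : g.Isolated p (middle c)) (k : Fin g.size) :
    g.cell k = expandCell c (g.contract c) p k := by
  classical
  by_cases hk : k = p
  · subst hk
    exact hp.1.trans (if_pos rfl).symm
  · obtain ⟨h1, h2⟩ := hp.2 k hk
    have e1 := GriddedPerm.lt_iff_of_col (g := g) (x := k) (p := p) (by rw [hp.1]; exact h1)
    have e2 := GriddedPerm.lt_iff_of_row (g := g) (x := k) (p := p) (by rw [hp.1]; exact h2)
    rw [hp.1] at e1 e2
    refine Eq.trans ?_ (if_neg hk).symm
    exact Prod.ext (eq_expandIndex h1 e1) (eq_expandIndex h2 e2)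

theorem expandIndex_mono {c i j : ℕ} {lo lo' : Prop} [Decidable lo] [Decidable lo'] (h : i ≤ j)
    (h' : lo' → lo) : expandIndex c i lo ≤ expandIndex c j lo' := by
  unfold expandIndex
  split_ifs <;> first | omega | tauto

theorem expandIndex_le_middle {c i : ℕ} {lo : Prop} [Decidable lo] (h : lo) (hi : i ≤ c) :
    expandIndex c i lo ≤ c + 1 := by
  unfold expandIndex
  split_ifs <;> omega

theorem middle_le_expandIndex {c i : ℕ} {lo : Prop} [Decidable lo] (h : ¬ lo) (hi : c ≤ i) :
    c + 1 ≤ expandIndex c i lo := by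
  unfold expandIndex
  split_ifs <;> omega

theorem expandIndex_ne_middle {c i : ℕ} {lo : Prop} [Decidable lo] :
    expandIndex c i lo ≠ c + 1 := by
  unfold expandIndex
  split_ifs <;> omega

theorem expandCell_consistent {c : Cell} {g : GriddedPerm} {p : Fin g.size} (hp : g.cell p = c) :
    Consistent g.perm (expandCell c g p) := by
  classical
  subst hp
  constructor
  · intro i j hij
    unfold expandCell
    have h0 := g.consistent.1 i j hij
    split_ifs with h1 h2 h2
    · exact le_rfl
    · subst h1
      exact middle_le_expandIndex (not_lt.2 hij.le) h0
    · subst h2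
      exact expandIndex_le_middle hij h0
    · exact expandIndex_mono h0 fun h => hij.trans h
  · intro i j hij
    unfold expandCell
    have h0 := g.consistent.2 i j hij
    split_ifs with h1 h2 h2
    · exact le_rfl
    · subst h1
      exact middle_le_expandIndex (not_lt.2 hij.le) h0
    · subst h2
      exact expandIndex_le_middle hij h0
    · exact expandIndex_mono h0 fun h => hij.trans h

theorem contractIndex_lt {c i t : ℕ} (hc : c < t) (hi : i < t + 2) : contractIndex c i < t := by
  unfold contractIndex
  split_ifs <;> omega

theorem lt_of_contractIndex_lt {c i t : ℕ} (hi : contractIndex c i < t) : i < t + 2 := by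
  unfold contractIndex at hi
  split_ifs at hi <;> omega

/-- Contraction is the bijection. It is injective since the placed point is the extreme one among
the entries `I` of occurrences of `h`, and `expandCell` recovers the cells from it; it is surjective
since `{h}` is required, so an extreme occurrence exists and can be isolated. -/
theorem placedTiling_count {h : GriddedPerm} {I : Fin h.size} {dir : Direction} {T : Tiling}
    (hT : {h} ∈ T.req) (hx : (h.cell I).1 < T.width) (hy : (h.cell I).2 < T.height) :
    T.count = (placedTiling h I dir T).count := by
  classical
  symm
  refine Tiling.count_eq_of_bijOn (GriddedPerm.contract (h.cell I)) ⟨?_, ?_, ?_⟩ fun _ => rfl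
  · intro g hg
    obtain ⟨hb, ho, -, -, hr, f, hf, -⟩ := (placedTiling_grid h I dir T g).1 hg
    refine ⟨fun k => ⟨contractIndex_lt hx (hb k).1, contractIndex_lt hy (hb k).2⟩, ho, ?_⟩
    intro L hL
    by_cases hne : L = {h}
    · rw [hne]
      exact ⟨h, rfl, f, hf⟩
    · exact hr L hL hne
  · intro g hg g' hg' heq
    obtain ⟨-, -, ⟨p, hp⟩, hfur, -, f, hf, hfI⟩ := (placedTiling_grid h I dir T g).1 hg
    obtain ⟨-, -, ⟨p', hp'⟩, hfur', -, f', hf', hfI'⟩ := (placedTiling_grid h I dir T g').1 hg'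
    obtain ⟨d, hd, rfl, -⟩ := exists_cell_of_mapMono_eq heq
    have hfp : f I = p := by
      by_contra hne
      exact (hp.2 _ hne).1 (by rw [hfI])
    have hfp' : f' I = p' := by
      by_contra hne
      exact (hp'.2 _ hne).1 (by rw [hfI'])
    have hcell : ∀ k, (g.contract (h.cell I)).cell k =
        (GriddedPerm.contract (h.cell I) ⟨g.size, g.perm, d, hd⟩).cell k := fun k =>
      congrFun (eq_of_heq (GriddedPerm.mk.inj heq).2.2) k
    have hocc : (g.contract (h.cell I)).IsOcc h f' := ⟨hf'.1, fun k => (hcell _).trans (hf'.2 k)⟩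
    have hocc' : (GriddedPerm.contract (h.cell I) ⟨g.size, g.perm, d, hd⟩).IsOcc h f :=
      ⟨hf.1, fun k => (hcell _).symm.trans (hf.2 k)⟩
    -- Both gridded permutations have the same contraction, so an occurrence through one placed
    -- point is an occurrence for the other. Neither point is beyond the other, and ranks are
    -- injective.
    have i1 := mt (hp.further_iff dir (f' I)).2 (hfur f' hocc)
    have i2 := mt (hp'.further_iff dir (f I)).2 (hfur' f hocc')
    have hpp : p = p' := by
      rw [hfp'] at i1
      rw [hfp] at i2
      refine dir.rank_injective g (le_antisymm (not_lt.1 i1) ?_)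
      -- Ranks use only positions and values, which the two gridded permutations share; this holds
      -- by computation once the direction is fixed.
      cases dir <;> exact not_lt.1 i2
    subst hpp
    refine GriddedPerm.mk_congr fun k => ?_
    refine (hp.cell_eq k).trans (Eq.trans ?_ (hp'.cell_eq k).symm)
    by_cases hk : k = p
    · exact (if_pos hk).trans (if_pos hk).symm
    · refine (if_neg hk).trans (Eq.trans ?_ (if_neg hk).symm)
      exact Prod.ext
        (congrArg (fun x : Cell => expandIndex (h.cell I).1 x.1 (k < p)) (hcell k))
        (congrArg (fun x : Cell => expandIndex (h.cell I).2 x.2 (g.perm k < g.perm p)) (hcell k))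
  · intro g hg
    obtain ⟨f₀, hf₀⟩ : ∃ f, g.IsOcc h f := by
      obtain ⟨r, hr, hgr⟩ := hg.2.2 _ hT
      rw [Set.mem_singleton_iff.1 hr] at hgr
      exact hgr
    -- Least rank means furthest in the direction; the point to be isolated is this extreme entry.
    obtain ⟨p, hp, hmin⟩ := Set.exists_min_image {x | ∃ f, g.IsOcc h f ∧ f I = x} (dir.rank g)
      (Set.toFinite _) ⟨_, f₀, hf₀, rfl⟩
    obtain ⟨f, hf, hfI⟩ := hp
    have hpc : g.cell p = h.cell I := by rw [← hfI]; exact hf.2 I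
    let g' : GriddedPerm := ⟨g.size, g.perm, expandCell (h.cell I) g p, expandCell_consistent hpc⟩
    have hgg' : g'.contract (h.cell I) = g := by
      refine GriddedPerm.mk_congr fun k => ?_
      rw [Function.comp_apply]
      by_cases hk : k = p
      · have : g'.cell k = middle (h.cell I) := if_pos hk
        rw [this, hk, hpc]
        exact Prod.ext (contractIndex_middle _) (contractIndex_middle _)
      · have : g'.cell k = (expandIndex (h.cell I).1 (g.cell k).1 (k < p),
          expandIndex (h.cell I).2 (g.cell k).2 (g.perm k < g.perm p)) := if_neg hk
        rw [this]
        exact Prod.ext (contractIndex_expandIndex _ _ _) (contractIndex_expandIndex _ _ _)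
    have hiso : g'.Isolated p (middle (h.cell I)) := by
      refine ⟨if_pos rfl, fun k hk => ?_⟩
      have : g'.cell k = (expandIndex (h.cell I).1 (g.cell k).1 (k < p),
          expandIndex (h.cell I).2 (g.cell k).2 (g.perm k < g.perm p)) := if_neg hk
      rw [this]
      exact ⟨expandIndex_ne_middle, expandIndex_ne_middle⟩
    have hcell : ∀ k, contractCell (h.cell I) (g'.cell k) = g.cell k := fun k =>
      congrFun (eq_of_heq (GriddedPerm.mk.inj hgg').2.2) k
    refine ⟨g', (placedTiling_grid h I dir T g').2 ?_, hgg'⟩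
    refine ⟨fun k => ?_, ?_, ⟨p, hiso⟩, ?_, ?_, f, ⟨hf.1, fun k => (hcell _).trans (hf.2 k)⟩, ?_⟩
    · have := hg.1 k
      rw [← hcell k] at this
      exact ⟨lt_of_contractIndex_lt this.1, lt_of_contractIndex_lt this.2⟩
    · rw [hgg']
      exact hg.2.1
    · intro f' hf'
      refine mt (hiso.further_iff dir (f' I)).1 ?_
      have := hmin (f' I) ⟨f', ⟨hf'.1, fun k => (hcell _).symm.trans (hf'.2 k)⟩, rfl⟩
      cases dir <;> exact not_lt.2 this
    · rw [hgg']
      exact fun L hL _ => hg.2.2 L hL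
    · exact (congrArg g'.cell hfI).trans hiso.1

theorem pointPl_spec {h : GriddedPerm} {I : Fin h.size} {dir : Direction} {T : Tiling}
    {B : Fin (pointPl h I dir).arity → Tiling} (hB : (pointPl h I dir).d T = some B)
    (i : Fin (pointPl h I dir).arity) : T.count = (B i).count := by
  have := Strategy.unary_d_eq_some hB i
  split_ifs at this with hc
  rw [← Option.some.inj this]
  exact placedTiling_count hc.1 hc.2.1 hc.2.2

theorem equivalent_count {T T' : Tiling} (h : Equivalent T T') : T.count = T'.count := by
  induction h with
  | rel T T' h =>
    cases h with
    | simplify _ _ h => exact simplifies_count h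
    | pointPl h I dir _ B i hB => exact pointPl_spec hB i
    | rowSep r S _ B i hB => exact (rowSep_spec hB i rfl).1
    | colSep r S _ B i hB => exact (colSep_spec hB i rfl).1
  | refl => rfl
  | symm _ _ _ ih => exact ih.symm
  | trans _ _ _ _ _ ih1 ih2 => exact ih1.trans ih2

end CombExp
-- Product decompositions: restriction, merging, factors
namespace CombExp

/-! ### Gridded permutations from point sets -/

section Assemble

variable {E K : Type*} [Fintype E] [LinearOrder K]

theorem exists_rankEquiv (p : E → K) (hp : Function.Injective p) :
    ∃ e : E ≃ Fin (Fintype.card E), ∀ x y, e x < e y ↔ p x < p y := by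
  let _ : LinearOrder E := LinearOrder.lift' p hp
  exact ⟨(monoEquivOfFin E rfl).symm.toEquiv, fun x y => (monoEquivOfFin E rfl).symm.lt_iff_lt⟩

/-- The rank of an element of `E` with respect to an injective key. -/
noncomputable def rankEquiv (p : E → K) (hp : Function.Injective p) : E ≃ Fin (Fintype.card E) :=
  (exists_rankEquiv p hp).choose

theorem rankEquiv_lt (p : E → K) (hp : Function.Injective p) (x y : E) :
    rankEquiv p hp x < rankEquiv p hp y ↔ p x < p y :=
  (exists_rankEquiv p hp).choose_spec x y

/-- `g` is the gridded permutation of the points of `E`, with horizontal positions `p`, vertical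
positions `v` and cells `c`, under the bijection `e`. -/
structure IsPlot {L : Type*} [LinearOrder L] (g : GriddedPerm) (p : E → K) (v : E → L)
    (c : E → Cell) (e : E ≃ Fin g.size) : Prop where
  pos : ∀ x y, e x < e y ↔ p x < p y
  val : ∀ x y, g.perm (e x) < g.perm (e y) ↔ v x < v y
  cell : ∀ x, g.cell (e x) = c x

/-- Standardization: rank the points horizontally and vertically, and let the permutation send the
first rank to the second. -/
theorem exists_isPlot {L : Type*} [LinearOrder L] (p : E → K) (v : E → L) (c : E → Cell)
    (hp : Function.Injective p) (hv : Function.Injective v)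
    (h1 : ∀ x y, p x < p y → (c x).1 ≤ (c y).1) (h2 : ∀ x y, v x < v y → (c x).2 ≤ (c y).2) :
    ∃ (g : GriddedPerm) (e : E ≃ Fin g.size), IsPlot g p v c e := by
  refine ⟨⟨Fintype.card E, (rankEquiv p hp).symm.trans (rankEquiv v hv),
    c ∘ (rankEquiv p hp).symm, fun i j h => ?_, fun i j h => ?_⟩, rankEquiv p hp, ?_, ?_, ?_⟩
  · apply h1
    rw [← rankEquiv_lt p hp]
    simpa using h
  · apply h2
    rw [← rankEquiv_lt v hv]
    simpa using h
  · exact rankEquiv_lt p hp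
  · intro x y
    simp [rankEquiv_lt]
  · intro x
    simp

end Assemble

/-! ### Restriction to a set of cells -/

open Classical in
theorem exists_restrict (g : GriddedPerm) (P : Set Cell) :
    ∃ (h : GriddedPerm) (e : {x : Fin g.size // g.cell x ∈ P} ≃ Fin h.size),
      IsPlot h (fun x : {x : Fin g.size // g.cell x ∈ P} => x.1) (fun x => g.perm x.1)
        (fun x => g.cell x.1) e :=
  exists_isPlot _ _ _ Subtype.val_injective (g.perm.injective.comp Subtype.val_injective)
    (fun _ _ h => g.consistent.1 _ _ h) (fun _ _ h => g.consistent.2 _ _ h)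

/-- The gridded permutation formed by the entries of `g` in the cells of `P`. -/
noncomputable def GriddedPerm.restrict (g : GriddedPerm) (P : Set Cell) : GriddedPerm :=
  (exists_restrict g P).choose

/-- The entries of the restriction. -/
noncomputable def restrictEquiv (g : GriddedPerm) (P : Set Cell) :
    {x : Fin g.size // g.cell x ∈ P} ≃ Fin (g.restrict P).size :=
  (exists_restrict g P).choose_spec.choose

open Classical in
theorem isPlot_restrict (g : GriddedPerm) (P : Set Cell) :
    IsPlot (g.restrict P) (fun x : {x : Fin g.size // g.cell x ∈ P} => x.1) (fun x => g.perm x.1)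
        (fun x => g.cell x.1) (restrictEquiv g P) :=
  (exists_restrict g P).choose_spec.choose_spec

theorem restrict_cell_mem (g : GriddedPerm) (P : Set Cell) (k : Fin (g.restrict P).size) :
    (g.restrict P).cell k ∈ P := by
  obtain ⟨x, rfl⟩ := (restrictEquiv g P).surjective k
  rw [(isPlot_restrict g P).cell]
  exact x.2

theorem restrict_contains_iff (g o : GriddedPerm) (P : Set Cell) :
    (g.restrict P).Contains o ↔ g.Contains o ∧ o.Within P := by
  have H := isPlot_restrict g P
  constructor
  · rintro ⟨f, hf, hfc⟩
    refine ⟨⟨OrderEmbedding.ofStrictMono (fun k => ((restrictEquiv g P).symm (f k)).1) ?_, ?_, ?_⟩,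
      fun k => ?_⟩
    · intro i j hij
      rw [← H.pos]
      simpa using hij
    · intro i j
      rw [hf]
      have := H.val ((restrictEquiv g P).symm (f i)) ((restrictEquiv g P).symm (f j))
      rw [Equiv.apply_symm_apply, Equiv.apply_symm_apply] at this
      exact this
    · intro i
      have := H.cell ((restrictEquiv g P).symm (f i))
      rw [Equiv.apply_symm_apply] at this
      exact this.symm.trans (hfc i)
    · rw [← hfc k]
      exact restrict_cell_mem g P _
  · rintro ⟨⟨f, hf, hfc⟩, hP⟩
    have hm : ∀ k, g.cell (f k) ∈ P := fun k => by rw [hfc]; exact hP k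
    refine ⟨OrderEmbedding.ofStrictMono (fun k => restrictEquiv g P ⟨f k, hm k⟩) ?_, ?_, ?_⟩
    · intro i j hij
      rw [H.pos]
      simpa using hij
    · intro i j
      rw [hf]
      exact (H.val ⟨f i, hm i⟩ ⟨f j, hm j⟩).symm
    · intro i
      exact (H.cell ⟨f i, hm i⟩).trans (hfc i)

/-! ### Merging gridded permutations on parts that share no row and no column -/

section Merge

variable {m : ℕ} {P : Fin m → Set Cell}

/-- Different parts share no row and no column. -/
def Separated (P : Fin m → Set Cell) : Prop :=
  ∀ i j, i ≠ j → ∀ a ∈ P i, ∀ b ∈ P j, a.1 ≠ b.1 ∧ a.2 ≠ b.2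

/-- The horizontal position of an entry of a tuple of gridded permutations. -/
def posKey (t : Fin m → GriddedPerm) (x : Σ i, Fin (t i).size) : ℕ ×ₗ ℕ :=
  toLex (((t x.1).cell x.2).1, (x.2 : ℕ))

/-- The vertical position of an entry of a tuple of gridded permutations. -/
def valKey (t : Fin m → GriddedPerm) (x : Σ i, Fin (t i).size) : ℕ ×ₗ ℕ :=
  toLex (((t x.1).cell x.2).2, ((t x.1).perm x.2 : ℕ))

theorem Separated.eq_of_col (hP : Separated P) {i j : Fin m} {a b : Cell} (ha : a ∈ P i)
    (hb : b ∈ P j) (h : a.1 = b.1) : i = j := by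
  by_contra hij
  exact (hP i j hij a ha b hb).1 h

theorem Separated.eq_of_row (hP : Separated P) {i j : Fin m} {a b : Cell} (ha : a ∈ P i)
    (hb : b ∈ P j) (h : a.2 = b.2) : i = j := by
  by_contra hij
  exact (hP i j hij a ha b hb).2 h

/-- Ties in the column or row are possible only within one part, because the parts are separated;
there the position or value inside that part breaks them. Hence both lexicographic keys are
injective. -/
theorem exists_merge (hP : Separated P) (t : Fin m → GriddedPerm)
    (ht : ∀ i, (t i).Within (P i)) :
    ∃ (g : GriddedPerm) (e : (Σ i, Fin (t i).size) ≃ Fin g.size),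
      IsPlot g (posKey t) (valKey t) (fun x => (t x.1).cell x.2) e := by
  refine exists_isPlot _ _ _ ?_ ?_ ?_ ?_
  · rintro ⟨i, x⟩ ⟨j, y⟩ h
    obtain ⟨h1, h2⟩ := Prod.mk.inj (toLex.injective h)
    obtain rfl := hP.eq_of_col (ht _ _) (ht _ _) h1
    obtain rfl := Fin.ext h2
    rfl
  · rintro ⟨i, x⟩ ⟨j, y⟩ h
    obtain ⟨h1, h2⟩ := Prod.mk.inj (toLex.injective h)
    obtain rfl := hP.eq_of_row (ht _ _) (ht _ _) h1
    obtain rfl := (t i).perm.injective (Fin.ext h2)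
    rfl
  · intro x y h
    rcases Prod.Lex.toLex_lt_toLex.1 h with h | h
    · exact h.le
    · exact h.1.le
  · intro x y h
    rcases Prod.Lex.toLex_lt_toLex.1 h with h | h
    · exact h.le
    · exact h.1.le

theorem posKey_lt_iff (t : Fin m → GriddedPerm) (i : Fin m) (x y : Fin (t i).size) :
    posKey t ⟨i, x⟩ < posKey t ⟨i, y⟩ ↔ x < y := by
  refine Prod.Lex.toLex_lt_toLex.trans ⟨?_, fun h => ?_⟩
  · rintro (h | h)
    · exact (GriddedPerm.lt_iff_of_col h.ne).1 h
    · exact h.2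
  · rcases ((t i).consistent.1 x y h).lt_or_eq with h' | h'
    · exact Or.inl h'
    · exact Or.inr ⟨h', h⟩

theorem valKey_lt_iff (t : Fin m → GriddedPerm) (i : Fin m) (x y : Fin (t i).size) :
    valKey t ⟨i, x⟩ < valKey t ⟨i, y⟩ ↔ (t i).perm x < (t i).perm y := by
  refine Prod.Lex.toLex_lt_toLex.trans ⟨?_, fun h => ?_⟩
  · rintro (h | h)
    · exact (GriddedPerm.lt_iff_of_row h.ne).1 h
    · exact h.2
  · rcases ((t i).consistent.2 x y h).lt_or_eq with h' | h'
    · exact Or.inl h'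
    · exact Or.inr ⟨h', h⟩

theorem restrict_merge (hP : Separated P) {t : Fin m → GriddedPerm}
    (ht : ∀ i, (t i).Within (P i)) {g : GriddedPerm} {e : (Σ i, Fin (t i).size) ≃ Fin g.size}
    (H : IsPlot g (posKey t) (valKey t) (fun x => (t x.1).cell x.2) e) (i : Fin m) :
    g.restrict (P i) = t i := by
  have R := isPlot_restrict g (P i)
  have hmem : ∀ x : Fin (t i).size, g.cell (e ⟨i, x⟩) ∈ P i := fun x => by
    rw [H.cell]
    exact ht i x
  let F : Fin (t i).size → Fin (g.restrict (P i)).size :=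
    fun x => restrictEquiv g (P i) ⟨e ⟨i, x⟩, hmem x⟩
  have hF : Function.Bijective F := by
    constructor
    · intro x y h
      have := congrArg Subtype.val ((restrictEquiv g (P i)).injective h)
      simpa using e.injective this
    · intro k
      obtain ⟨⟨z, hz⟩, rfl⟩ := (restrictEquiv g (P i)).surjective k
      obtain ⟨⟨j, x⟩, rfl⟩ := e.surjective z
      rw [H.cell] at hz
      obtain rfl : j = i := hP.eq_of_col (ht j x) hz rfl
      exact ⟨x, rfl⟩
  symm
  refine GriddedPerm.eq_of_iso (Equiv.ofBijective F hF) ?_ ?_ ?_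
  · intro x y
    refine Iff.symm ((R.pos _ _).trans ((H.pos _ _).trans ?_))
    exact posKey_lt_iff t i x y
  · intro x y
    refine Iff.symm ((R.val _ _).trans ((H.val _ _).trans ?_))
    exact valKey_lt_iff t i x y
  · intro x
    exact (R.cell _).trans (H.cell _)

/-- Within a part the keys reproduce the order of `g`; across parts the columns and rows differ and
consistency of `g` decides the order. The hypothesis `hg` guarantees that no entry of `g` is lost.
-/
theorem merge_restrict (hP : Separated P) {g : GriddedPerm} (hg : g.Within (⋃ i, P i))
    {g' : GriddedPerm} {e : (Σ i, Fin (g.restrict (P i)).size) ≃ Fin g'.size}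
    (H : IsPlot g' (posKey fun i => g.restrict (P i)) (valKey fun i => g.restrict (P i))
      (fun x => (g.restrict (P x.1)).cell x.2) e) : g' = g := by
  let F : (Σ i, Fin (g.restrict (P i)).size) → Fin g.size :=
    fun x => ((restrictEquiv g (P x.1)).symm x.2).1
  have hFc : ∀ x, (g.restrict (P x.1)).cell x.2 = g.cell (F x) := by
    intro x
    have := (isPlot_restrict g (P x.1)).cell ((restrictEquiv g (P x.1)).symm x.2)
    rwa [Equiv.apply_symm_apply] at this
  have hFm : ∀ x, g.cell (F x) ∈ P x.1 := fun x => ((restrictEquiv g (P x.1)).symm x.2).2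
  have hF : Function.Bijective F := by
    constructor
    · rintro ⟨i, x⟩ ⟨j, y⟩ h
      have hi := hFm ⟨i, x⟩
      rw [h] at hi
      obtain rfl : i = j := hP.eq_of_col hi (hFm ⟨j, y⟩) rfl
      have := (restrictEquiv g (P i)).symm.injective (Subtype.ext h)
      dsimp only at this
      rw [this]
    · intro z
      obtain ⟨i, hi⟩ := Set.mem_iUnion.1 (hg z)
      refine ⟨⟨i, restrictEquiv g (P i) ⟨z, hi⟩⟩, ?_⟩
      exact congrArg Subtype.val (Equiv.symm_apply_apply _ _)
  refine GriddedPerm.eq_of_iso (e.symm.trans (Equiv.ofBijective F hF)) ?_ ?_ ?_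
  · intro a b
    obtain ⟨x, rfl⟩ := e.surjective a
    obtain ⟨y, rfl⟩ := e.surjective b
    simp only [Equiv.trans_apply, Equiv.symm_apply_apply, Equiv.ofBijective_apply]
    rw [H.pos]
    by_cases hxy : x.1 = y.1
    · obtain ⟨i, x⟩ := x
      obtain ⟨j, y⟩ := y
      dsimp only at hxy
      subst hxy
      rw [posKey_lt_iff, ← (restrictEquiv g (P i)).apply_symm_apply x,
        ← (restrictEquiv g (P i)).apply_symm_apply y, (isPlot_restrict g (P i)).pos]
      simp [F]
    · have hne := (hP _ _ hxy _ (hFm x) _ (hFm y)).1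
      refine Prod.Lex.toLex_lt_toLex.trans ?_
      dsimp only
      rw [hFc x, hFc y]
      exact ⟨fun h => (GriddedPerm.lt_iff_of_col hne).1 (h.resolve_right fun h => hne h.1),
        fun h => Or.inl ((GriddedPerm.lt_iff_of_col hne).2 h)⟩
  · intro a b
    obtain ⟨x, rfl⟩ := e.surjective a
    obtain ⟨y, rfl⟩ := e.surjective b
    simp only [Equiv.trans_apply, Equiv.symm_apply_apply, Equiv.ofBijective_apply]
    rw [H.val]
    by_cases hxy : x.1 = y.1
    · obtain ⟨i, x⟩ := x
      obtain ⟨j, y⟩ := y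
      dsimp only at hxy
      subst hxy
      rw [valKey_lt_iff, ← (restrictEquiv g (P i)).apply_symm_apply x,
        ← (restrictEquiv g (P i)).apply_symm_apply y, (isPlot_restrict g (P i)).val]
      simp [F]
    · have hne := (hP _ _ hxy _ (hFm x) _ (hFm y)).2
      refine Prod.Lex.toLex_lt_toLex.trans ?_
      dsimp only
      rw [hFc x, hFc y]
      exact ⟨fun h => (GriddedPerm.lt_iff_of_row hne).1 (h.resolve_right fun h => hne h.1),
        fun h => Or.inl ((GriddedPerm.lt_iff_of_row hne).2 h)⟩
  · intro a
    obtain ⟨x, rfl⟩ := e.surjective a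
    simp only [Equiv.trans_apply, Equiv.symm_apply_apply, Equiv.ofBijective_apply]
    rw [H.cell, hFc]

end Merge

/-! ### The factor strategy -/

section Factor

variable {m : ℕ} {P : Fin m → Set Cell} {T : Tiling}

theorem subtiling_within {i : Fin m} {g : GriddedPerm} (hg : g ∈ (subtiling P T i).Grid) :
    g.Within (P i) := by
  intro k
  by_contra hk
  exact hg.2.1 _ (Or.inr ⟨g.cell k, (hg.1 k).1, (hg.1 k).2, hk, rfl⟩)
    ((contains_point_iff _ _).2 ⟨k, rfl⟩)

theorem GriddedPerm.Contains.within {g h : GriddedPerm} (hgh : g.Contains h) {p : Set Cell}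
    (hg : g.Within p) : h.Within p := by
  obtain ⟨f, _, hc⟩ := hgh
  intro k
  rw [← hc]
  exact hg _

theorem restrict_inBox {t u : ℕ} {g : GriddedPerm} (hg : g.InBox t u) (p : Set Cell) :
    (g.restrict p).InBox t u := by
  intro k
  obtain ⟨x, rfl⟩ := (restrictEquiv g p).surjective k
  rw [(isPlot_restrict g p).cell]
  exact hg _

/-- By non-interaction an obstruction that fits in the union of the parts lies in a single part, and
the relevant members of a requirement list do too. Thus each condition on `g` is a condition on one
restriction. -/
theorem mem_grid_iff_restrict (hm : 0 < m) (hU : (⋃ i, P i) = T.nonemptyCells)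
    (hN : ∀ i j, i ≠ j → NonInteracting T (P i) (P j)) (g : GriddedPerm) :
    g ∈ T.Grid ↔ g.Within (⋃ i, P i) ∧ ∀ i, g.restrict (P i) ∈ (subtiling P T i).Grid := by
  have hwithin : ∀ (h : GriddedPerm) (i : Fin m), h.Within (⋃ i, P i) →
      (∀ j, j ≠ i → ¬ h.Involves (P j)) → h.Within (P i) := by
    intro h i hh hj k
    obtain ⟨j, hk⟩ := Set.mem_iUnion.1 (hh k)
    by_cases hji : j = i
    · exact hji ▸ hk
    · exact absurd ⟨k, hk⟩ (hj j hji)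
  constructor
  · intro hg
    have hw : g.Within (⋃ i, P i) := fun k => by
      rw [hU]
      exact Tiling.cell_mem_nonemptyCells hg k
    refine ⟨hw, fun i => ⟨restrict_inBox hg.1 _, ?_, ?_⟩⟩
    · rintro o (⟨ho, -⟩ | ⟨c, -, -, hc, rfl⟩) hcont
      · exact hg.2.1 o ho ((restrict_contains_iff _ _ _).1 hcont).1
      · exact hc (((restrict_contains_iff _ _ _).1 hcont).2 (0 : Fin 1))
    · rintro _ ⟨L, hL, hLj, rfl⟩
      obtain ⟨h, hhL, hgh⟩ := hg.2.2 L hL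
      have hhw := hwithin h i (hgh.within hw) fun j hj => hLj j hj h hhL
      exact ⟨h, ⟨hhL, hhw⟩, (restrict_contains_iff _ _ _).2 ⟨hgh, hhw⟩⟩
  · rintro ⟨hw, hg⟩
    refine ⟨fun k => ?_, ?_, ?_⟩
    · have := hw k
      rw [hU] at this
      exact ⟨this.1, this.2.1⟩
    · intro o ho hgo
      have how := hgo.within hw
      obtain ⟨i, hi⟩ : ∃ i, o.Within (P i) := by
        by_cases h : ∃ i, o.Involves (P i)
        · obtain ⟨i, hi⟩ := h
          exact ⟨i, hwithin o i how fun j hj hoj => (hN i j hj.symm).2.1 o ho ⟨hi, hoj⟩⟩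
        · push Not at h
          exact ⟨⟨0, hm⟩, hwithin o _ how fun j _ => h j⟩
      exact (hg i).2.1 o (Or.inl ⟨ho, hi⟩) ((restrict_contains_iff _ _ _).2 ⟨hgo, hi⟩)
    · intro L hL
      obtain ⟨i, hi⟩ : ∃ i, ∀ j, j ≠ i → ∀ h ∈ L, ¬ h.Involves (P j) := by
        by_cases h : ∃ i, ∃ h ∈ L, h.Involves (P i)
        · obtain ⟨i, hi⟩ := h
          exact ⟨i, fun j hj h hh hoj => (hN i j hj.symm).2.2 L hL ⟨hi, h, hh, hoj⟩⟩
        · push Not at h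
          exact ⟨⟨0, hm⟩, fun j _ => h j⟩
      obtain ⟨h, hh, hgh⟩ := (hg i).2.2 _ ⟨L, hL, hi, rfl⟩
      exact ⟨h, hh.1, ((restrict_contains_iff _ _ _).1 hgh).1⟩

/-- Restriction and merging turn a gridded permutation of size `n` into a tuple of objects of the
factors with total size `n`; sorting the tuples by their sizes gives the convolution. -/
theorem count_eq_sum_prod (hm : 0 < m) (hU : (⋃ i, P i) = T.nonemptyCells)
    (hN : ∀ i j, i ≠ j → NonInteracting T (P i) (P j)) (n : ℕ) :
    T.count n = ∑ k ∈ Finset.piAntidiag (Finset.univ : Finset (Fin m)) n,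
      ∏ i, (subtiling P T i).count (k i) := by
  classical
  have hP : Separated P := fun i j hij => (hN i j hij).1
  have hfin : ∀ (T : Tiling) n, Finite {g // g ∈ T.Grid ∧ g.size = n} := fun T n =>
    (T.finite_grid n).to_subtype
  have hcard : ∀ (T : Tiling) n, T.count n = Nat.card {g // g ∈ T.Grid ∧ g.size = n} :=
    fun T n => rfl
  have hmerge := fun t ht => exists_merge hP t ht
  choose M e hM using hmerge
  have hsize : ∀ t ht, (M t ht).size = ∑ i, (t i).size := by
    intro t ht
    have := Fintype.card_congr (e t ht)
    simp only [Fintype.card_sigma, Fintype.card_fin] at this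
    exact this.symm
  let X := Σ k : {k // k ∈ Finset.piAntidiag (Finset.univ : Finset (Fin m)) n},
    ∀ i, {g // g ∈ (subtiling P T i).Grid ∧ g.size = k.1 i}
  have hw : ∀ (x : X) i, (x.2 i).1.Within (P i) := fun x i => subtiling_within (x.2 i).2.1
  have hres : ∀ (x : X) i, (M _ (hw x)).restrict (P i) = (x.2 i).1 := fun x i =>
    restrict_merge hP (hw x) (hM _ (hw x)) i
  have hmw : ∀ x : X, (M _ (hw x)).Within (⋃ i, P i) := by
    intro x k
    obtain ⟨z, rfl⟩ := (e _ (hw x)).surjective k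
    rw [(hM _ (hw x)).cell]
    exact Set.mem_iUnion.2 ⟨z.1, hw x z.1 z.2⟩
  let F : X → {g // g ∈ T.Grid ∧ g.size = n} := fun x =>
    ⟨M _ (hw x), (mem_grid_iff_restrict hm hU hN _).2 ⟨hmw x, fun i => by
      rw [hres]
      exact (x.2 i).2.1⟩, by
      rw [hsize, Finset.sum_congr rfl fun i _ => (x.2 i).2.2]
      exact (Finset.mem_piAntidiag.1 x.1.2).1⟩
  have hF : Function.Bijective F := by
    constructor
    · intro x y hxy
      have h1 : ∀ i, (x.2 i).1 = (y.2 i).1 := fun i => by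
        rw [← hres x i, ← hres y i]
        exact congrArg (fun g => GriddedPerm.restrict g (P i)) (congrArg Subtype.val hxy)
      obtain ⟨⟨k, hk⟩, t⟩ := x
      obtain ⟨⟨l, hl⟩, s⟩ := y
      obtain rfl : k = l := by
        funext i
        exact (t i).2.2.symm.trans ((congrArg GriddedPerm.size (h1 i)).trans (s i).2.2)
      congr
      funext i
      exact Subtype.ext (h1 i)
    · rintro ⟨g, hg, rfl⟩
      obtain ⟨hgw, hgr⟩ := (mem_grid_iff_restrict hm hU hN g).1 hg
      have hr : ∀ i, (g.restrict (P i)).Within (P i) := fun i => restrict_cell_mem g (P i)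
      have hmr : M _ hr = g := merge_restrict hP hgw (hM _ hr)
      refine ⟨⟨⟨fun i => (g.restrict (P i)).size, Finset.mem_piAntidiag.2
        ⟨?_, fun i _ => Finset.mem_univ i⟩⟩, fun i => ⟨g.restrict (P i), hgr i, rfl⟩⟩, ?_⟩
      · rw [← hsize _ hr, hmr]
      · exact Subtype.ext hmr
  rw [hcard, ← Nat.card_congr (Equiv.ofBijective F hF), Nat.card_sigma]
  simp only [Nat.card_pi, ← hcard]
  exact Finset.sum_coe_sort (Finset.piAntidiag (Finset.univ : Finset (Fin m)) n)
    (fun k => ∏ i, (subtiling P T i).count (k i))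

end Factor

end CombExp
-- Strategies: correctness of the counting functions and productivity
namespace CombExp

/-- Bridges the counting function of `factor`, a sum over a box of truncated index ranges, and the
sum over all tuples with total `n`; the tuples outside the box must contribute nothing. -/
theorem sum_pi_fin_eq_sum_piAntidiag {R : Type*} [AddCommMonoid R] {m : ℕ} (b : Fin m → ℕ) (n : ℕ)
    (F : (Fin m → ℕ) → R)
    (hF : ∀ k ∈ Finset.piAntidiag (Finset.univ : Finset (Fin m)) n, (∃ i, b i ≤ k i) → F k = 0) :
    (∑ k : (i : Fin m) → Fin (b i), if ∑ i, (k i : ℕ) = n then F (fun i => k i) else 0) =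
      ∑ k ∈ Finset.piAntidiag (Finset.univ : Finset (Fin m)) n, F k := by
  rw [← Finset.sum_filter]
  refine Finset.sum_of_injOn (fun k i => (k i : ℕ)) ?_ ?_ ?_ fun _ _ => rfl
  · intro k _ l _ h
    funext i
    exact Fin.ext (congrFun h i)
  · intro k hk
    have := (Finset.mem_filter.1 (Finset.mem_coe.1 hk)).2
    exact Finset.mem_coe.2 (Finset.mem_piAntidiag.2 ⟨this, fun i _ => Finset.mem_univ i⟩)
  · intro k hk hk'
    refine hF k hk ?_
    by_contra h
    push Not at h
    refine hk' ⟨fun i => ⟨k i, h i⟩, ?_, rfl⟩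
    exact Finset.mem_coe.2 (Finset.mem_filter.2 ⟨Finset.mem_univ _, (Finset.mem_piAntidiag.1 hk).1⟩)

theorem le_of_mem_piAntidiag {m n : ℕ} {k : Fin m → ℕ}
    (hk : k ∈ Finset.piAntidiag (Finset.univ : Finset (Fin m)) n) (i : Fin m) : k i ≤ n := by
  rw [← (Finset.mem_piAntidiag.1 hk).1]
  exact Finset.single_le_sum (f := k) (fun _ _ => Nat.zero_le _) (Finset.mem_univ i)

theorem eq_zero_of_mem_piAntidiag {m n : ℕ} {k : Fin m → ℕ}
    (hk : k ∈ Finset.piAntidiag (Finset.univ : Finset (Fin m)) n) {i j : Fin m} (hi : k i = n)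
    (hij : j ≠ i) : k j = 0 := by
  have h1 := (Finset.mem_piAntidiag.1 hk).1
  rw [← Finset.add_sum_erase _ _ (Finset.mem_univ i), hi] at h1
  have h2 : ∑ l ∈ Finset.univ.erase i, k l = 0 := by omega
  exact Finset.sum_eq_zero_iff.1 h2 j (Finset.mem_erase.2 ⟨hij, Finset.mem_univ _⟩)

/-! ### The strategies are productive combinatorial strategies -/

theorem factor_d_eq_some {m : ℕ} {P : Fin m → Set Cell} {S : Finset (Fin m)} {T : Tiling}
    {B : Fin (factor P S).arity → Tiling} (h : (factor P S).d T = some B) :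
    (2 ≤ m ∧ (⋃ i, P i) = T.nonemptyCells ∧
      (∀ i j, i ≠ j → Disjoint (P i) (P j) ∧ NonInteracting T (P i) (P j)) ∧
      (∀ i, ∃ g ∈ (subtiling P T i).Grid, 1 ≤ g.size) ∧
      (∀ i, i ∈ S ↔ ∃ j, j ≠ i ∧ (subtiling P T j).count 0 = 0)) ∧ B = subtiling P T := by
  simp only [factor] at h
  split_ifs at h with hc
  exact ⟨hc, (Option.some.inj h).symm⟩

theorem factor_isStrategy {m : ℕ} (P : Fin m → Set Cell) (S : Finset (Fin m)) :
    (factor P S).IsStrategy Tiling.count := by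
  intro T B h n
  obtain ⟨⟨hm, hU, hN, -, hS⟩, rfl⟩ := factor_d_eq_some h
  rw [count_eq_sum_prod (by omega) hU fun i j hij => (hN i j hij).2]
  refine sum_pi_fin_eq_sum_piAntidiag
    (fun i => ((if i ∈ S then (n : ℤ) - 1 else n) + 1).toNat) n
    (fun k => ∏ i, (subtiling P T i).count (k i)) ?_
  rintro k hk ⟨i, hi⟩
  have hle := le_of_mem_piAntidiag hk i
  -- The range of `i ∈ S` omits only `n`. If `k i = n`, all other indices are `0`, and some other
  -- factor has no object of size `0`.
  by_cases hiS : i ∈ S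
  · simp only [hiS, if_true] at hi
    have hin : k i = n := by omega
    obtain ⟨j, hj, hj0⟩ := (hS i).1 hiS
    refine Finset.prod_eq_zero (Finset.mem_univ j) ?_
    rw [eq_zero_of_mem_piAntidiag hk hin hj, hj0]
  · simp only [hiS, if_false] at hi
    omega

theorem Tiling.count_pos_of_mem {T : Tiling} {g : GriddedPerm} (hg : g ∈ T.Grid) :
    0 < T.count g.size :=
  (Set.ncard_pos (T.finite_grid _)).2 ⟨g, hg, rfl⟩

/-- Full reliance on factor `i` means `i ∉ S`, so every other factor has an object of size `0`, and
padding with these embeds factor `i` into the parent. Combining nonempty objects of factor `i` and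
of a second factor gives an object outside the image. -/
theorem factor_isProductive {m : ℕ} (P : Fin m → Set Cell) (S : Finset (Fin m)) :
    (factor P S).IsProductive Tiling.count := by
  classical
  intro T B h i
  obtain ⟨⟨hm, hU, hN, hG, hS⟩, rfl⟩ := factor_d_eq_some h
  change Fin m at i
  have hcount := count_eq_sum_prod (P := P) (by omega) hU fun i j hij => (hN i j hij).2
  constructor
  · intro N j hj
    change (j : ℤ) ≤ if i ∈ S then (N : ℤ) - 1 else N at hj
    split_ifs at hj <;> omega
  · rintro ⟨N, hN'⟩
    change (N : ℤ) ≤ if i ∈ S then (N : ℤ) - 1 else N at hN'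
    have hiS : i ∉ S := fun hi => by
      rw [if_pos hi] at hN'
      omega
    have h0 : ∀ j, j ≠ i → 0 < (subtiling P T j).count 0 := by
      intro j hj
      by_contra hc
      exact hiS ((hS i).2 ⟨j, hj, by omega⟩)
    have hsingle : ∀ n, (Pi.single i n : Fin m → ℕ) ∈
        Finset.piAntidiag (Finset.univ : Finset (Fin m)) n := by
      intro n
      exact Finset.mem_piAntidiag.2 ⟨by simp, fun j _ => Finset.mem_univ j⟩
    have hle : ∀ n, (subtiling P T i).count n ≤
        ∏ j, (subtiling P T j).count ((Pi.single i n : Fin m → ℕ) j) := by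
      intro n
      rw [← Finset.mul_prod_erase _ _ (Finset.mem_univ i), Pi.single_eq_same]
      refine Nat.le_mul_of_pos_right _ (Finset.prod_pos fun j hj => ?_)
      rw [Pi.single_eq_of_ne (Finset.ne_of_mem_erase hj)]
      exact h0 j (Finset.ne_of_mem_erase hj)
    constructor
    · intro n
      rw [hcount]
      exact (hle n).trans (Finset.single_le_sum
        (f := fun k : Fin m → ℕ => ∏ j, (subtiling P T j).count (k j))
        (fun _ _ => Nat.zero_le _) (hsingle n))
    · obtain ⟨j, hj⟩ : ∃ j : Fin m, j ≠ i := by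
        have : Nontrivial (Fin m) := Fin.nontrivial_iff_two_le.2 hm
        exact exists_ne i
      obtain ⟨g, hg, hg1⟩ := hG i
      obtain ⟨g', hg', hg1'⟩ := hG j
      -- The size vector of the extra object: it has the same total as `Pi.single i (g.size +
      -- g'.size)` but is a different summand, since `g'` is nonempty.
      let k : Fin m → ℕ := Pi.single i g.size + Pi.single j g'.size
      have hki : k i = g.size := by simp [k, hj.symm]
      have hkj : k j = g'.size := by simp [k, hj]
      have hkl : ∀ l, l ≠ i → l ≠ j → k l = 0 := fun l hi hj => by simp [k, hi, hj]
      have hk : k ∈ Finset.piAntidiag (Finset.univ : Finset (Fin m)) (g.size + g'.size) :=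
        Finset.mem_piAntidiag.2 ⟨by simp [k, Finset.sum_add_distrib], fun j _ => Finset.mem_univ j⟩
      have hne : Pi.single i (g.size + g'.size) ≠ k := fun h => by
        have := congrFun h j
        rw [hkj, Pi.single_eq_of_ne hj] at this
        omega
      have hkpos : 0 < ∏ l, (subtiling P T l).count (k l) := by
        refine Finset.prod_pos fun l _ => ?_
        by_cases hli : l = i
        · subst hli
          rw [hki]
          exact Tiling.count_pos_of_mem hg
        · by_cases hlj : l = j
          · subst hlj
            rw [hkj]
            exact Tiling.count_pos_of_mem hg'
          · rw [hkl l hli hlj]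
            exact h0 l hli
      refine ⟨g.size + g'.size, ?_⟩
      rw [hcount, ← Finset.add_sum_erase _ _ (hsingle (g.size + g'.size))]
      refine lt_of_le_of_lt (hle _) (Nat.lt_add_of_pos_right ?_)
      exact lt_of_lt_of_le hkpos (Finset.single_le_sum
        (f := fun k : Fin m → ℕ => ∏ j, (subtiling P T j).count (k j))
        (fun _ _ => Nat.zero_le _) (Finset.mem_erase.2 ⟨hne.symm, hk⟩))

theorem reqIns_d_eq_some {H : Set GriddedPerm} {T : Tiling} {B : Fin (reqIns H).arity → Tiling}
    (h : (reqIns H).d T = some B) :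
    B = (![⟨T.width, T.height, T.obs ∪ H, T.req⟩,
      ⟨T.width, T.height, T.obs, T.req ∪ {H}⟩] : Fin 2 → Tiling) ∧
    (Tiling.mk T.width T.height (T.obs ∪ H) T.req).Grid.Nonempty ∧
    (Tiling.mk T.width T.height T.obs (T.req ∪ {H})).Grid.Nonempty := by
  simp only [reqIns] at h
  split_ifs at h with hc
  exact ⟨(Option.some.inj h).symm, hc.2⟩

theorem count_reqIns (T : Tiling) (H : Set GriddedPerm) (n : ℕ) :
    (Tiling.mk T.width T.height (T.obs ∪ H) T.req).count n +
      (Tiling.mk T.width T.height T.obs (T.req ∪ {H})).count n = T.count n := by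
  have h1 : ∀ g, g ∈ (Tiling.mk T.width T.height (T.obs ∪ H) T.req).Grid ↔
      g ∈ T.Grid ∧ ∀ h ∈ H, ¬ g.Contains h := by
    intro g
    simp only [Tiling.Grid, Set.mem_ofPred_eq, Set.mem_union, or_imp, forall_and]
    tauto
  have h2 : ∀ g, g ∈ (Tiling.mk T.width T.height T.obs (T.req ∪ {H})).Grid ↔
      g ∈ T.Grid ∧ ∃ h ∈ H, g.Contains h := by
    intro g
    simp only [Tiling.Grid, Set.mem_ofPred_eq, Set.mem_union, Set.mem_singleton_iff, or_imp,
      forall_and, forall_eq]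
    tauto
  unfold Tiling.count
  rw [← Set.ncard_union_eq ?_ (Tiling.finite_grid _ _) (Tiling.finite_grid _ _)]
  · congr 1
    ext g
    simp only [Set.mem_union, Set.mem_ofPred_eq, h1, h2]
    constructor
    · rintro (h | h)
      · exact ⟨h.1.1, h.2⟩
      · exact ⟨h.1.1, h.2⟩
    · rintro ⟨hg, hn⟩
      by_cases h : ∃ h ∈ H, g.Contains h
      · exact Or.inr ⟨⟨hg, h⟩, hn⟩
      · push Not at h
        exact Or.inl ⟨⟨hg, h⟩, hn⟩
  · rw [Set.disjoint_left]
    rintro g ⟨hg, -⟩ ⟨hg', -⟩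
    obtain ⟨h, hh, hc⟩ := ((h2 g).1 hg').2
    exact ((h1 g).1 hg).2 h hh hc

theorem reqIns_isStrategy (H : Set GriddedPerm) : (reqIns H).IsStrategy Tiling.count := by
  intro T B h n
  obtain ⟨rfl, -⟩ := reqIns_d_eq_some h
  exact count_reqIns T H n

/-- The children partition the parent and both are nonempty, so each is smaller than the parent at a
size realized by the other. -/
theorem reqIns_isProductive (H : Set GriddedPerm) : (reqIns H).IsProductive Tiling.count := by
  intro T B h i
  obtain ⟨rfl, ⟨g, hg⟩, ⟨g', hg'⟩⟩ := reqIns_d_eq_some h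
  have h1 := Tiling.count_pos_of_mem hg
  have h2 := Tiling.count_pos_of_mem hg'
  refine ⟨fun N j hj => Int.ofNat_le.1 hj, fun _ => ?_⟩
  have hi : i = (0 : Fin 2) ∨ i = (1 : Fin 2) :=
    (show ∀ i : Fin 2, i = 0 ∨ i = 1 by decide) i
  rcases hi with rfl | rfl
  · refine ⟨fun n => ?_, g'.size, ?_⟩
    · rw [← count_reqIns T H n]
      exact Nat.le_add_right _ _
    · rw [← count_reqIns T H]
      exact Nat.lt_add_of_pos_right h2
  · refine ⟨fun n => ?_, g.size, ?_⟩
    · rw [← count_reqIns T H n]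
      exact Nat.le_add_left _ _
    · rw [← count_reqIns T H]
      exact Nat.lt_add_of_pos_left h1

theorem verify_isStrategy {A : Tiling} {a : ℕ → ℕ} (h : ∀ n, A.count n = a n) :
    (verify A a).IsStrategy Tiling.count := by
  intro T B hB n
  simp only [verify] at hB
  split_ifs at hB with hc
  rw [Tiling.count_congr hc, h]
  rfl

theorem verify_isProductive (A : Tiling) (a : ℕ → ℕ) : (verify A a).IsProductive Tiling.count :=
  fun _ _ _ i => (show Fin 0 from i).elim0

theorem produces_verify (A : Tiling) (a : ℕ → ℕ) : Produces (verify A a) A (![] : Fin 0 → Tiling) :=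
  ⟨_, if_pos rfl, fun i => (show Fin 0 from i).elim0⟩

end CombExp
-- A computable calculus of gridded patterns
namespace CombExp

/-! ### Patterns as lists -/

/-- A pattern with cells: the list of its entries `(value, cell)`, from left to right. Only the
relative order of the values matters. -/
abbrev Pat : Type := List (ℕ × Cell)

/-- The list of the entries of a gridded permutation. -/
def GriddedPerm.toPat (g : GriddedPerm) : Pat := List.ofFn fun i => ((g.perm i : ℕ), g.cell i)

/-- The entries `a.1` and `b.1` of `π` are in the same relative position as the entries `a.2` and
`b.2` of a pattern, with `a` to the left of `b`. -/
def PairMatch {n : ℕ} (π : Equiv.Perm (Fin n)) (a b : Fin n × (ℕ × Cell)) : Prop :=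
  a.1 < b.1 ∧ (a.2.1 < b.2.1 ↔ π a.1 < π b.1) ∧ (b.2.1 < a.2.1 ↔ π b.1 < π a.1)

/-- `z` pairs the entries of an occurrence in `(π, c)` with the entries of a pattern. -/
def Match {n : ℕ} (π : Equiv.Perm (Fin n)) (c : Fin n → Cell) (z : List (Fin n × (ℕ × Cell))) :
    Prop :=
  z.Pairwise (PairMatch π) ∧ ∀ a ∈ z, c a.1 = a.2.2

/-- `g` contains the pattern `p`. -/
def GriddedPerm.Has (g : GriddedPerm) (p : Pat) : Prop :=
  ∃ z, z.map Prod.snd = p ∧ Match g.perm g.cell z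

theorem toPat_length (g : GriddedPerm) : g.toPat.length = g.size := List.length_ofFn

theorem toPat_injective : Function.Injective GriddedPerm.toPat := by
  rintro ⟨n, π, c, hc⟩ ⟨m, σ, d, hd⟩ h
  obtain rfl : n = m := by simpa [toPat_length] using congrArg List.length h
  have h' := List.ofFn_injective h
  obtain rfl : π = σ := by
    ext i
    exact congrArg Prod.fst (congrFun h' i)
  exact GriddedPerm.mk_congr fun i => congrArg Prod.snd (congrFun h' i)

theorem match_of_isOcc {g h : GriddedPerm} {f : Fin h.size ↪o Fin g.size} (hf : g.IsOcc h f) :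
    Match g.perm g.cell (List.ofFn fun i => (f i, ((h.perm i : ℕ), h.cell i))) := by
  refine ⟨List.pairwise_ofFn.2 fun i j hij => ⟨f.lt_iff_lt.2 hij, ?_, ?_⟩, ?_⟩
  · exact Fin.lt_def.symm.trans (hf.1 i j)
  · exact Fin.lt_def.symm.trans (hf.1 j i)
  · intro a ha
    obtain ⟨i, rfl⟩ := (List.mem_ofFn' _ _).1 ha
    exact hf.2 i

/-- Converse of `match_of_isOcc`. The explicit shape of `z` is kept because point placement has to
follow one particular entry of the occurrence. -/
theorem exists_isOcc {g h : GriddedPerm} {z : List (Fin g.size × (ℕ × Cell))}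
    (hz : Match g.perm g.cell z)
    (hp : z.map Prod.snd = h.toPat) :
    ∃ f : Fin h.size ↪o Fin g.size, g.IsOcc h f ∧
      z = List.ofFn fun i => (f i, ((h.perm i : ℕ), h.cell i)) := by
  have hlen : z.length = h.size := by
    have := congrArg List.length hp
    rwa [List.length_map, toPat_length] at this
  have hsnd : ∀ (i : Fin h.size) (hi : (i : ℕ) < z.length),
      (z[(i : ℕ)]).2 = ((h.perm i : ℕ), h.cell i) := by
    intro i hi
    have h1 : (z.map Prod.snd)[(i : ℕ)]'(by simpa using hi) =
      h.toPat[(i : ℕ)]'(by rw [toPat_length]; exact i.2) := by simp only [hp]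
    rw [List.getElem_map] at h1
    rw [h1]
    simp [GriddedPerm.toPat]
  have hi : ∀ i : Fin h.size, (i : ℕ) < z.length := fun i => lt_of_lt_of_eq i.2 hlen.symm
  have hpw : ∀ i j : Fin h.size, i < j → PairMatch g.perm (z[(i : ℕ)]'(hi i)) (z[(j : ℕ)]'(hi j)) :=
    fun i j hij => List.pairwise_iff_getElem.1 hz.1 i j (hi i) (hi j) hij
  refine ⟨OrderEmbedding.ofStrictMono (fun i => (z[(i : ℕ)]'(hi i)).1) ?_, ⟨?_, ?_⟩, ?_⟩
  · exact fun i j hij => (hpw i j hij).1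
  · intro i j
    rcases lt_trichotomy i j with hij | rfl | hij
    · have := (hpw i j hij).2.1
      rw [hsnd, hsnd] at this
      exact Fin.lt_def.trans this
    · simp
    · have := (hpw j i hij).2.2
      rw [hsnd, hsnd] at this
      exact Fin.lt_def.trans this
  · intro i
    have := hz.2 _ (List.getElem_mem (hi i))
    rw [hsnd] at this
    exact this
  · refine List.ext_getElem (by simp [hlen]) fun k h1 h2 => ?_
    rw [List.getElem_ofFn]
    exact Prod.ext rfl (hsnd ⟨k, lt_of_lt_of_eq h1 hlen⟩ h1)

/-- The bridge from embeddings between `Fin` types to lists, on which containment can be tested by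
evaluation. -/
theorem contains_iff_has {g h : GriddedPerm} : g.Contains h ↔ g.Has h.toPat := by
  constructor
  · rintro ⟨f, hf⟩
    refine ⟨_, ?_, match_of_isOcc hf⟩
    rw [List.map_ofFn]
    rfl
  · rintro ⟨z, hp, hz⟩
    obtain ⟨f, hf, -⟩ := exists_isOcc hz hp
    exact ⟨f, hf⟩

theorem GriddedPerm.Has.length_le {g : GriddedPerm} {p : Pat} (h : g.Has p) :
    p.length ≤ g.size := by
  obtain ⟨z, rfl, hz⟩ := h
  have : (z.map Prod.fst).Nodup :=
    List.Pairwise.imp (fun h => (ne_of_lt h)) (List.pairwise_map.2 (hz.1.imp fun h => h.1))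
  simpa using this.length_le_card

/-! ### Decision procedures for patterns -/

/-- Can `x` be to the left of `y` in a gridded permutation? -/
def okPair (x y : ℕ × Cell) : Bool :=
  Nat.ble x.2.1 y.2.1 && (!Nat.blt x.1 y.1 || Nat.ble x.2.2 y.2.2) &&
    (!Nat.blt y.1 x.1 || Nat.ble y.2.2 x.2.2)

theorem okPair_of_match {g : GriddedPerm} {a b : Fin g.size × (ℕ × Cell)} (h : PairMatch g.perm a b)
    (ha : g.cell a.1 = a.2.2) (hb : g.cell b.1 = b.2.2) : okPair a.2 b.2 = true := by
  have h1 := g.consistent.1 _ _ h.1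
  have h2 := fun hlt => g.consistent.2 _ _ (h.2.1.1 hlt)
  have h3 := fun hlt => g.consistent.2 _ _ (h.2.2.1 hlt)
  rw [ha, hb] at h1 h2 h3
  simp only [okPair, Bool.and_eq_true, Bool.or_eq_true, Bool.not_eq_true', Nat.blt_eq,
    Nat.ble_eq, ← Bool.not_eq_true]
  exact ⟨⟨h1, or_iff_not_imp_left.2 fun h => h2 (not_not.1 h)⟩,
    or_iff_not_imp_left.2 fun h => h3 (not_not.1 h)⟩

/-- Can the pattern occur in a gridded permutation? -/
def consistentB : Pat → Bool
  | [] => true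
  | x :: p => p.all (okPair x) && consistentB p

theorem GriddedPerm.Has.consistentB {g : GriddedPerm} {p : Pat} (h : g.Has p) :
    consistentB p = true := by
  obtain ⟨z, rfl, h1, h2⟩ := h
  induction z with
  | nil => rfl
  | cons a z ih =>
    rw [List.pairwise_cons] at h1
    simp only [List.map_cons, CombExp.consistentB, Bool.and_eq_true, List.all_eq_true]
    refine ⟨?_, ih h1.2 fun b hb => h2 b (List.mem_cons_of_mem _ hb)⟩
    intro x hx
    obtain ⟨b, hb, rfl⟩ := List.mem_map.1 hx
    exact okPair_of_match (h1.1 b hb) (h2 a List.mem_cons_self) (h2 b (List.mem_cons_of_mem _ hb))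

theorem GriddedPerm.Has.sublist {g : GriddedPerm} {p q : Pat} (h : g.Has p) (hq : q.Sublist p) :
    g.Has q := by
  obtain ⟨z, rfl, h1, h2⟩ := h
  obtain ⟨w, hw, rfl⟩ := List.sublist_map_iff.1 hq
  exact ⟨w, rfl, h1.sublist hw, fun a ha => h2 a (hw.subset ha)⟩

/-- Equality of cells. -/
def cellEq (a b : Cell) : Bool := Nat.beq a.1 b.1 && Nat.beq a.2 b.2

theorem cellEq_iff {a b : Cell} : cellEq a b = true ↔ a = b := by
  simp [cellEq, Prod.ext_iff]

/-- Do `x`, `y` have the same relative order as `x'`, `y'`? -/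
def sameOrder (x y x' y' : ℕ) : Bool :=
  (Nat.blt x y == Nat.blt x' y') && (Nat.blt y x == Nat.blt y' x')

theorem sameOrder_iff {x y x' y' : ℕ} :
    sameOrder x y x' y' = true ↔ (x < y ↔ x' < y') ∧ (y < x ↔ y' < x') := by
  have key : ∀ b c : Bool, (b == c) = true ↔ (b = true ↔ c = true) := by decide
  rw [sameOrder, Bool.and_eq_true, key, key, Nat.blt_eq, Nat.blt_eq, Nat.blt_eq, Nat.blt_eq]

/-- Are the two patterns order isomorphic, with equal cells? -/
def isoB : Pat → Pat → Bool
  | [], [] => true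
  | x :: p, y :: q => cellEq x.2 y.2 && (p.zip q).all (fun w => sameOrder x.1 w.1.1 y.1 w.2.1) &&
      isoB p q
  | _, _ => false

/-- The same entries of `g` serve as an occurrence of `q`; only the labels they are paired with are
exchanged. -/
theorem match_zipWith_of_isoB {g : GriddedPerm} {z : List (Fin g.size × (ℕ × Cell))}
    (hz : Match g.perm g.cell z) {q : Pat} (h : isoB (z.map Prod.snd) q = true) :
    (List.zipWith (fun a y => (a.1, y)) z q).map Prod.snd = q ∧
      Match g.perm g.cell (List.zipWith (fun a y => (a.1, y)) z q) := by
  induction z generalizing q with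
  | nil =>
    cases q with
    | nil => exact ⟨rfl, hz⟩
    | cons => simp [isoB] at h
  | cons a z ih =>
    cases q with
    | nil => simp [isoB] at h
    | cons y q =>
      obtain ⟨h1, h2⟩ := hz
      rw [List.pairwise_cons] at h1
      simp only [List.map_cons, isoB, Bool.and_eq_true, List.all_eq_true, cellEq_iff,
        sameOrder_iff] at h
      obtain ⟨⟨hc, ho⟩, hi⟩ := h
      obtain ⟨i1, i2⟩ := ih ⟨h1.2, fun b hb => h2 b (List.mem_cons_of_mem _ hb)⟩ hi
      simp only [List.zipWith_cons_cons, List.map_cons, i1, true_and]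
      refine ⟨List.pairwise_cons.2 ⟨?_, i2.1⟩, ?_⟩
      · intro b hb
        rw [← List.map_uncurry_zip_eq_zipWith] at hb
        obtain ⟨⟨w, y'⟩, hw, rfl⟩ := List.mem_map.1 hb
        have hmem := (List.of_mem_zip hw).1
        obtain ⟨p1, p2, p3⟩ := h1.1 w hmem
        have := ho (w.2, y') (by
          rw [List.zip_map_left]
          exact List.mem_map.2 ⟨(w, y'), hw, rfl⟩)
        exact ⟨p1, this.1.symm.trans p2, this.2.symm.trans p3⟩
      · intro b hb
        rcases List.mem_cons.1 hb with rfl | hb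
        · exact (h2 a List.mem_cons_self).trans hc
        · exact i2.2 b hb

theorem GriddedPerm.Has.of_isoB {g : GriddedPerm} {p q : Pat} (h : g.Has p) (hq : isoB p q = true) :
    g.Has q := by
  obtain ⟨z, rfl, hz⟩ := h
  exact ⟨_, match_zipWith_of_isoB hz hq⟩

/-- The subsequences of `p` with the same cells as `q`. -/
def candidates : Pat → Pat → List Pat
  | _, [] => [[]]
  | [], _ :: _ => []
  | x :: p, y :: q =>
    (if cellEq x.2 y.2 then (candidates p q).map (x :: ·) else []) ++ candidates p (y :: q)

theorem sublist_of_mem_candidates {p q r : Pat} (h : r ∈ candidates p q) : r.Sublist p := by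
  induction p generalizing q r with
  | nil =>
    cases q with
    | nil => simp only [candidates, List.mem_singleton] at h; simp [h]
    | cons => simp [candidates] at h
  | cons x p ih =>
    cases q with
    | nil => simp only [candidates, List.mem_singleton] at h; simp [h]
    | cons y q =>
      simp only [candidates, List.mem_append] at h
      rcases h with h | h
      · split_ifs at h
        · obtain ⟨r, hr, rfl⟩ := List.mem_map.1 h
          exact (ih hr).cons_cons x
        · simp at h
      · exact (ih h).cons x

/-- Does the pattern `p` contain the pattern `q`? -/
def containsB (p q : Pat) : Bool := (candidates p q).any (isoB · q)

/-- Only soundness of the test is used: a missed containment could make an evaluation fail but never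
yield a false conclusion. -/
theorem GriddedPerm.Has.of_containsB {g : GriddedPerm} {p q : Pat} (h : g.Has p)
    (hq : containsB p q = true) : g.Has q := by
  obtain ⟨r, hr, hi⟩ := List.any_eq_true.1 hq
  exact (h.sublist (sublist_of_mem_candidates hr)).of_isoB hi

/-! #### Adding an entry to an occurrence -/

/-- Make room for new values. -/
def spread (p : Pat) : Pat := p.map fun x => (2 * x.1 + 1, x.2)

/-- All ways of inserting an entry in the cell `m` into `p`. -/
def inserts (m : Cell) (p : Pat) : List Pat :=
  (List.range (p.length + 1)).flatMap fun k =>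
    (0 :: p.map fun x => 2 * x.1 + 2).map fun w =>
      (spread p).take k ++ (w, m) :: (spread p).drop k

theorem exists_split_of_sorted {α : Type*} {n : ℕ} (z : List (Fin n × α))
    (hz : z.Pairwise fun a b => a.1 < b.1) (x : Fin n) (hx : ∀ a ∈ z, a.1 ≠ x) :
    ∃ z₁ z₂, z = z₁ ++ z₂ ∧ (∀ a ∈ z₁, a.1 < x) ∧ ∀ a ∈ z₂, x < a.1 := by
  induction z with
  | nil => exact ⟨[], [], rfl, by simp, by simp⟩
  | cons a z ih =>
    rw [List.pairwise_cons] at hz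
    rcases lt_or_gt_of_ne (hx a List.mem_cons_self) with h | h
    · obtain ⟨z₁, z₂, rfl, h1, h2⟩ := ih hz.2 fun b hb => hx b (List.mem_cons_of_mem _ hb)
      refine ⟨a :: z₁, z₂, rfl, ?_, h2⟩
      intro b hb
      rcases List.mem_cons.1 hb with rfl | hb
      · exact h
      · exact h1 b hb
    · refine ⟨[], a :: z, rfl, by simp, ?_⟩
      intro b hb
      rcases List.mem_cons.1 hb with rfl | hb
      · exact h
      · exact h.trans (hz.1 b hb)

/-- After `spread` the old values are odd, and the even numbers are the gaps. The gap for `x` is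
just above the largest pattern value whose entry lies below `x`, or `0` if there is none. -/
theorem exists_value {g : GriddedPerm} {z : List (Fin g.size × (ℕ × Cell))}
    (hz : Match g.perm g.cell z)
    (x : Fin g.size) (hx : ∀ a ∈ z, a.1 ≠ x) :
    ∃ w ∈ 0 :: (z.map Prod.snd).map fun x => 2 * x.1 + 2,
      ∀ a ∈ z, (2 * a.2.1 + 1 < w ↔ g.perm a.1 < g.perm x) ∧
        (w < 2 * a.2.1 + 1 ↔ g.perm x < g.perm a.1) := by
  classical
  have hsymm : ∀ a ∈ z, ∀ b ∈ z, (a.2.1 < b.2.1 ↔ g.perm a.1 < g.perm b.1) := by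
    intro a ha b hb
    let R : Fin g.size × (ℕ × Cell) → Fin g.size × (ℕ × Cell) → Prop := fun a b =>
      (a.2.1 < b.2.1 ↔ g.perm a.1 < g.perm b.1) ∧ (b.2.1 < a.2.1 ↔ g.perm b.1 < g.perm a.1)
    -- `Pairwise` compares entries in list order only; being symmetric, and trivially true on the
    -- diagonal, the relation extends to all pairs.
    have hR : Std.Symm R := ⟨fun _ _ h => ⟨h.2, h.1⟩⟩
    have hzR : z.Pairwise R := hz.1.imp fun h => h.2
    exact (List.Pairwise.forall_of_forall (R := R) (fun c _ => by simp [R]) hzR ha hb).1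
  have hpx : ∀ a ∈ z, g.perm a.1 ≠ g.perm x := fun a ha h => hx a ha (g.perm.injective h)
  by_cases hS : ∃ a ∈ z, g.perm a.1 < g.perm x
  · obtain ⟨a, ha, hax⟩ := hS
    have hne : (z.toFinset.filter fun a => g.perm a.1 < g.perm x).Nonempty :=
      ⟨a, Finset.mem_filter.2 ⟨List.mem_toFinset.2 ha, hax⟩⟩
    obtain ⟨b, hb, hmax⟩ := Finset.exists_max_image _ (fun a => a.2.1) hne
    simp only [Finset.mem_filter, List.mem_toFinset] at hb hmax
    refine ⟨2 * b.2.1 + 2, List.mem_cons_of_mem _ (List.mem_map.2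
      ⟨b.2, List.mem_map_of_mem hb.1, rfl⟩), fun a ha => ?_⟩
    rcases lt_or_gt_of_ne (hpx a ha) with h | h
    · have := hmax a ⟨ha, h⟩
      exact ⟨iff_of_true (by omega) h, iff_of_false (by omega) h.asymm⟩
    · have := (hsymm b hb.1 a ha).2 (hb.2.trans h)
      exact ⟨iff_of_false (by omega) h.asymm, iff_of_true (by omega) h⟩
  · push Not at hS
    refine ⟨0, List.mem_cons_self, fun a ha => ?_⟩
    have h := lt_of_le_of_ne (hS a ha) (hpx a ha).symm
    exact ⟨iff_of_false (by omega) h.asymm, iff_of_true (by omega) h⟩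

/-- Since the pattern has no entry in `m`, the entry `x` is new to the occurrence; its position and
value fall in some gap, and `inserts` runs through all gaps. -/
theorem GriddedPerm.Has.exists_insert {g : GriddedPerm} {p : Pat} (h : g.Has p) {x : Fin g.size}
    {m : Cell} (hx : g.cell x = m) (hm : ∀ y ∈ p, y.2 ≠ m) : ∃ q ∈ inserts m p, g.Has q := by
  obtain ⟨z, rfl, hz⟩ := h
  have hzx : ∀ a ∈ z, a.1 ≠ x := by
    rintro a ha rfl
    refine hm a.2 (List.mem_map_of_mem ha) ?_
    rw [← hx, hz.2 a ha]
  obtain ⟨w, hw, hwz⟩ := exists_value hz x hzx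
  obtain ⟨z₁, z₂, rfl, h1, h2⟩ := exists_split_of_sorted z (hz.1.imp fun h => h.1) x hzx
  let up : Fin g.size × (ℕ × Cell) → Fin g.size × (ℕ × Cell) :=
    fun a => (a.1, (2 * a.2.1 + 1, a.2.2))
  have hmap : ∀ l : List (Fin g.size × (ℕ × Cell)),
      (l.map up).map Prod.snd = spread (l.map Prod.snd) := fun l => by
    simp only [spread, List.map_map]
    rfl
  refine ⟨spread (z₁.map Prod.snd) ++ (w, m) :: spread (z₂.map Prod.snd), ?_,
    z₁.map up ++ (x, (w, m)) :: z₂.map up, ?_, ?_⟩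
  · refine List.mem_flatMap.2 ⟨z₁.length, ?_, List.mem_map.2 ⟨w, hw, ?_⟩⟩
    · simp only [List.mem_range, List.length_map, List.length_append]
      omega
    · simp [spread]
  · rw [List.map_append, List.map_cons, hmap, hmap]
  · have hup : ∀ a b, PairMatch g.perm a b → PairMatch g.perm (up a) (up b) := by
      rintro a b ⟨p1, p2, p3⟩
      refine ⟨p1, ?_, ?_⟩
      · rw [← p2]
        simp only [up]
        omega
      · rw [← p3]
        simp only [up]
        omega
    obtain ⟨hp, hc⟩ := hz
    obtain ⟨q1, q2, q3⟩ := List.pairwise_append.1 hp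
    constructor
    · refine List.pairwise_append.2 ⟨List.pairwise_map.2 (q1.imp (hup _ _)),
        List.pairwise_cons.2 ⟨?_, List.pairwise_map.2 (q2.imp (hup _ _))⟩, ?_⟩
      · intro b hb
        obtain ⟨b, hb', rfl⟩ := List.mem_map.1 hb
        have := hwz b (List.mem_append_right _ hb')
        exact ⟨h2 b hb', this.2, this.1⟩
      · intro a ha b hb
        obtain ⟨a, ha', rfl⟩ := List.mem_map.1 ha
        rcases List.mem_cons.1 hb with rfl | hb
        · have := hwz a (List.mem_append_left _ ha')
          exact ⟨h1 a ha', this.1, this.2⟩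
        · obtain ⟨b, hb', rfl⟩ := List.mem_map.1 hb
          exact hup _ _ (q3 a ha' b hb')
    · intro a ha
      rcases List.mem_append.1 ha with ha | ha
      · obtain ⟨a, ha', rfl⟩ := List.mem_map.1 ha
        exact hc a (List.mem_append_left _ ha')
      · rcases List.mem_cons.1 ha with rfl | ha
        · exact hx
        · obtain ⟨a, ha', rfl⟩ := List.mem_map.1 ha
          exact hc a (List.mem_append_right _ ha')

/-! #### Patterns of relabelled gridded permutations -/

/-- The consistent ways of replacing the cells of a pattern by preimages under `φ` in the
list `C`. -/
def refine (φ : Cell → Cell) (C : List Cell) : Pat → List Pat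
  | [] => [[]]
  | x :: p => (refine φ C p).flatMap fun t =>
      (C.filter fun c => cellEq (φ c) x.2 && t.all (okPair (x.1, c))).map fun c => (x.1, c) :: t

theorem mem_refine_of_match {g : GriddedPerm} {a b : ℕ →o ℕ} {C : List Cell}
    (hC : ∀ i, g.cell i ∈ C) {z : List (Fin g.size × (ℕ × Cell))}
    (hz : Match g.perm (Prod.map a b ∘ g.cell) z) :
    (z.map fun w => (w.2.1, g.cell w.1)) ∈ refine (Prod.map a b) C (z.map Prod.snd) ∧
      Match g.perm g.cell (z.map fun w => (w.1, (w.2.1, g.cell w.1))) := by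
  have hM : Match g.perm g.cell (z.map fun w => (w.1, (w.2.1, g.cell w.1))) := by
    refine ⟨List.pairwise_map.2 (hz.1.imp fun h => h), fun w hw => ?_⟩
    obtain ⟨w, -, rfl⟩ := List.mem_map.1 hw
    rfl
  refine ⟨?_, hM⟩
  clear hM
  induction z with
  | nil => simp [refine]
  | cons w z ih =>
    obtain ⟨h1, h2⟩ := hz
    rw [List.pairwise_cons] at h1
    have i1 := ih ⟨h1.2, fun b hb => h2 b (List.mem_cons_of_mem _ hb)⟩
    simp only [List.map_cons, refine, List.mem_flatMap, List.mem_map, List.mem_filter]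
    refine ⟨_, i1, g.cell w.1, ⟨hC _, ?_⟩, rfl⟩
    rw [Bool.and_eq_true, cellEq_iff, List.all_eq_true]
    refine ⟨h2 w List.mem_cons_self, fun y hy => ?_⟩
    obtain ⟨v, hv, rfl⟩ := List.mem_map.1 hy
    exact okPair_of_match (g := g) (a := (w.1, (w.2.1, g.cell w.1)))
      (b := (v.1, (v.2.1, g.cell v.1))) (h1.1 v hv) rfl rfl

theorem exists_match_of_mem_refine {g : GriddedPerm} {a b : ℕ →o ℕ} {C : List Cell} {p q : Pat}
    (hq : q ∈ refine (Prod.map a b) C p) {z : List (Fin g.size × (ℕ × Cell))}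
    (hz : Match g.perm g.cell z)
    (hzq : z.map Prod.snd = q) :
    ∃ z' : List (Fin g.size × (ℕ × Cell)), Match g.perm (Prod.map a b ∘ g.cell) z' ∧
      z'.map Prod.snd = p ∧
      z = z'.map fun w => (w.1, (w.2.1, g.cell w.1)) := by
  refine ⟨z.map fun w => (w.1, (w.2.1, Prod.map a b w.2.2)), ⟨?_, ?_⟩, ?_, ?_⟩
  · exact List.pairwise_map.2 (hz.1.imp fun h => h)
  · intro w hw
    obtain ⟨w, hw', rfl⟩ := List.mem_map.1 hw
    exact congrArg (Prod.map a b) (hz.2 w hw')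
  · subst hzq
    rw [List.map_map]
    clear hz
    induction p generalizing z with
    | nil =>
      simp only [refine, List.mem_singleton, List.map_eq_nil_iff] at hq
      simp [hq]
    | cons x p ih =>
      simp only [refine, List.mem_flatMap, List.mem_map, List.mem_filter, Bool.and_eq_true,
        cellEq_iff] at hq
      obtain ⟨t, ht, c, ⟨-, hc, -⟩, h⟩ := hq
      cases z with
      | nil => simp at h
      | cons w z =>
        simp only [List.map_cons, List.cons.injEq] at h
        obtain ⟨hw, rfl⟩ := h
        rw [List.map_cons, ih ht, Function.comp_apply, ← hw]
        simp only [hc]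
  · rw [List.map_map]
    refine (List.map_id z).symm.trans (List.map_congr_left fun w hw => ?_)
    rw [Function.comp_apply, hz.2 w hw]
    rfl

/-- Lets conditions on a relabelled gridded permutation be rewritten as conditions on `g`: the
pattern is replaced by its finitely many consistent lifts to the cells `C` that `g` can use. -/
theorem has_mapMono_iff {g : GriddedPerm} {a b : ℕ →o ℕ} {C : List Cell}
    (hC : ∀ i, g.cell i ∈ C) (p : Pat) :
    (g.mapMono a b).Has p ↔ ∃ q ∈ refine (Prod.map a b) C p, g.Has q := by
  constructor
  · rintro ⟨z, rfl, hz⟩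
    obtain ⟨h1, h2⟩ := mem_refine_of_match (g := g) hC hz
    exact ⟨_, h1, _, List.map_map, h2⟩
  · rintro ⟨q, hq, z, hzq, hz⟩
    obtain ⟨z', h1, h2, -⟩ := exists_match_of_mem_refine hq hz hzq
    exact ⟨z', h2, h1⟩

/-- Does the entry of index `I` lie in a cell satisfying `Q`? -/
def cellAt (Q : Cell → Bool) (I : ℕ) (p : Pat) : Bool := (p[I]?).any fun x => Q x.2

/-- The version that remembers in which cell of `g` the entry `I` lies. Both the multiplexes beyond
the placed point and the one through it are instances, with different tests `Q`. -/
theorem exists_isOcc_mapMono_iff {g h : GriddedPerm} {a b : ℕ →o ℕ} {C : List Cell}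
    (hC : ∀ i, g.cell i ∈ C) (I : Fin h.size) (Q : Cell → Bool) :
    (∃ f, (g.mapMono a b).IsOcc h f ∧ Q (g.cell (f I)) = true) ↔
      ∃ q ∈ (refine (Prod.map a b) C h.toPat).filter (cellAt Q I), g.Has q := by
  constructor
  · rintro ⟨f, hf, hQ⟩
    change Fin h.size ↪o Fin g.size at f
    obtain ⟨h1, h2⟩ := mem_refine_of_match (g := g)
      (z := List.ofFn fun i => (f i, ((h.perm i : ℕ), h.cell i))) hC (match_of_isOcc hf)
    have hp : (List.ofFn fun i => (f i, ((h.perm i : ℕ), h.cell i))).map Prod.snd = h.toPat := by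
      rw [List.map_ofFn]
      rfl
    rw [hp] at h1
    refine ⟨_, List.mem_filter.2 ⟨h1, ?_⟩, _, List.map_map, h2⟩
    simp only [cellAt, List.map_ofFn, List.getElem?_ofFn, I.2, dif_pos, Option.any_some,
      Function.comp_apply]
    exact hQ
  · rintro ⟨q, hq, z, hzq, hz⟩
    obtain ⟨hq, hI⟩ := List.mem_filter.1 hq
    obtain ⟨z', h1, h2, rfl⟩ := exists_match_of_mem_refine hq hz hzq
    obtain ⟨f, hf, rfl⟩ := exists_isOcc (g := g.mapMono a b) h1 h2
    change Fin h.size ↪o Fin g.size at f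
    refine ⟨f, hf, ?_⟩
    have hq2 : q = (List.ofFn fun i => (f i, ((h.perm i : ℕ), h.cell i))).map
        fun w : Fin g.size × (ℕ × Cell) => (w.2.1, g.cell w.1) := hzq.symm.trans List.map_map
    rw [hq2] at hI
    simp only [cellAt, List.map_ofFn, List.getElem?_ofFn, I.2, dif_pos, Option.any_some,
      Function.comp_apply] at hI
    exact hI

end CombExp
-- Finite descriptions and sound tests between them
namespace CombExp

/-! ### Descriptions of tilings by finite lists -/

/-- A finite description of a set of gridded permutations: the cells that may be used, the
obstructions, and the requirement lists. -/
structure Desc where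
  cells : List Cell
  obs : List Pat
  req : List (List Pat)

namespace Desc

/-- The gridded permutations that fit the description. -/
def Mem (A : Desc) (g : GriddedPerm) : Prop :=
  (∀ i, g.cell i ∈ A.cells) ∧ (∀ o ∈ A.obs, ¬ g.Has o) ∧ ∀ L ∈ A.req, ∃ r ∈ L, g.Has r

/-- The cells in which an entry is required. -/
def pts (A : Desc) : List Cell :=
  A.req.filterMap fun L => match L with
    | [[x]] => some x.2
    | _ => none

end Desc

theorem has_singleton_iff {g : GriddedPerm} {x : ℕ × Cell} : g.Has [x] ↔ ∃ i, g.cell i = x.2 := by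
  constructor
  · rintro ⟨z, hz, -, h⟩
    obtain ⟨a, rfl, rfl⟩ := List.map_eq_singleton_iff.1 hz
    exact ⟨a.1, h a List.mem_cons_self⟩
  · rintro ⟨i, hi⟩
    refine ⟨[(i, x)], rfl, List.pairwise_singleton _ _, ?_⟩
    simpa using hi

theorem Desc.Mem.exists_of_mem_pts {A : Desc} {g : GriddedPerm} (h : A.Mem g) {m : Cell}
    (hm : m ∈ A.pts) : ∃ i, g.cell i = m := by
  obtain ⟨L, hL, hLm⟩ := List.mem_filterMap.1 hm
  obtain ⟨r, hr, hgr⟩ := h.2.2 L hL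
  split at hLm
  · rw [List.mem_singleton.1 hr, has_singleton_iff] at hgr
    rwa [← Option.some.inj hLm]
  · simp at hLm

/-- The ways of adding entries in the cells `ms` to a pattern that has none there. -/
def addPoints (ms : List Cell) (p : Pat) : List Pat :=
  ms.foldr (fun m ps => ps.flatMap fun q =>
    if q.any fun x => cellEq x.2 m then [q] else (inserts m q).filter consistentB) [p]

/-- An occurrence can be enlarged by entries that are known to exist. Inconsistent insertions may be
discarded, since they occur nowhere. -/
theorem GriddedPerm.Has.exists_addPoints {g : GriddedPerm} {ms : List Cell}
    (hms : ∀ m ∈ ms, ∃ i, g.cell i = m) {p : Pat} (h : g.Has p) :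
    ∃ q ∈ addPoints ms p, g.Has q := by
  induction ms with
  | nil => exact ⟨p, List.mem_singleton_self p, h⟩
  | cons m ms ih =>
    obtain ⟨q, hq, hgq⟩ := ih fun k hk => hms k (List.mem_cons_of_mem _ hk)
    by_cases hm : q.any fun x => cellEq x.2 m
    · refine ⟨q, List.mem_flatMap.2 ⟨q, hq, ?_⟩, hgq⟩
      rw [if_pos hm]
      exact List.mem_singleton_self q
    · obtain ⟨x, hx⟩ := hms m List.mem_cons_self
      obtain ⟨r, hr, hgr⟩ := hgq.exists_insert hx fun y hy hym =>
        hm (List.any_eq_true.2 ⟨y, hy, cellEq_iff.2 hym⟩)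
      refine ⟨r, List.mem_flatMap.2 ⟨q, hq, ?_⟩, hgr⟩
      rw [if_neg hm]
      exact List.mem_filter.2 ⟨hr, hgr.consistentB⟩

theorem any_cellEq_iff {C : List Cell} {c : Cell} : C.any (cellEq c) = true ↔ c ∈ C := by
  simp [cellEq_iff]

namespace Desc

/-- The pattern uses a forbidden cell or contains an obstruction. -/
def bad (A : Desc) (p : Pat) : Bool :=
  p.any (fun x => !A.cells.any (cellEq x.2)) || A.obs.any (containsB p)

theorem Mem.not_has_of_bad {A : Desc} {g : GriddedPerm} (h : A.Mem g) {p : Pat}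
    (hp : A.bad p = true) : ¬ g.Has p := by
  intro hgp
  rcases Bool.or_eq_true_iff.1 hp with hp | hp
  · obtain ⟨x, hx, hxc⟩ := List.any_eq_true.1 hp
    obtain ⟨i, hi⟩ := has_singleton_iff.1 (hgp.sublist (List.singleton_sublist.2 hx))
    rw [Bool.not_eq_true', ← Bool.not_eq_true, any_cellEq_iff, ← hi] at hxc
    exact hxc (h.1 i)
  · obtain ⟨o, ho, hpo⟩ := List.any_eq_true.1 hp
    exact h.2.1 o ho (hgp.of_containsB hpo)

/-- The pattern cannot occur, since every way of adding the required entries is bad. -/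
def refutes (A : Desc) (p : Pat) : Bool := !consistentB p || (addPoints A.pts p).all A.bad

theorem Mem.not_has_of_refutes {A : Desc} {g : GriddedPerm} (h : A.Mem g) {p : Pat}
    (hp : A.refutes p = true) : ¬ g.Has p := by
  intro hgp
  rcases Bool.or_eq_true_iff.1 hp with hp | hp
  · rw [hgp.consistentB] at hp
    exact absurd hp (by decide)
  · obtain ⟨q, hq, hgq⟩ := hgp.exists_addPoints fun m hm => h.exists_of_mem_pts hm
    exact h.not_has_of_bad (List.all_eq_true.1 hp q hq) hgq

/-- A sufficient test for `A.Mem` to imply `B.Mem`. -/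
def implies (A B : Desc) : Bool :=
  A.cells.all (fun c => B.cells.any (cellEq c) || A.refutes [(0, c)]) && B.obs.all A.refutes &&
    B.req.all fun L => A.req.any fun R => R.all fun r => (addPoints A.pts r).all fun q =>
      A.bad q || L.any (containsB q)

/-- The required points are what gives the test its strength. For instance a `132` above and to the
right of a placed point is excluded only because the point completes it to a `1243`. -/
theorem Mem.of_implies {A B : Desc} {g : GriddedPerm} (h : A.Mem g) (hAB : A.implies B = true) :
    B.Mem g := by
  simp only [implies, Bool.and_eq_true, List.all_eq_true, Bool.or_eq_true, any_cellEq_iff] at hAB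
  obtain ⟨⟨h1, h2⟩, h3⟩ := hAB
  refine ⟨fun i => ?_, fun o ho => h.not_has_of_refutes (h2 o ho), fun L hL => ?_⟩
  · rcases h1 _ (h.1 i) with hi | hi
    · exact hi
    · exact absurd (has_singleton_iff.2 ⟨i, rfl⟩) (h.not_has_of_refutes hi)
  · obtain ⟨R, hR, hRL⟩ := List.any_eq_true.1 (h3 L hL)
    obtain ⟨r, hr, hgr⟩ := h.2.2 R hR
    obtain ⟨q, hq, hgq⟩ := hgr.exists_addPoints fun m hm => h.exists_of_mem_pts hm
    rcases Bool.or_eq_true_iff.1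
      (List.all_eq_true.1 (List.all_eq_true.1 hRL r hr) q hq) with hq' | hq'
    · exact absurd hgq (h.not_has_of_bad hq')
    · obtain ⟨l, hl, hql⟩ := List.any_eq_true.1 hq'
      exact ⟨l, hl, hgq.of_containsB hql⟩

/-- A sufficient test for `A` and `B` to describe the same set. -/
def equiv (A B : Desc) : Bool := A.implies B && B.implies A

theorem mem_iff_of_equiv {A B : Desc} (h : A.equiv B = true) (g : GriddedPerm) :
    A.Mem g ↔ B.Mem g := by
  obtain ⟨h1, h2⟩ := Bool.and_eq_true_iff.1 h
  exact ⟨fun h => h.of_implies h1, fun h => h.of_implies h2⟩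

/-- The gridded permutations with cells in `C` whose image under `φ` fits the description. -/
def pull (A : Desc) (φ : Cell → Cell) (C : List Cell) : Desc :=
  ⟨C, A.obs.flatMap (refine φ C), A.req.map fun L => L.flatMap (refine φ C)⟩

theorem avoids_flatMap_refine_iff {g : GriddedPerm} {a b : ℕ →o ℕ} {C : List Cell}
    (hC : ∀ i, g.cell i ∈ C) (O : List Pat) :
    (∀ o ∈ O.flatMap (refine (Prod.map a b) C), ¬ g.Has o) ↔
      ∀ o ∈ O, ¬ (g.mapMono a b).Has o := by
  simp only [List.mem_flatMap, has_mapMono_iff hC]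
  constructor
  · rintro h o ho ⟨q, hq, hgq⟩
    exact h q ⟨o, ho, hq⟩ hgq
  · rintro h q ⟨o, ho, hq⟩ hgq
    exact h o ho ⟨q, hq, hgq⟩

theorem exists_flatMap_refine_iff {g : GriddedPerm} {a b : ℕ →o ℕ} {C : List Cell}
    (hC : ∀ i, g.cell i ∈ C) (L : List Pat) :
    (∃ r ∈ L.flatMap (refine (Prod.map a b) C), g.Has r) ↔
      ∃ r ∈ L, (g.mapMono a b).Has r := by
  simp only [List.mem_flatMap, has_mapMono_iff hC]
  constructor
  · rintro ⟨q, ⟨o, ho, hq⟩, hgq⟩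
    exact ⟨o, ho, q, hq, hgq⟩
  · rintro ⟨o, ho, q, hq, hgq⟩
    exact ⟨q, ⟨o, ho, hq⟩, hgq⟩

theorem mem_pull_iff {A : Desc} {a b : ℕ →o ℕ} {C : List Cell}
    (h : ∀ c ∈ C, Prod.map a b c ∈ A.cells) (g : GriddedPerm) :
    (A.pull (Prod.map a b) C).Mem g ↔ (∀ i, g.cell i ∈ C) ∧ A.Mem (g.mapMono a b) := by
  refine and_congr_right fun hC => ?_
  refine Iff.trans (and_congr (avoids_flatMap_refine_iff hC _) ?_)
    (and_iff_right fun i => h _ (hC i)).symm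
  exact List.forall_mem_map.trans
    (forall₂_congr fun L _ => exists_flatMap_refine_iff hC L)

end Desc

/-- Inserting empty rows and columns into `T'` by `f, k` amounts to restricting to the image cells
and pulling `A'` back along the left inverses `a, b`. Hence simplification reduces to one
equivalence test. -/
theorem simplifies_of_desc {T T' : Tiling} {A A' : Desc} (hT : ∀ g, g ∈ T.Grid ↔ A.Mem g)
    (hT' : ∀ g, g ∈ T'.Grid ↔ A'.Mem g) {f k : ℕ → ℕ} (hf : StrictMono f) (hk : StrictMono k)
    (a b : ℕ →o ℕ) (haf : ∀ n, a (f n) = n) (hbk : ∀ n, b (k n) = n)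
    (h : A.equiv (A'.pull (Prod.map a b) (A'.cells.map (Prod.map f k))) = true) :
    Simplifies T T' := by
  have hγ : ∀ c : Cell, Prod.map a b (Prod.map f k c) = c := fun c =>
    Prod.ext (haf c.1) (hbk c.2)
  refine ⟨f, k, hf, hk, Set.ext fun g => ?_⟩
  rw [hT, Desc.mem_iff_of_equiv h, Desc.mem_pull_iff, mem_mapCells]
  · constructor
    · rintro ⟨h1, h2⟩
      refine ⟨_, (hT' _).2 h2, ?_⟩
      have h3 : ∀ i, Prod.map f k (Prod.map a b (g.cell i)) = g.cell i := fun i => by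
        obtain ⟨c, _, hc⟩ := List.mem_map.1 (h1 i)
        rw [← hc, hγ]
      have h4 : Prod.map f k ∘ (g.mapMono a b).cell = g.cell := funext h3
      have h5 : Consistent (g.mapMono a b).perm (Prod.map f k ∘ (g.mapMono a b).cell) := by
        rw [h4]
        exact g.consistent
      exact ⟨h5, GriddedPerm.mk_congr fun i => (h3 i).symm⟩
    · rintro ⟨o, ho, hc, rfl⟩
      refine ⟨fun i => List.mem_map.2 ⟨_, ((hT' o).1 ho).1 i, rfl⟩, ?_⟩
      have : (GriddedPerm.mk o.size o.perm (Prod.map f k ∘ o.cell) hc).mapMono a b = o :=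
        GriddedPerm.mk_congr fun i => hγ _
      rw [this]
      exact (hT' o).1 ho
  · intro c hc
    obtain ⟨c, hc', rfl⟩ := List.mem_map.1 hc
    rwa [hγ]

/-! ### Tilings with a finite description -/

/-- The values of the pattern are those of a permutation. -/
def permB (p : Pat) : Bool :=
  p.all (fun x => Nat.blt x.1 p.length) && decide (p.map Prod.fst).Nodup

/-- `permB` makes the values a permutation, and consistency of the cells is inherited from an
occurrence. So a listed pattern that comes from no gridded permutation never occurs, and it makes no
difference that it is missing from the tiling. -/
theorem GriddedPerm.Has.exists_toPat {g : GriddedPerm} {p : Pat} (h : g.Has p)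
    (hp : permB p = true) : ∃ o : GriddedPerm, o.toPat = p := by
  obtain ⟨z, rfl, hz, hzc⟩ := h
  simp only [permB, Bool.and_eq_true, List.all_eq_true, Nat.blt_eq, decide_eq_true_eq] at hp
  obtain ⟨h1, h2⟩ := hp
  set p := z.map Prod.snd with hpz
  let v : Fin p.length → Fin p.length := fun i => ⟨p[i].1, h1 _ (List.getElem_mem i.2)⟩
  have hv : Function.Injective v := by
    intro i j hij
    have h3 : p[i].1 = p[j].1 := congrArg Fin.val hij
    have hi : (i : ℕ) < (p.map Prod.fst).length := by simp
    have hj : (j : ℕ) < (p.map Prod.fst).length := by simp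
    refine Fin.ext ((h2.getElem_inj_iff (hi := hi) (hj := hj)).1 ?_)
    simpa using h3
  have hlen : p.length = z.length := List.length_map _
  have hpw : ∀ i j : Fin p.length, i < j → PairMatch g.perm
      (z[(i : ℕ)]'(lt_of_lt_of_eq i.2 hlen)) (z[(j : ℕ)]'(lt_of_lt_of_eq j.2 hlen)) :=
    fun i j hij => List.pairwise_iff_getElem.1 hz i j _ _ hij
  have hsnd : ∀ i : Fin p.length, p[i] = (z[(i : ℕ)]'(lt_of_lt_of_eq i.2 hlen)).2 := fun i => by
    simp [hpz]
  have hcell : ∀ i : Fin p.length,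
      p[i].2 = g.cell (z[(i : ℕ)]'(lt_of_lt_of_eq i.2 hlen)).1 := fun i => by
    rw [hsnd, hzc _ (List.getElem_mem _)]
  let σ : Equiv.Perm (Fin p.length) := Equiv.ofBijective v (Finite.injective_iff_bijective.1 hv)
  have hc : Consistent σ fun i => p[i].2 := by
    constructor
    · intro i j hij
      change (p[i].2).1 ≤ (p[j].2).1
      rw [hcell, hcell]
      exact g.consistent.1 _ _ (hpw i j hij).1
    · intro i j hij
      have hlt : p[i].1 < p[j].1 := hij
      change (p[i].2).2 ≤ (p[j].2).2
      rw [hcell, hcell]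
      apply g.consistent.2
      rw [hsnd, hsnd] at hlt
      rcases lt_trichotomy i j with h | h | h
      · exact (hpw i j h).2.1.1 hlt
      · rw [h] at hlt
        exact absurd hlt (lt_irrefl _)
      · exact (hpw j i h).2.2.1 hlt
  refine ⟨⟨p.length, σ, _, hc⟩, List.ext_getElem (by simp [toPat_length]) fun i h3 h4 => ?_⟩
  simp [GriddedPerm.toPat, σ, v]

/-- The tiling has the given description, all obstructions outside the list being point
obstructions that make the other cells empty. -/
structure Tiling.DescribedBy (T : Tiling) (A : Desc) : Prop where
  box : ∀ c ∈ A.cells, c.1 < T.width ∧ c.2 < T.height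
  obs : T.obs = {o | o.toPat ∈ A.obs} ∪
    {o | ∃ c : Cell, c.1 < T.width ∧ c.2 < T.height ∧ c ∉ A.cells ∧ o = point c}
  req : T.req = {L | ∃ l ∈ A.req, L = {h | h.toPat ∈ l}}
  permB_obs : A.obs.all permB = true
  permB_req : (A.req.all fun L => L.all permB) = true

namespace Tiling.DescribedBy

variable {T : Tiling} {A : Desc}

theorem avoids_iff (H : T.DescribedBy A) (g : GriddedPerm) :
    (g.InBox T.width T.height ∧ ∀ o ∈ T.obs, ¬ g.Contains o) ↔
      (∀ i, g.cell i ∈ A.cells) ∧ ∀ o ∈ A.obs, ¬ g.Has o := by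
  rw [H.obs]
  constructor
  · rintro ⟨hb, ho⟩
    constructor
    · intro i
      by_contra hi
      exact ho _ (Or.inr ⟨g.cell i, (hb i).1, (hb i).2, hi, rfl⟩)
        ((contains_point_iff _ _).2 ⟨i, rfl⟩)
    · intro p hp hgp
      obtain ⟨o, rfl⟩ := hgp.exists_toPat (List.all_eq_true.1 H.permB_obs p hp)
      exact ho o (Or.inl hp) (contains_iff_has.2 hgp)
  · rintro ⟨hc, ho⟩
    refine ⟨fun i => H.box _ (hc i), ?_⟩
    rintro o (h | ⟨c, -, -, hcA, rfl⟩) hgo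
    · exact ho _ h (contains_iff_has.1 hgo)
    · obtain ⟨i, rfl⟩ := (contains_point_iff _ _).1 hgo
      exact hcA (hc i)

theorem req_iff (H : T.DescribedBy A) {l : List Pat} (hl : l ∈ A.req) (g : GriddedPerm) :
    (∃ r ∈ {h : GriddedPerm | h.toPat ∈ l}, g.Contains r) ↔ ∃ r ∈ l, g.Has r := by
  constructor
  · rintro ⟨r, hr, hgr⟩
    exact ⟨_, hr, contains_iff_has.1 hgr⟩
  · rintro ⟨p, hp, hgp⟩
    obtain ⟨o, rfl⟩ := hgp.exists_toPat
      (List.all_eq_true.1 (List.all_eq_true.1 H.permB_req l hl) p hp)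
    exact ⟨o, hp, contains_iff_has.2 hgp⟩

theorem mem_grid_iff (H : T.DescribedBy A) (g : GriddedPerm) : g ∈ T.Grid ↔ A.Mem g := by
  have h2 : (∀ L ∈ T.req, ∃ r ∈ L, g.Contains r) ↔ ∀ L ∈ A.req, ∃ r ∈ L, g.Has r := by
    rw [H.req]
    constructor
    · exact fun h l hl => (H.req_iff hl g).1 (h _ ⟨l, hl, rfl⟩)
    · rintro h _ ⟨l, hl, rfl⟩
      exact (H.req_iff hl g).2 (h l hl)
  have h3 : g ∈ T.Grid ↔ (g.InBox T.width T.height ∧ ∀ o ∈ T.obs, ¬ g.Contains o) ∧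
      ∀ L ∈ T.req, ∃ r ∈ L, g.Contains r := and_assoc.symm
  rw [h3, H.avoids_iff, h2]
  exact and_assoc

theorem nonemptyCells_eq (H : T.DescribedBy A)
    (h : (A.obs.all fun p => !Nat.beq p.length 1) = true) :
    T.nonemptyCells = {c | c ∈ A.cells} := by
  ext c
  constructor
  · rintro ⟨h1, h2, h3⟩
    by_contra hc
    rw [H.obs] at h3
    exact h3 (Or.inr ⟨c, h1, h2, hc, rfl⟩)
  · intro hc
    refine ⟨(H.box c hc).1, (H.box c hc).2, fun hp => ?_⟩
    rw [H.obs] at hp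
    rcases hp with hp | ⟨c', -, -, hc', he⟩
    · have := List.all_eq_true.1 h _ hp
      rw [toPat_length] at this
      exact absurd this (show ¬ (!Nat.beq 1 1) = true by decide)
    · have h4 : c = c' := by
        have := congrArg GriddedPerm.toPat he
        simpa [GriddedPerm.toPat, point, localized] using this
      exact hc' (h4 ▸ hc)

end Tiling.DescribedBy

end CombExp
-- Strategies acting on descriptions
namespace CombExp

/-! ### Sets of gridded permutations given by lists of patterns -/

/-- The gridded permutations whose list of entries belongs to `L`. -/
def patSet (L : List Pat) : Set GriddedPerm := {o | o.toPat ∈ L}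

theorem patSet_append (L M : List Pat) : patSet (L ++ M) = patSet L ∪ patSet M :=
  Set.ext fun _ => List.mem_append

theorem patSet_singleton (h : GriddedPerm) : patSet [h.toPat] = {h} :=
  Set.ext fun _ => List.mem_singleton.trans toPat_injective.eq_iff

/-- This needs no consistency hypothesis: for inconsistent data both sides are empty. -/
theorem gridded_eq_patSet {n : ℕ} (π : Equiv.Perm (Fin n)) (c : Fin n → Cell) :
    gridded π c = patSet [List.ofFn fun i => ((π i : ℕ), c i)] := by
  ext o
  constructor
  · rintro ⟨h, rfl⟩
    exact List.mem_singleton_self _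
  · intro ho
    replace ho : o.toPat = List.ofFn fun i => ((π i : ℕ), c i) := List.mem_singleton.1 ho
    obtain ⟨m, σ, d, hd⟩ := o
    obtain rfl : m = n := by simpa [toPat_length] using congrArg List.length ho
    have h' := List.ofFn_injective ho
    obtain rfl : σ = π := by
      ext i
      exact congrArg Prod.fst (congrFun h' i)
    obtain rfl : d = c := funext fun i => congrArg Prod.snd (congrFun h' i)
    exact ⟨hd, rfl⟩

/-- The basis patterns in the cell `c`. -/
def basisPats (c : Cell) : List Pat :=
  [[(0, c), (1, c), (3, c), (2, c)], [(0, c), (2, c), (3, c), (1, c)],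
    [(1, c), (0, c), (3, c), (2, c)]]

/-- The patterns of `obs12`. -/
def pats12 (a b : Cell) : List Pat := [[(0, a), (1, b)]]

/-- The patterns of `rightmostObs`. -/
def rightmostPats (lo hi : Cell) : List Pat :=
  basisPats lo ++ basisPats hi ++
    [[(1, hi), (0, lo), (3, hi), (2, hi)], [(1, lo), (0, lo), (2, hi)],
      [(0, lo), (1, lo), (2, hi)], [(0, lo), (1, hi), (2, hi)]]

/-- The patterns of `leftmostObs`. -/
def leftmostPats (lo hi : Cell) : List Pat :=
  basisPats lo ++
    [[(0, lo), (1, lo), (3, hi), (2, lo)], [(0, lo), (2, lo), (3, hi), (1, lo)],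
      [(0, lo), (2, hi), (3, hi), (1, lo)], [(1, lo), (0, lo), (3, hi), (2, lo)],
      [(0, hi), (2, hi), (1, hi)], [(1, hi), (2, hi), (0, hi)], [(0, lo), (2, hi), (1, hi)]]

/-- The patterns of `pairObs`. -/
def pairPats (a b : Cell) : List Pat :=
  basisPats a ++
    [[(1, a), (0, a), (3, a), (2, b)], [(0, a), (1, a), (3, a), (2, b)],
      [(0, a), (2, a), (3, a), (1, b)], [(0, a), (2, b), (1, b)], [(0, b), (1, b)]]

theorem basisAt_eq_patSet (c : Cell) : basisAt c = patSet (basisPats c) := by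
  ext o
  rw [basisAt, Set.mem_insert_iff, Set.mem_insert_iff, Set.mem_singleton_iff,
    ← toPat_injective.eq_iff, ← toPat_injective.eq_iff, ← toPat_injective.eq_iff]
  refine Iff.trans ?_ (List.mem_cons.trans (or_congr_right (List.mem_cons.trans
    (or_congr_right List.mem_singleton)))).symm
  exact Iff.rfl

theorem obs12_eq_patSet (a b : Cell) : obs12 a b = patSet (pats12 a b) := gridded_eq_patSet _ _

theorem rightmostObs_eq_patSet (lo hi : Cell) :
    rightmostObs lo hi = patSet (rightmostPats lo hi) := by
  simp only [rightmostObs, basisAt_eq_patSet, gridded_eq_patSet, ← patSet_append]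
  rfl

theorem leftmostObs_eq_patSet (lo hi : Cell) :
    leftmostObs lo hi = patSet (leftmostPats lo hi) := by
  simp only [leftmostObs, basisAt_eq_patSet, gridded_eq_patSet, ← patSet_singleton,
    Set.insert_eq, ← patSet_append]
  rfl

theorem pairObs_eq_patSet (a b : Cell) : pairObs a b = patSet (pairPats a b) := by
  simp only [pairObs, basisAt_eq_patSet, gridded_eq_patSet, obs12, ← patSet_append]
  rfl

/-! ### Descriptions of the tilings that occur -/

/-- The description of a drawn tiling. -/
def drawnDesc (pts cells : List Cell) (obs req : List Pat) : Desc where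
  cells := pts ++ cells
  obs := obs ++ pts.flatMap fun c => [[(0, c), (1, c)], [(1, c), (0, c)]]
  req := (req.map fun p => [p]) ++ pts.map fun c => [[(0, c)]]

theorem permB_pair (c : Cell) : permB [(0, c), (1, c)] = true ∧ permB [(1, c), (0, c)] = true :=
  ⟨rfl, rfl⟩

theorem drawn_describedBy {t u : ℕ} (pts cells : List Cell) (obs : List Pat)
    (reqs : List GriddedPerm) {P C : Set Cell} {O R : Set GriddedPerm} (hP : P = {c | c ∈ pts})
    (hC : C = {c | c ∈ cells}) (hO : O = patSet obs) (hR : R = {h | h ∈ reqs})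
    (hbox : ∀ c ∈ pts ++ cells, c.1 < t ∧ c.2 < u) (hobs : obs.all permB = true)
    (hreq : ((reqs.map GriddedPerm.toPat).all permB) = true) :
    (drawn t u P C O R).DescribedBy
      (drawnDesc pts cells obs (reqs.map GriddedPerm.toPat)) := by
  subst hP hC hO hR
  refine ⟨hbox, ?_, ?_, ?_, ?_⟩
  · have hl : ∀ (o : GriddedPerm) (c : Cell),
        (o = localized (1 : Equiv.Perm (Fin 2)) c ∨ o = localized p21 c) ↔
          o.toPat ∈ [[(0, c), (1, c)], [(1, c), (0, c)]] := by
      intro o c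
      rw [← toPat_injective.eq_iff, ← toPat_injective.eq_iff, List.mem_cons, List.mem_singleton]
      exact Iff.rfl
    ext o
    simp only [drawn, drawnDesc, patSet, Set.mem_union, Set.mem_ofPred_eq, List.mem_append,
      List.mem_flatMap, hl, not_or, and_assoc]
    exact or_right_comm
  · ext L
    simp only [drawn, drawnDesc, Set.mem_union, Set.mem_ofPred_eq, List.mem_append, List.mem_map]
    constructor
    · rintro (⟨h, hh, rfl⟩ | ⟨c, hc, rfl⟩)
      · exact ⟨_, Or.inl ⟨_, ⟨h, hh, rfl⟩, rfl⟩, (patSet_singleton h).symm⟩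
      · exact ⟨_, Or.inr ⟨c, hc, rfl⟩, (patSet_singleton (point c)).symm⟩
    · rintro ⟨_, (⟨_, ⟨h, hh, rfl⟩, rfl⟩ | ⟨c, hc, rfl⟩), rfl⟩
      · exact Or.inl ⟨h, hh, patSet_singleton h⟩
      · exact Or.inr ⟨c, hc, patSet_singleton (point c)⟩
  · simp only [drawnDesc, List.all_append, Bool.and_eq_true, hobs, true_and, List.all_eq_true,
      List.mem_flatMap]
    rintro p ⟨c, -, hp⟩
    rcases List.mem_cons.1 hp with rfl | hp
    · exact (permB_pair c).1
    · rw [List.mem_singleton.1 hp]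
      exact (permB_pair c).2
  · rw [List.all_eq_true] at hreq ⊢
    intro L hL
    rcases List.mem_append.1 hL with hL | hL
    · obtain ⟨p, hp, rfl⟩ := List.mem_map.1 hL
      simp [hreq p hp]
    · obtain ⟨c, hc, rfl⟩ := List.mem_map.1 hL
      rfl

namespace Desc

/-- A sufficient test for a gridded permutation with this list of entries to fit the description. -/
def accepts (A : Desc) (p : Pat) : Bool :=
  p.all (fun x => A.cells.any (cellEq x.2)) && A.obs.all (fun o => Nat.blt p.length o.length) &&
    A.req.all fun L => L.any (containsB p)

theorem mem_of_accepts {A : Desc} {g : GriddedPerm} (h : A.accepts g.toPat = true) : A.Mem g := by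
  simp only [accepts, Bool.and_eq_true, List.all_eq_true, any_cellEq_iff, Nat.blt_eq,
    toPat_length] at h
  obtain ⟨⟨h1, h2⟩, h3⟩ := h
  have hself : g.Has g.toPat := contains_iff_has.1
    ⟨RelEmbedding.refl _, fun _ _ => Iff.rfl, fun _ => rfl⟩
  -- Obstructions are avoided for the crude reason that they are longer than `g`, which is enough
  -- for the small witnesses in use.
  refine ⟨fun i => ?_, fun o ho hgo => (h2 o ho).not_ge hgo.length_le, fun L hL => ?_⟩
  · exact h1 ((g.perm i : ℕ), g.cell i) ((List.mem_ofFn' _ _).2 ⟨i, rfl⟩)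
  · obtain ⟨r, hr, hgr⟩ := List.any_eq_true.1 (h3 L hL)
    exact ⟨r, hr, hself.of_containsB hgr⟩

/-- Add an obstruction. -/
def avoid (A : Desc) (p : Pat) : Desc := { A with obs := A.obs ++ [p] }

/-- Add a requirement. -/
def require (A : Desc) (p : Pat) : Desc := { A with req := A.req ++ [[p]] }

end Desc

variable {T : Tiling} {A : Desc}

theorem Tiling.DescribedBy.avoid (H : T.DescribedBy A) (h : GriddedPerm)
    (hp : permB h.toPat = true) :
    (Tiling.mk T.width T.height (T.obs ∪ {h}) T.req).DescribedBy (A.avoid h.toPat) := by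
  refine ⟨H.box, ?_, H.req, ?_, H.permB_req⟩
  · change T.obs ∪ {h} = patSet (A.obs ++ [h.toPat]) ∪ _
    rw [patSet_append, patSet_singleton, Set.union_right_comm, H.obs]
    rfl
  · change (A.obs ++ [h.toPat]).all permB = true
    rw [List.all_append, H.permB_obs]
    simpa using hp

theorem Tiling.DescribedBy.require (H : T.DescribedBy A) (h : GriddedPerm)
    (hp : permB h.toPat = true) :
    (Tiling.mk T.width T.height T.obs (T.req ∪ {{h}})).DescribedBy (A.require h.toPat) := by
  refine ⟨H.box, H.obs, ?_, H.permB_obs, ?_⟩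
  · ext L
    change L ∈ T.req ∪ {{h}} ↔ ∃ l ∈ A.req ++ [[h.toPat]], L = patSet l
    rw [H.req]
    simp only [Set.mem_union, Set.mem_ofPred_eq, Set.mem_singleton_iff, List.mem_append,
      List.mem_singleton, or_and_right, exists_or, exists_eq_left, patSet_singleton]
    rfl
  · change (A.req ++ [[h.toPat]]).all (fun L => L.all permB) = true
    rw [List.all_append, H.permB_req]
    simpa using hp

/-- The hypotheses `s₀`, `s₁` know the children only through their descriptions, so an application
reduces to evaluated tests. The witnesses `g₀`, `g₁` show that both children are nonempty, without
which the strategy does not apply. -/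
theorem produces_reqIns {B₀ B₁ : Tiling} (H : T.DescribedBy A) (h : GriddedPerm)
    (hb : h.InBox T.width T.height) (hp : permB h.toPat = true) {g₀ g₁ : GriddedPerm}
    (h₀ : (A.avoid h.toPat).accepts g₀.toPat = true)
    (h₁ : (A.require h.toPat).accepts g₁.toPat = true)
    (s₀ : ∀ T', (∀ g, g ∈ T'.Grid ↔ (A.avoid h.toPat).Mem g) → Simplifies T' B₀)
    (s₁ : ∀ T', (∀ g, g ∈ T'.Grid ↔ (A.require h.toPat).Mem g) → Simplifies T' B₁) :
    Produces (reqIns {h}) T (![B₀, B₁] : Fin 2 → Tiling) := by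
  have H₀ := (H.avoid h hp).mem_grid_iff
  have H₁ := (H.require h hp).mem_grid_iff
  refine ⟨(![_, _] : Fin 2 → Tiling), if_pos ⟨?_, ⟨g₀, (H₀ _).2 (Desc.mem_of_accepts h₀)⟩,
    ⟨g₁, (H₁ _).2 (Desc.mem_of_accepts h₁)⟩⟩, ?_⟩
  · intro i
    change Fin 2 at i
    revert i
    rw [Fin.forall_fin_two]
    exact ⟨s₀ _ H₀, s₁ _ H₁⟩
  · exact fun o ho => (Set.mem_singleton_iff.1 ho).symm ▸ hb

/-! ### Placed points -/

/-- The test corresponding to `Direction.Further`. -/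
def Direction.furtherB : Direction → Cell → Cell → Bool
  | .left, a, b => Nat.blt a.1 b.1
  | .right, a, b => Nat.blt b.1 a.1
  | .up, a, b => Nat.blt b.2 a.2
  | .down, a, b => Nat.blt a.2 b.2

theorem Direction.furtherB_iff (d : Direction) (a b : Cell) :
    d.furtherB a b = true ↔ d.Further a b := by
  cases d <;> exact Iff.of_eq Nat.blt_eq

namespace Desc

/-- The cells that may be used after placing a point. -/
def placedCells (A : Desc) (c : Cell) (w h : ℕ) : List Cell :=
  ((List.range (w + 2)) ×ˢ (List.range (h + 2))).filter fun x =>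
    A.cells.any (cellEq (contractCell c x)) &&
      (cellEq x (middle c) || (!Nat.beq x.1 (middle c).1 && !Nat.beq x.2 (middle c).2))

/-- The description of the tiling obtained by placing the entry `I` of `p`, in the cell `c`. -/
def place (A : Desc) (p : Pat) (I : ℕ) (c : Cell) (w h : ℕ) (d : Direction) : Desc :=
  let C := A.placedCells c w h
  let m := middle c
  ⟨C, A.obs.flatMap (refine (contractCell c) C) ++ [[(0, m), (1, m)], [(1, m), (0, m)]] ++
      (refine (contractCell c) C p).filter (cellAt (fun x => d.furtherB x m) I),
    ((A.req.filter fun L => L ≠ [p]).map fun L => L.flatMap (refine (contractCell c) C)) ++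
      [[[(0, m)]], (refine (contractCell c) C p).filter (cellAt (fun x => cellEq x m) I)]⟩

theorem mem_placedCells {A : Desc} {c x : Cell} {w h : ℕ} :
    x ∈ A.placedCells c w h ↔ (x.1 < w + 2 ∧ x.2 < h + 2) ∧ contractCell c x ∈ A.cells ∧
      (x = middle c ∨ (x.1 ≠ (middle c).1 ∧ x.2 ≠ (middle c).2)) := by
  simp only [placedCells, List.mem_filter, Bool.and_eq_true, Bool.or_eq_true, any_cellEq_iff,
    cellEq_iff, Bool.not_eq_true', ← Bool.not_eq_true, Nat.beq_eq]
  refine and_congr_left fun _ => ?_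
  obtain ⟨a, b⟩ := x
  exact List.pair_mem_product.trans (and_congr List.mem_range List.mem_range)

end Desc

/-- The isolation of the placed point is encoded twice over: the other cells of its row and column
are missing from `placedCells`, and `12`, `21` and the point requirement fix the middle cell. The
remaining conditions are pulled back along the contraction. -/
theorem Tiling.DescribedBy.mem_placedTiling_iff (H : T.DescribedBy A) (h : GriddedPerm)
    (I : Fin h.size) (hx : (h.cell I).1 < T.width) (hy : (h.cell I).2 < T.height) (d : Direction)
    (g : GriddedPerm) :
    g ∈ (placedTiling h I d T).Grid ↔
      (A.place h.toPat I (h.cell I) T.width T.height d).Mem g := by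
  rw [placedTiling_grid]
  set c := h.cell I
  set m := middle c
  set C := A.placedCells c T.width T.height with hCdef
  have hcon : ∀ i : Fin g.size, (g.contract c).cell i = contractCell c (g.cell i) := fun _ => rfl
  have hcells : (g.InBox (T.width + 2) (T.height + 2) ∧ (∀ o ∈ T.obs, ¬ (g.contract c).Contains o) ∧
      ∃ p, g.Isolated p m) ↔ (∀ i, g.cell i ∈ C) ∧
        (∀ o ∈ A.obs, ¬ (g.contract c).Has o) ∧
        (¬ g.Has [(0, m), (1, m)] ∧ ¬ g.Has [(1, m), (0, m)]) ∧ g.Has [(0, m)] := by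
    have hpt : g.Contains (point m) ↔ g.Has [(0, m)] := contains_iff_has
    have h12 : g.Contains (localized (1 : Equiv.Perm (Fin 2)) m) ↔ g.Has [(0, m), (1, m)] :=
      contains_iff_has
    have h21 : g.Contains (localized p21 m) ↔ g.Has [(1, m), (0, m)] := contains_iff_has
    constructor
    · rintro ⟨hb, ho, hp⟩
      have hb' : (g.contract c).InBox T.width T.height := fun i =>
        ⟨contractIndex_lt hx (hb i).1, contractIndex_lt hy (hb i).2⟩
      obtain ⟨h1, h2⟩ := (H.avoids_iff _).1 ⟨hb', ho⟩
      obtain ⟨h3, -, -, h4⟩ := (exists_isolated_iff hb).2 hp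
      obtain ⟨p, hp1, hp2⟩ := hp
      refine ⟨fun i => Desc.mem_placedCells.2 ⟨hb i, h1 i, ?_⟩, h2, ?_, hpt.1 h4⟩
      · by_cases hi : i = p
        · exact Or.inl (hi ▸ hp1)
        · exact Or.inr (hp2 i hi)
      · exact ⟨fun h => h3.1 (h12.2 h), fun h => h3.2 (h21.2 h)⟩
    · rintro ⟨hC, ho, h3, h4⟩
      have hb : g.InBox (T.width + 2) (T.height + 2) := fun i => (Desc.mem_placedCells.1 (hC i)).1
      refine ⟨hb, ((H.avoids_iff _).2 ⟨fun i =>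
        (hcon i).symm ▸ (Desc.mem_placedCells.1 (hC i)).2.1, ho⟩).2,
        (exists_isolated_iff hb).1 ⟨⟨fun h => h3.1 (h12.1 h), fun h => h3.2 (h21.1 h)⟩,
          ?_, ?_, hpt.2 h4⟩⟩
      · intro j _ hj hg
        obtain ⟨i, hi⟩ := (contains_point_iff _ _).1 hg
        rcases (Desc.mem_placedCells.1 (hC i)).2.2 with h | h
        · exact hj ((congrArg Prod.snd (hi.symm.trans h) : j = m.2))
        · exact h.1 (congrArg Prod.fst hi :)
      · intro j _ hj hg
        obtain ⟨i, hi⟩ := (contains_point_iff _ _).1 hg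
        rcases (Desc.mem_placedCells.1 (hC i)).2.2 with h | h
        · exact hj ((congrArg Prod.fst (hi.symm.trans h) : j = m.1))
        · exact h.2 (congrArg Prod.snd hi :)
  have hreq : (∃ f, (g.contract c).IsOcc h f ∧ g.cell (f I) = m) →
      ((∀ L ∈ T.req, L ≠ {h} → ∃ r ∈ L, (g.contract c).Contains r) ↔
        ∀ l ∈ A.req, l ≠ [h.toPat] → ∃ r ∈ l, (g.contract c).Has r) := by
    rintro ⟨f, hf, -⟩
    rw [H.req]
    constructor
    · intro hL l hl hne
      rw [← H.req_iff hl]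
      -- A list other than `[h.toPat]` may still stand for the set `{h}`, for example by repetition.
      -- It then survives in the description although the strategy removes `{h}`; this is harmless
      -- because `h` occurs in the contraction anyway.
      by_cases he : patSet l = {h}
      · exact ⟨h, by rw [show {o : GriddedPerm | o.toPat ∈ l} = {h} from he]; rfl, f, hf⟩
      · exact hL _ ⟨l, hl, rfl⟩ he
    · rintro hl _ ⟨l, hlA, rfl⟩ hne
      rw [H.req_iff hlA]
      refine hl l hlA fun he => hne ?_
      rw [he]
      exact patSet_singleton h
  have hswap : ∀ {p1 p2 p3 p4 p5 p6 : Prop}, (p1 ∧ p2 ∧ p3 ∧ p4 ∧ p5 ∧ p6) ↔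
      (p1 ∧ p2 ∧ p3) ∧ p4 ∧ p6 ∧ p5 := by
    intros
    tauto
  rw [hswap, hcells, and_assoc]
  refine and_congr_right fun hC => ?_
  have hfur : (∀ f, (g.contract c).IsOcc h f → ¬ d.Further (g.cell (f I)) m) ↔
      ∀ q ∈ (refine (contractCell c) C h.toPat).filter (cellAt (fun x => d.furtherB x m) I),
        ¬ g.Has q := by
    have := exists_isOcc_mapMono_iff (a := contractHom c.1) (b := contractHom c.2) hC I
      (fun x => d.furtherB x m)
    simp only [Direction.furtherB_iff] at this
    rw [← not_iff_not]
    push Not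
    exact this
  have hmid : (∃ f, (g.contract c).IsOcc h f ∧ g.cell (f I) = m) ↔
      ∃ q ∈ (refine (contractCell c) C h.toPat).filter (cellAt (fun x => cellEq x m) I),
        g.Has q := by
    have := exists_isOcc_mapMono_iff (a := contractHom c.1) (b := contractHom c.2) hC I
      (fun x => cellEq x m)
    simp only [cellEq_iff] at this
    exact this
  have hobs : (∀ o ∈ A.obs, ¬ (g.contract c).Has o) ↔
      ∀ o ∈ A.obs.flatMap (refine (contractCell c) C), ¬ g.Has o :=
    (Desc.avoids_flatMap_refine_iff hC _).symm
  have hreq2 : (∀ l ∈ A.req, l ≠ [h.toPat] → ∃ r ∈ l, (g.contract c).Has r) ↔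
      ∀ L ∈ (A.req.filter fun L => L ≠ [h.toPat]).map
        fun L => L.flatMap (refine (contractCell c) C), ∃ r ∈ L, g.Has r := by
    rw [List.forall_mem_map]
    simp only [List.mem_filter, decide_eq_true_eq, and_imp]
    exact forall₂_congr fun l _ => imp_congr_right fun _ =>
      (Desc.exists_flatMap_refine_iff hC l).symm
  have hpair : ∀ {X Y : Pat}, (¬ g.Has X ∧ ¬ g.Has Y) ↔ ∀ o ∈ [X, Y], ¬ g.Has o := by
    intros
    simp
  have hlast : ∀ {L : List Pat}, (∃ q ∈ L, g.Has q) ∧ g.Has [(0, m)] ↔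
      ∀ M ∈ [[[(0, m)]], L], ∃ q ∈ M, g.Has q := by
    intros
    simp [and_comm]
  have hstep : ((∀ f, (g.contract c).IsOcc h f → ¬ d.Further (g.cell (f I)) m) ∧
      (∃ f, (g.contract c).IsOcc h f ∧ g.cell (f I) = m) ∧
      ∀ L ∈ T.req, L ≠ {h} → ∃ r ∈ L, (g.contract c).Contains r) ↔
      ((∀ f, (g.contract c).IsOcc h f → ¬ d.Further (g.cell (f I)) m) ∧
      (∃ f, (g.contract c).IsOcc h f ∧ g.cell (f I) = m) ∧
      ∀ l ∈ A.req, l ≠ [h.toPat] → ∃ r ∈ l, (g.contract c).Has r) :=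
    and_congr_right fun _ => and_congr_right hreq
  have hshape : ∀ {q1 q2 q3 q4 q5 q6 : Prop}, ((q1 ∧ q2 ∧ q3) ∧ q4 ∧ q5 ∧ q6) ↔
      ((q1 ∧ q2) ∧ q4) ∧ q6 ∧ (q5 ∧ q3) := by
    intros
    constructor
    · rintro ⟨⟨h1, h2, h3⟩, h4, h5, h6⟩
      exact ⟨⟨⟨h1, h2⟩, h4⟩, h6, h5, h3⟩
    · rintro ⟨⟨⟨h1, h2⟩, h4⟩, h6, h5, h3⟩
      exact ⟨⟨h1, h2, h3⟩, h4, h5, h6⟩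
  refine (and_congr (and_congr hobs (and_congr_left' hpair))
    (hstep.trans (and_congr hfur (and_congr hmid hreq2)))).trans (hshape.trans ?_)
  rw [hlast, ← List.forall_mem_append, ← List.forall_mem_append, ← List.forall_mem_append]
  exact Iff.rfl

theorem produces_pointPl {B : Tiling} (H : T.DescribedBy A) (h : GriddedPerm) (I : Fin h.size)
    (d : Direction) (hmem : A.req.any (fun L => decide (L = [h.toPat])) = true)
    (hx : (h.cell I).1 < T.width) (hy : (h.cell I).2 < T.height)
    (s : ∀ T', (∀ g, g ∈ T'.Grid ↔ (A.place h.toPat I (h.cell I) T.width T.height d).Mem g) →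
      Simplifies T' B) :
    Produces (pointPl h I d) T (![B] : Fin 1 → Tiling) := by
  have hmem' : {h} ∈ T.req := by
    obtain ⟨L, hL, he⟩ := List.any_eq_true.1 hmem
    rw [H.req]
    exact ⟨L, hL, by rw [of_decide_eq_true he]; exact (patSet_singleton h).symm⟩
  refine ⟨fun _ => placedTiling h I d T, ?_, ?_⟩
  · have hc : {h} ∈ T.req ∧ (h.cell I).1 < T.width ∧ (h.cell I).2 < T.height :=
      ⟨hmem', hx, hy⟩
    simp only [pointPl, Strategy.unary, if_pos hc]
    rfl
  · intro i
    obtain rfl : i = (0 : Fin 1) := Subsingleton.elim (α := Fin 1) _ _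
    exact s _ (H.mem_placedTiling_iff h I hx hy d)

end CombExp
namespace CombExp

/-! ### Descriptions of separated tilings -/

variable {T : Tiling} {A : Desc}

/-- The cell map of row separation, for a list of columns. -/
def rowShiftB (r : ℕ) (S : List ℕ) (c : Cell) : Cell :=
  if Nat.blt c.2 r || (Nat.beq c.2 r && S.contains c.1) then c else (c.1, c.2 + 1)

/-- The cell map of column separation, for a list of rows. -/
def colShiftB (q : ℕ) (S : List ℕ) (c : Cell) : Cell :=
  if Nat.blt c.1 q || (Nat.beq c.1 q && S.contains c.2) then c else (c.1 + 1, c.2)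

theorem rowShift_eq (r : ℕ) (S : List ℕ) : rowShift r {i | i ∈ S} = rowShiftB r S := by
  funext c
  simp [rowShift, rowShiftB]

theorem colShift_eq (q : ℕ) (S : List ℕ) : colShift q {j | j ∈ S} = colShiftB q S := by
  funext c
  simp [colShift, colShiftB]

theorem merge_rowShift (r : ℕ) (S : Set ℕ) (c : Cell) :
    Prod.map OrderHom.id (mergeIndex r) (rowShift r S c) = c := by
  obtain ⟨a, b⟩ := c
  unfold rowShift
  split_ifs with h <;> refine Prod.ext rfl ?_ <;> simp only [Prod.map_snd, mergeIndex_apply] <;>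
    split_ifs <;> simp at h <;> omega

theorem merge_colShift (q : ℕ) (S : Set ℕ) (c : Cell) :
    Prod.map (mergeIndex q) OrderHom.id (colShift q S c) = c := by
  obtain ⟨a, b⟩ := c
  unfold colShift
  split_ifs with h <;> refine Prod.ext ?_ rfl <;> simp only [Prod.map_fst, mergeIndex_apply] <;>
    split_ifs <;> simp at h <;> omega

/-- Matches the pulled-back description with the characterization of separated grids: for a cell
over `A.cells`, lying in the image of `γ` means being fixed by merging and then splitting. -/
theorem Desc.mem_pull_map_iff {γ : Cell → Cell} {a b : ℕ →o ℕ}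
    (hγ : ∀ c, Prod.map a b (γ c) = c) (g : GriddedPerm) :
    (A.pull (Prod.map a b) (A.cells.map γ)).Mem g ↔
      (∀ i, γ (Prod.map a b (g.cell i)) = g.cell i) ∧ A.Mem (g.mapMono a b) := by
  rw [Desc.mem_pull_iff]
  · refine and_congr_left fun hA => forall_congr' fun i => ?_
    constructor
    · intro h
      obtain ⟨c, _, hc⟩ := List.mem_map.1 h
      rw [← hc, hγ]
    · exact fun h => List.mem_map.2 ⟨_, hA.1 i, h⟩
  · intro c hc
    obtain ⟨c, hc', rfl⟩ := List.mem_map.1 hc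
    rwa [hγ]

/-- The test for the critical row patterns to be obstructions. -/
def Desc.rowSeparable (A : Desc) (r : ℕ) (S : List ℕ) : Bool :=
  S.all fun i => A.cells.any (cellEq (i, r)) && A.cells.all fun c =>
    !Nat.beq c.2 r || S.contains c.1 ||
      ((!Nat.blt i c.1 || decide ([(1, (i, r)), (0, c)] ∈ A.obs)) &&
        (!Nat.blt c.1 i || decide ([(0, c), (1, (i, r))] ∈ A.obs)))

/-- The test for the critical column patterns to be obstructions. -/
def Desc.colSeparable (A : Desc) (q : ℕ) (S : List ℕ) : Bool :=
  S.all fun j => A.cells.any (cellEq (q, j)) && A.cells.all fun c =>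
    !Nat.beq c.1 q || S.contains c.2 ||
      ((!Nat.blt j c.2 || decide ([(1, c), (0, (q, j))] ∈ A.obs)) &&
        (!Nat.blt c.2 j || decide ([(0, c), (1, (q, j))] ∈ A.obs)))

/-- No obstruction is a point. -/
def Desc.noPoint (A : Desc) : Bool := A.obs.all fun p => !Nat.beq p.length 1

theorem Tiling.DescribedBy.mem_obs (H : T.DescribedBy A) {o : GriddedPerm}
    (h : o.toPat ∈ A.obs) : o ∈ T.obs := by
  rw [H.obs]
  exact Or.inl h

theorem produces_rowSep {B : Tiling} (H : T.DescribedBy A) (r : ℕ) (S : List ℕ)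
    {S' : Set ℕ} (hS' : S' = {i | i ∈ S}) (hS : S ≠ [])
    (hA : A.noPoint = true) (hsep : A.rowSeparable r S = true)
    (s : ∀ T', (∀ g, g ∈ T'.Grid ↔ (A.pull (Prod.map OrderHom.id (mergeIndex r))
      (A.cells.map (rowShiftB r S))).Mem g) → Simplifies T' B) :
    Produces (rowSep r S') T (![B] : Fin 1 → Tiling) := by
  subst hS'
  have hne := H.nonemptyCells_eq hA
  simp only [Desc.rowSeparable, List.all_eq_true, Bool.and_eq_true, Bool.or_eq_true,
    any_cellEq_iff, Bool.not_eq_true', ← Bool.not_eq_true, Nat.beq_eq, Nat.blt_eq,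
    List.contains_iff_mem, decide_eq_true_eq] at hsep
  have hc : ({i | i ∈ S} : Set ℕ).Nonempty ∧ (∀ i ∈ {i | i ∈ S}, (i, r) ∈ T.nonemptyCells) ∧
      criticalRow T r {i | i ∈ S} ⊆ T.obs := by
    refine ⟨List.exists_mem_of_ne_nil S hS, fun i hi => ?_, ?_⟩
    · rw [hne]
      exact (hsep i hi).1
    · rintro o ⟨i, hi, i', hi', hi'T, ho⟩
      rw [hne] at hi'T
      -- The other alternatives of the test, a different row or a column in `S`, are excluded for
      -- `i'`.
      have h := (((hsep i hi).2 _ hi'T).resolve_left fun h => h.elim (fun h => h rfl) hi')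
      apply H.mem_obs
      rcases ho with ⟨hlt, ho⟩ | ⟨hlt, ho⟩
      · rw [gridded_eq_patSet] at ho
        rw [List.mem_singleton.1 ho]
        exact h.1.resolve_left fun h => h hlt
      · rw [gridded_eq_patSet] at ho
        rw [List.mem_singleton.1 ho]
        exact h.2.resolve_left fun h => h hlt
  have hd : ∃ B', (rowSep r {i | i ∈ S}).d T = some B' := by
    simp only [rowSep, Strategy.unary, if_pos hc]
    exact ⟨_, rfl⟩
  obtain ⟨B', hB'⟩ := hd
  refine ⟨B', hB', fun i => ?_⟩
  obtain rfl : i = (0 : Fin 1) := Subsingleton.elim (α := Fin 1) _ _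
  refine s _ fun g => ?_
  rw [← rowShift_eq, Desc.mem_pull_map_iff (merge_rowShift r _), ← H.mem_grid_iff]
  exact (rowSep_spec hB' _ rfl).2 g

theorem produces_colSep {B : Tiling} (H : T.DescribedBy A) (r : ℕ) (S : List ℕ)
    {S' : Set ℕ} (hS' : S' = {i | i ∈ S}) (hS : S ≠ [])
    (hA : A.noPoint = true) (hsep : A.colSeparable r S = true)
    (s : ∀ T', (∀ g, g ∈ T'.Grid ↔ (A.pull (Prod.map (mergeIndex r) OrderHom.id)
      (A.cells.map (colShiftB r S))).Mem g) → Simplifies T' B) :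
    Produces (colSep r S') T (![B] : Fin 1 → Tiling) := by
  subst hS'
  have hne := H.nonemptyCells_eq hA
  simp only [Desc.colSeparable, List.all_eq_true, Bool.and_eq_true, Bool.or_eq_true,
    any_cellEq_iff, Bool.not_eq_true', ← Bool.not_eq_true, Nat.beq_eq, Nat.blt_eq,
    List.contains_iff_mem, decide_eq_true_eq] at hsep
  have hc : ({i | i ∈ S} : Set ℕ).Nonempty ∧ (∀ i ∈ {i | i ∈ S}, (r, i) ∈ T.nonemptyCells) ∧
      criticalCol T r {i | i ∈ S} ⊆ T.obs := by
    refine ⟨List.exists_mem_of_ne_nil S hS, fun i hi => ?_, ?_⟩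
    · rw [hne]
      exact (hsep i hi).1
    · rintro o ⟨i, hi, i', hi', hi'T, ho⟩
      rw [hne] at hi'T
      have h := (((hsep i hi).2 _ hi'T).resolve_left fun h => h.elim (fun h => h rfl) hi')
      apply H.mem_obs
      rcases ho with ⟨hlt, ho⟩ | ⟨hlt, ho⟩
      · rw [gridded_eq_patSet] at ho
        rw [List.mem_singleton.1 ho]
        exact h.1.resolve_left fun h => h hlt
      · rw [gridded_eq_patSet] at ho
        rw [List.mem_singleton.1 ho]
        exact h.2.resolve_left fun h => h hlt
  have hd : ∃ B', (colSep r {i | i ∈ S}).d T = some B' := by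
    simp only [colSep, Strategy.unary, if_pos hc]
    exact ⟨_, rfl⟩
  obtain ⟨B', hB'⟩ := hd
  refine ⟨B', hB', fun i => ?_⟩
  obtain rfl : i = (0 : Fin 1) := Subsingleton.elim (α := Fin 1) _ _
  refine s _ fun g => ?_
  rw [← colShift_eq, Desc.mem_pull_map_iff (merge_colShift r _), ← H.mem_grid_iff]
  exact (colSep_spec hB' _ rfl).2 g

/-! ### Descriptions of factors -/

/-- All entries of the pattern lie in cells of `C`. -/
def withinB (C : List Cell) (p : Pat) : Bool := p.all fun x => C.any (cellEq x.2)

/-- Some entry of the pattern lies in a cell of `C`. -/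
def involvesB (C : List Cell) (p : Pat) : Bool := p.any fun x => C.any (cellEq x.2)

theorem withinB_iff {C : List Cell} {g : GriddedPerm} :
    withinB C g.toPat = true ↔ g.Within {c | c ∈ C} := by
  simp only [withinB, GriddedPerm.toPat, List.all_eq_true, List.forall_mem_ofFn_iff,
    any_cellEq_iff]
  exact Iff.rfl

theorem involvesB_iff {C : List Cell} {g : GriddedPerm} :
    involvesB C g.toPat = true ↔ g.Involves {c | c ∈ C} := by
  constructor
  · intro h
    obtain ⟨x, hx, hxC⟩ := List.any_eq_true.1 h
    obtain ⟨k, rfl⟩ := (List.mem_ofFn' _ _).1 hx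
    exact ⟨k, any_cellEq_iff.1 hxC⟩
  · rintro ⟨k, hk⟩
    exact List.any_eq_true.2 ⟨_, (List.mem_ofFn' _ _).2 ⟨k, rfl⟩, any_cellEq_iff.2 hk⟩

namespace Desc

/-- The description of the factor on the cells `C`; the cells of the other factors are `D`. -/
def part (A : Desc) (C D : List Cell) : Desc where
  cells := C
  obs := A.obs.filter (withinB C)
  req := (A.req.filter fun L => L.all fun p => !involvesB D p).map fun L => L.filter (withinB C)

/-- A sufficient test for two lists of cells not to interact. -/
def separates (A : Desc) (C D : List Cell) : Bool :=
  (C.all fun a => D.all fun b => !Nat.beq a.1 b.1 && !Nat.beq a.2 b.2) &&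
    (A.obs.all fun o => !(involvesB C o && involvesB D o)) &&
      A.req.all fun L => !(L.any (involvesB C) && L.any (involvesB D))

end Desc

/-- The condition `hreal` is needed for requirements: the tiling asks whether the gridded
permutations of a list touch other parts, the description asks this of all listed patterns, and an
unrealizable pattern could tell the two apart. -/
theorem Tiling.DescribedBy.subtiling {m : ℕ} (H : T.DescribedBy A) {P : Fin m → Set Cell}
    {i : Fin m} {C D : List Cell} (hC : P i = {c | c ∈ C})
    (hD : ∀ c, c ∈ D ↔ ∃ j, j ≠ i ∧ c ∈ P j) (hCA : ∀ c ∈ C, c ∈ A.cells)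
    (hreal : ∀ l ∈ A.req, ∀ p ∈ l, p ∈ Set.range GriddedPerm.toPat) :
    (subtiling P T i).DescribedBy (A.part C D) := by
  have hinv : ∀ h : GriddedPerm, (∀ j, j ≠ i → ¬ h.Involves (P j)) ↔
      (!involvesB D h.toPat) = true := by
    intro h
    rw [Bool.not_eq_true', ← Bool.not_eq_true, involvesB_iff]
    constructor
    · rintro H ⟨k, hk⟩
      obtain ⟨j, hj, hkj⟩ := (hD _).1 hk
      exact H j hj ⟨k, hkj⟩
    · rintro H j hj ⟨k, hk⟩
      exact H ⟨k, (hD _).2 ⟨j, hj, hk⟩⟩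
  refine ⟨fun c hc => H.box c (hCA c hc), ?_, ?_, ?_, ?_⟩
  · ext o
    simp only [CombExp.subtiling, Desc.part, hC, H.obs, Set.mem_union, Set.mem_ofPred_eq,
      List.mem_filter, withinB_iff]
    constructor
    · rintro (⟨h | ⟨c, -, -, hc, rfl⟩, hw⟩ | h)
      · exact Or.inl ⟨h, hw⟩
      · exact absurd (hCA _ (hw (0 : Fin 1))) hc
      · exact Or.inr h
    · rintro (⟨h, hw⟩ | h)
      · exact Or.inl ⟨Or.inl h, hw⟩
      · exact Or.inr h
  · have hl : ∀ l : List Pat, {h : GriddedPerm | h.toPat ∈ l ∧ h.Within {c | c ∈ C}} =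
        {h | h.toPat ∈ l.filter (withinB C)} := by
      intro l
      ext h
      simp only [Set.mem_ofPred_eq, List.mem_filter, withinB_iff]
    ext L
    simp only [CombExp.subtiling, Desc.part, hC, H.req, Set.mem_ofPred_eq, List.mem_map,
      List.mem_filter, List.all_eq_true]
    constructor
    · rintro ⟨_, ⟨l, hlA, rfl⟩, h1, rfl⟩
      refine ⟨_, ⟨l, ⟨hlA, fun p hp => ?_⟩, rfl⟩, hl l⟩
      obtain ⟨h, rfl⟩ := hreal l hlA p hp
      exact (hinv h).1 fun j hj => h1 j hj h hp
    · rintro ⟨_, ⟨l, ⟨hlA, h1⟩, rfl⟩, rfl⟩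
      exact ⟨_, ⟨l, hlA, rfl⟩, fun j hj h hh => (hinv h).2 (h1 _ hh) j hj, (hl l).symm⟩
  · exact List.all_eq_true.2 fun p hp =>
      List.all_eq_true.1 H.permB_obs p (List.mem_of_mem_filter hp)
  · refine List.all_eq_true.2 fun L hL => ?_
    obtain ⟨l, hl, rfl⟩ := List.mem_map.1 hL
    exact List.all_eq_true.2 fun p hp => List.all_eq_true.1
      (List.all_eq_true.1 H.permB_req l (List.mem_of_mem_filter hl)) p (List.mem_of_mem_filter hp)

theorem Tiling.DescribedBy.nonInteracting (H : T.DescribedBy A) {C D : List Cell}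
    (hC : ∀ c ∈ C, c ∈ A.cells) (h : A.separates C D = true) :
    NonInteracting T {c | c ∈ C} {c | c ∈ D} := by
  simp only [Desc.separates, Bool.and_eq_true, List.all_eq_true, Bool.not_eq_true',
    ← Bool.not_eq_true, Nat.beq_eq, List.any_eq_true] at h
  obtain ⟨⟨h1, h2⟩, h3⟩ := h
  refine ⟨h1, ?_, ?_⟩
  · rintro o ho ⟨hoC, hoD⟩
    rw [H.obs] at ho
    rcases ho with ho | ⟨c, -, -, hc, rfl⟩
    · exact h2 _ ho ⟨involvesB_iff.2 hoC, involvesB_iff.2 hoD⟩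
    · obtain ⟨_, hk⟩ := hoC
      exact hc (hC _ hk)
  · rintro L hL ⟨⟨a, ha, haC⟩, ⟨b, hb, hbD⟩⟩
    rw [H.req] at hL
    obtain ⟨l, hl, rfl⟩ := hL
    exact h3 l hl ⟨⟨_, ha, involvesB_iff.2 haC⟩, ⟨_, hb, involvesB_iff.2 hbD⟩⟩

theorem Tiling.DescribedBy.count_zero_eq_zero (H : T.DescribedBy A)
    (h : A.req.any (fun L => L.all fun p => !Nat.beq p.length 0) = true) : T.count 0 = 0 := by
  obtain ⟨L, hL, hLp⟩ := List.any_eq_true.1 h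
  rw [Tiling.count]
  convert Set.ncard_empty GriddedPerm
  refine Set.eq_empty_of_forall_notMem ?_
  rintro g ⟨hg, h0⟩
  obtain ⟨r, hr, hgr⟩ := ((H.mem_grid_iff g).1 hg).2.2 L hL
  have h1 := hgr.length_le
  have h2 := List.all_eq_true.1 hLp r hr
  rw [Bool.not_eq_true', ← Bool.not_eq_true, Nat.beq_eq] at h2
  omega

theorem Tiling.DescribedBy.count_pos (H : T.DescribedBy A) {g : GriddedPerm}
    (h : A.accepts g.toPat = true) : 0 < T.count g.size :=
  Tiling.count_pos_of_mem ((H.mem_grid_iff g).2 (Desc.mem_of_accepts h))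

/-- The part of index `i` and the union of the other parts. -/
def otherCells {m : ℕ} (Q : Fin m → List Cell) (i : Fin m) : List Cell :=
  ((List.finRange m).filter fun j => j ≠ i).flatMap Q

/-- All hypotheses are evaluable tests except `hS`, which involves counts at size `0`; it is
therefore stated with the descriptions of the factors available. -/
theorem produces_factor {m : ℕ} {B : Fin m → Tiling} (H : T.DescribedBy A) (hm : 2 ≤ m)
    {P : Fin m → Set Cell} {S : Finset (Fin m)} (Q : Fin m → List Cell)
    (hP : ∀ i, P i = {c | c ∈ Q i}) (hA : A.noPoint = true)
    (hcov : (A.cells.all fun c => (List.finRange m).any fun i => (Q i).any (cellEq c)) = true)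
    (hsub : ∀ i, ((Q i).all fun c => A.cells.any (cellEq c)) = true)
    (hsep : ∀ i j, i ≠ j → A.separates (Q i) (Q j) = true)
    (hreal : ∀ l ∈ A.req, ∀ p ∈ l, p ∈ Set.range GriddedPerm.toPat)
    (hw : ∀ i, ∃ g : GriddedPerm, 1 ≤ g.size ∧
      (A.part (Q i) (otherCells Q i)).accepts g.toPat = true)
    (hS : (∀ i, (subtiling P T i).DescribedBy (A.part (Q i) (otherCells Q i))) →
      ∀ i, i ∈ S ↔ ∃ j, j ≠ i ∧ (subtiling P T j).count 0 = 0)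
    (s : ∀ i, ∀ T', (∀ g, g ∈ T'.Grid ↔ (A.part (Q i) (otherCells Q i)).Mem g) →
      Simplifies T' (B i)) :
    Produces (factor P S) T B := by
  simp only [List.all_eq_true, any_cellEq_iff] at hsub
  have hD : ∀ i c, c ∈ otherCells Q i ↔ ∃ j, j ≠ i ∧ c ∈ P j := by
    intro i c
    simp [otherCells, hP]
  have HS : ∀ i, (subtiling P T i).DescribedBy (A.part (Q i) (otherCells Q i)) :=
    fun i => H.subtiling (hP i) (hD i) (hsub i) hreal
  refine ⟨subtiling P T, if_pos ⟨hm, ?_, ?_, ?_, hS HS⟩, fun i => s i _ (HS i).mem_grid_iff⟩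
  · rw [H.nonemptyCells_eq hA]
    ext c
    simp only [Set.mem_iUnion, hP, Set.mem_ofPred_eq]
    constructor
    · rintro ⟨i, hi⟩
      exact hsub i c hi
    · intro hc
      obtain ⟨i, -, hi⟩ := List.any_eq_true.1 (List.all_eq_true.1 hcov c hc)
      exact ⟨i, any_cellEq_iff.1 hi⟩
  · intro i j hij
    have := H.nonInteracting (hsub i) (hsep i j hij)
    rw [hP, hP]
    refine ⟨Set.disjoint_left.2 fun c hi hj => (this.1 c hi c hj).1 rfl, this⟩
  · intro i
    obtain ⟨g, hg, hgA⟩ := hw i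
    exact ⟨g, ((HS i).mem_grid_iff g).2 (Desc.mem_of_accepts hgA), hg⟩

end CombExp
-- The individual tilings
namespace CombExp

/-! ### The tilings of the proof tree and their descriptions -/

theorem simplifies_of_equiv {T T' : Tiling} {A A' : Desc} (hT : ∀ g, g ∈ T.Grid ↔ A.Mem g)
    (hT' : ∀ g, g ∈ T'.Grid ↔ A'.Mem g) (h : A.equiv A' = true) : Simplifies T T' := by
  refine ⟨id, id, strictMono_id, strictMono_id, Set.ext fun g => ?_⟩
  rw [hT, Desc.mem_iff_of_equiv h, ← hT', mem_mapCells]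
  constructor
  · exact fun hg => ⟨g, hg, g.consistent, rfl⟩
  · rintro ⟨o, ho, -, rfl⟩
    exact ho

/-- The left inverse `n ↦ (n - k) / p` of `n ↦ p * n + k`. -/
def unscale (p k : ℕ) : ℕ →o ℕ where
  toFun n := (n - k) / p
  monotone' _ _ h := Nat.div_le_div_right (Nat.sub_le_sub_right h k)

/-- In most of the simplifications that delete lines, the retained columns and rows form arithmetic
progressions, such as columns `0, 2` or `1, 3` of `T6`. -/
theorem simplifies_of_scale {T T' : Tiling} {A A' : Desc} (hT : ∀ g, g ∈ T.Grid ↔ A.Mem g)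
    (hT' : ∀ g, g ∈ T'.Grid ↔ A'.Mem g) (p k p' k' : ℕ) (hp : 0 < p) (hp' : 0 < p')
    (h : A.equiv (A'.pull (Prod.map (unscale p k) (unscale p' k'))
      (A'.cells.map (Prod.map (fun n => p * n + k) fun n => p' * n + k'))) = true) :
    Simplifies T T' := by
  have hmono : ∀ {p : ℕ} (k : ℕ), 0 < p → StrictMono fun n => p * n + k := fun k hp _ _ h =>
    Nat.add_lt_add_right (Nat.mul_lt_mul_of_pos_left h hp) k
  have hinv : ∀ {p : ℕ} (k : ℕ), 0 < p → ∀ n, unscale p k (p * n + k) = n := fun {p} k hp n => by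
    change (p * n + k - k) / p = n
    rw [Nat.add_sub_cancel, Nat.mul_div_cancel_left _ hp]
  exact simplifies_of_desc hT hT' (hmono k hp) (hmono k' hp') _ _ (hinv k hp) (hinv k' hp') h

theorem empty_eq_setOf_mem {α : Type*} : (∅ : Set α) = {x | x ∈ ([] : List α)} :=
  Set.ext fun _ => by simp

theorem empty_eq_patSet : (∅ : Set GriddedPerm) = patSet [] := empty_eq_setOf_mem.trans
  (Set.ext fun o => by simp [patSet])

abbrev desc1 : Desc := ⟨[(0, 0)], basisPats (0, 0), []⟩
abbrev desc2 : Desc := drawnDesc [] [] [] []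
abbrev desc3 : Desc := drawnDesc [] [(0, 0)] (basisPats (0, 0)) [[(0, (0, 0))]]
abbrev desc4 : Desc := drawnDesc [] [(0, 0)] (pats12 (0, 0) (0, 0)) [[(0, (0, 0))]]
abbrev desc5 : Desc :=
  drawnDesc [] [(0, 0)] (basisPats (0, 0)) [[(0, (0, 0)), (1, (0, 0))]]

/-- The patterns of `obsT11'`. -/
def patsT11' : List Pat :=
  rightmostPats (0, 0) (0, 2) ++ pats12 (0, 0) (2, 0) ++ pats12 (2, 0) (2, 0)

abbrev desc5' : Desc :=
  drawnDesc [(1, 1)] [(0, 0), (0, 2), (2, 0)] patsT11' [[(0, (0, 0))]]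
abbrev desc5'' : Desc :=
  drawnDesc [(1, 1), (3, 3)] [(0, 4), (2, 0), (2, 2), (2, 4), (4, 0)]
    (leftmostPats (2, 0) (2, 2) ++ pairPats (0, 4) (2, 4) ++ pats12 (2, 0) (4, 0) ++
      pats12 (2, 0) (2, 4) ++ pats12 (2, 2) (2, 4) ++ pats12 (4, 0) (4, 0)) []
abbrev desc5''' : Desc :=
  drawnDesc [(1, 2), (3, 4)] [(0, 5), (2, 1), (2, 3), (2, 5), (4, 0)]
    (leftmostPats (2, 1) (2, 3) ++ pairPats (0, 5) (2, 5) ++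
      pats12 (2, 1) (2, 5) ++ pats12 (2, 3) (2, 5) ++ pats12 (4, 0) (4, 0)) []
abbrev desc6 : Desc :=
  drawnDesc [(1, 2), (4, 4)] [(0, 5), (2, 5), (3, 1), (3, 3), (5, 0)]
    (leftmostPats (3, 1) (3, 3) ++ pairPats (0, 5) (2, 5) ++ pats12 (5, 0) (5, 0)) []
abbrev desc7 : Desc := drawnDesc [] [(0, 0), (1, 0)] (pairPats (0, 0) (1, 0)) []
abbrev desc8 : Desc := drawnDesc [(0, 1)] [(1, 0), (1, 2)] (leftmostPats (1, 0) (1, 2)) []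
abbrev desc9 : Desc := drawnDesc [(0, 0)] [] [] []
abbrev desc10 : Desc := drawnDesc [] [(0, 0)] (pats12 (0, 0) (0, 0)) []
abbrev desc11 : Desc :=
  drawnDesc [] [(0, 0), (1, 0)] (pairPats (0, 0) (1, 0)) [[(0, (1, 0))]]
abbrev desc11' : Desc := drawnDesc [(1, 1)] [(0, 0), (0, 2), (2, 0)] patsT11' []
abbrev desc12 : Desc :=
  drawnDesc [(1, 2)] [(0, 1), (0, 3), (2, 0)]
    (rightmostPats (0, 1) (0, 3) ++ pats12 (2, 0) (2, 0)) []
abbrev desc13 : Desc := drawnDesc [(1, 1)] [(0, 0), (0, 2)] (rightmostPats (0, 0) (0, 2)) []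

theorem describedBy1 : T1.DescribedBy desc1 := by
  refine ⟨by decide, ?_, ?_, by decide +kernel, rfl⟩
  · change {o | ∃ σ ∈ basis, o = localized σ.2 (0, 0)} = patSet (basisPats (0, 0)) ∪ _
    rw [← basisAt_eq_patSet]
    ext o
    simp only [basis, basisAt, Set.mem_insert_iff, Set.mem_singleton_iff, exists_eq_or_imp,
      exists_eq_left, Set.mem_union, Set.mem_ofPred_eq]
    refine (or_iff_left ?_).symm
    rintro ⟨⟨a, b⟩, h1, h2, h3, -⟩
    obtain rfl := Nat.lt_one_iff.1 h1
    obtain rfl := Nat.lt_one_iff.1 h2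
    exact h3 (List.mem_singleton_self _)
  · change ∅ = _
    ext L
    simp

theorem describedBy2 : T2.DescribedBy desc2 :=
  drawn_describedBy [] [] [] [] empty_eq_setOf_mem empty_eq_setOf_mem empty_eq_patSet
    empty_eq_setOf_mem (by decide) rfl rfl

theorem describedBy3 : T3.DescribedBy desc3 :=
  drawn_describedBy [] [(0, 0)] _ [point (0, 0)] empty_eq_setOf_mem (by ext; simp)
    (basisAt_eq_patSet _) (by ext; simp) (by decide) (by decide +kernel) (by decide +kernel)

theorem describedBy4 : T4.DescribedBy desc4 :=
  drawn_describedBy [] [(0, 0)] _ [point (0, 0)] empty_eq_setOf_mem (by ext; simp)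
    (obs12_eq_patSet _ _) (by ext; simp) (by decide) (by decide +kernel) (by decide +kernel)

theorem describedBy5 : T5.DescribedBy desc5 :=
  drawn_describedBy [] [(0, 0)] _ [req12] empty_eq_setOf_mem (by ext; simp)
    (basisAt_eq_patSet _) (by ext; simp) (by decide) (by decide +kernel) (by decide +kernel)

theorem obsT11'_eq_patSet : obsT11' = patSet patsT11' := by
  simp only [obsT11', patsT11', patSet_append, rightmostObs_eq_patSet, obs12_eq_patSet]

theorem describedBy5' : T5'.DescribedBy desc5' :=
  drawn_describedBy [(1, 1)] [(0, 0), (0, 2), (2, 0)] _ [point (0, 0)] (by ext; simp)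
    (by ext; simp) obsT11'_eq_patSet (by ext; simp) (by decide) (by decide +kernel)
    (by decide +kernel)

theorem describedBy5'' : T5''.DescribedBy desc5'' :=
  drawn_describedBy [(1, 1), (3, 3)] [(0, 4), (2, 0), (2, 2), (2, 4), (4, 0)] _ []
    (by ext; simp) (by ext; simp)
    (by simp only [patSet_append, leftmostObs_eq_patSet, pairObs_eq_patSet, obs12_eq_patSet])
    empty_eq_setOf_mem (by decide) (by decide +kernel) rfl

theorem describedBy5''' : T5'''.DescribedBy desc5''' :=
  drawn_describedBy [(1, 2), (3, 4)] [(0, 5), (2, 1), (2, 3), (2, 5), (4, 0)] _ []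
    (by ext; simp) (by ext; simp)
    (by simp only [patSet_append, leftmostObs_eq_patSet, pairObs_eq_patSet, obs12_eq_patSet])
    empty_eq_setOf_mem (by decide) (by decide +kernel) rfl

theorem describedBy6 : T6.DescribedBy desc6 :=
  drawn_describedBy [(1, 2), (4, 4)] [(0, 5), (2, 5), (3, 1), (3, 3), (5, 0)] _ []
    (by ext; simp) (by ext; simp)
    (by simp only [patSet_append, leftmostObs_eq_patSet, pairObs_eq_patSet, obs12_eq_patSet])
    empty_eq_setOf_mem (by decide) (by decide +kernel) rfl

theorem describedBy7 : T7.DescribedBy desc7 :=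
  drawn_describedBy [] [(0, 0), (1, 0)] _ [] empty_eq_setOf_mem (by ext; simp)
    (pairObs_eq_patSet _ _) empty_eq_setOf_mem (by decide) (by decide +kernel) rfl

theorem describedBy8 : T8.DescribedBy desc8 :=
  drawn_describedBy [(0, 1)] [(1, 0), (1, 2)] _ [] (by ext; simp) (by ext; simp)
    (leftmostObs_eq_patSet _ _) empty_eq_setOf_mem (by decide) (by decide +kernel) rfl

theorem describedBy9 : T9.DescribedBy desc9 :=
  drawn_describedBy [(0, 0)] [] _ [] (by ext; simp) empty_eq_setOf_mem empty_eq_patSet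
    empty_eq_setOf_mem (by decide) rfl rfl

theorem describedBy10 : T10.DescribedBy desc10 :=
  drawn_describedBy [] [(0, 0)] _ [] empty_eq_setOf_mem (by ext; simp) (obs12_eq_patSet _ _)
    empty_eq_setOf_mem (by decide) (by decide +kernel) rfl

theorem describedBy11 : T11.DescribedBy desc11 :=
  drawn_describedBy [] [(0, 0), (1, 0)] _ [point (1, 0)] empty_eq_setOf_mem (by ext; simp)
    (pairObs_eq_patSet _ _) (by ext; simp) (by decide) (by decide +kernel) (by decide +kernel)

theorem describedBy11' : T11'.DescribedBy desc11' :=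
  drawn_describedBy [(1, 1)] [(0, 0), (0, 2), (2, 0)] _ [] (by ext; simp) (by ext; simp)
    obsT11'_eq_patSet empty_eq_setOf_mem (by decide) (by decide +kernel) rfl

theorem describedBy12 : T12.DescribedBy desc12 :=
  drawn_describedBy [(1, 2)] [(0, 1), (0, 3), (2, 0)] _ [] (by ext; simp) (by ext; simp)
    (by simp only [patSet_append, rightmostObs_eq_patSet, obs12_eq_patSet])
    empty_eq_setOf_mem (by decide) (by decide +kernel) rfl

theorem describedBy13 : T13.DescribedBy desc13 :=
  drawn_describedBy [(1, 1)] [(0, 0), (0, 2)] _ [] (by ext; simp) (by ext; simp)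
    (rightmostObs_eq_patSet _ _) empty_eq_setOf_mem (by decide) (by decide +kernel) rfl

end CombExp
-- Evaluation of the rules
namespace CombExp

/-! ### The rules of the proof tree -/

/-- The empty gridded permutation. -/
abbrev emptyPerm : GriddedPerm := localized (1 : Equiv.Perm (Fin 0)) (0, 0)

theorem produces_insPoint : Produces insPoint T1 (![T2, T3] : Fin 2 → Tiling) :=
  produces_reqIns describedBy1 (point (0, 0)) (by intro i; decide +revert) (by decide +kernel)
    (g₀ := emptyPerm) (g₁ := point (0, 0)) (by decide +kernel) (by decide +kernel)
    (fun _ h => simplifies_of_equiv h describedBy2.mem_grid_iff (by decide +kernel))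
    (fun _ h => simplifies_of_equiv h describedBy3.mem_grid_iff (by decide +kernel))

theorem produces_ins12 : Produces ins12 T3 (![T4, T5] : Fin 2 → Tiling) :=
  produces_reqIns describedBy3 req12 (by intro i; decide +revert) (by decide +kernel)
    (g₀ := point (0, 0)) (g₁ := req12) (by decide +kernel) (by decide +kernel)
    (fun _ h => simplifies_of_equiv h describedBy4.mem_grid_iff (by decide +kernel))
    (fun _ h => simplifies_of_equiv h describedBy5.mem_grid_iff (by decide +kernel))

theorem produces_insRightPoint :
    Produces insRightPoint T7 (![T1, T11] : Fin 2 → Tiling) :=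
  produces_reqIns describedBy7 (point (1, 0)) (by intro i; decide +revert) (by decide +kernel)
    (g₀ := emptyPerm) (g₁ := point (1, 0)) (by decide +kernel) (by decide +kernel)
    (fun _ h => simplifies_of_equiv h describedBy1.mem_grid_iff (by decide +kernel))
    (fun _ h => simplifies_of_equiv h describedBy11.mem_grid_iff (by decide +kernel))

/-- The point is leftmost, so the column to its left is empty; the retained columns are `n + 1`. -/
theorem produces_pointPl_T8 :
    Produces (pointPl (point (0, 0)) (0 : Fin 1) .left) T3 (![T8] : Fin 1 → Tiling) :=
  produces_pointPl describedBy3 _ _ _ (by decide +kernel) (by decide) (by decide)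
    fun _ h => simplifies_of_scale h describedBy8.mem_grid_iff 1 1 1 0 one_pos one_pos
      (by decide +kernel)

/-- The empty column is now the last one, so deleting it moves no cell and no relabelling is needed.
-/
theorem produces_pointPl_T13 :
    Produces (pointPl (point (0, 0)) (0 : Fin 1) .right) T3 (![T13] : Fin 1 → Tiling) :=
  produces_pointPl describedBy3 _ _ _ (by decide +kernel) (by decide) (by decide)
    fun _ h => simplifies_of_equiv h describedBy13.mem_grid_iff (by decide +kernel)

theorem produces_pointPl_T5' :
    Produces (pointPl req12 (1 : Fin 2) .right) T5 (![T5'] : Fin 1 → Tiling) :=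
  produces_pointPl describedBy5 _ _ _ (by decide +kernel) (by decide) (by decide)
    fun _ h => simplifies_of_equiv h describedBy5'.mem_grid_iff (by decide +kernel)

theorem produces_pointPl_T5'' :
    Produces (pointPl (point (0, 0)) (0 : Fin 1) .left) T5' (![T5''] : Fin 1 → Tiling) :=
  produces_pointPl describedBy5' _ _ _ (by decide +kernel) (by decide) (by decide)
    fun _ h => simplifies_of_equiv h describedBy5''.mem_grid_iff (by decide +kernel)

theorem produces_rowSep_T5''' : Produces (rowSep 0 {4}) T5'' (![T5'''] : Fin 1 → Tiling) :=
  produces_rowSep describedBy5'' 0 [4] (by ext; simp) (List.cons_ne_nil _ _) (by decide +kernel)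
    (by decide +kernel)
    fun _ h => simplifies_of_equiv h describedBy5'''.mem_grid_iff (by decide +kernel)

theorem produces_colSep_T6 : Produces (colSep 2 {5}) T5''' (![T6] : Fin 1 → Tiling) :=
  produces_colSep describedBy5''' 2 [5] (by ext; simp) (List.cons_ne_nil _ _) (by decide +kernel)
    (by decide +kernel)
    fun _ h => simplifies_of_equiv h describedBy6.mem_grid_iff (by decide +kernel)

theorem produces_pointPl_T11' :
    Produces (pointPl (point (1, 0)) (0 : Fin 1) .left) T11 (![T11'] : Fin 1 → Tiling) := by
  -- Column `1` is split into `1, 2, 3`, and the leftmost point empties column `1`. The retained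
  -- columns `0, 2, 3` are not an arithmetic progression, so the embedding is given by hand, with
  -- left inverse `mergeIndex 0`.
  have hmono : StrictMono fun i : ℕ => if i = 0 then 0 else i + 1 := by
    intro i j hij
    dsimp only
    split_ifs <;> omega
  refine produces_pointPl describedBy11 _ _ _ (by decide +kernel) (by decide) (by decide)
    fun _ h => simplifies_of_desc h describedBy11'.mem_grid_iff hmono strictMono_id
      (mergeIndex 0) OrderHom.id (fun n => ?_) (fun _ => rfl) (by decide +kernel)
  rw [mergeIndex_apply]
  split_ifs <;> omega

theorem produces_rowSep_T12 : Produces (rowSep 0 {2}) T11' (![T12] : Fin 1 → Tiling) :=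
  produces_rowSep describedBy11' 0 [2] (by ext; simp) (List.cons_ne_nil _ _) (by decide +kernel)
    (by decide +kernel)
    fun _ h => simplifies_of_equiv h describedBy12.mem_grid_iff (by decide +kernel)

/-- The parts of the partition `partsT6`. -/
def cellsT6 : Fin 4 → List Cell :=
  ![[(0, 5), (2, 5)], [(1, 2), (3, 1), (3, 3)], [(4, 4)], [(5, 0)]]

/-- The parts of the partition `partsT12`. -/
def cellsT12 : Fin 2 → List Cell := ![[(0, 1), (0, 3), (1, 2)], [(2, 0)]]

theorem singleton_mem_range_toPat (c : Cell) : [(0, c)] ∈ Set.range GriddedPerm.toPat :=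
  ⟨point c, rfl⟩

/-- Two indices with value `0` suffice: whichever index is removed, one of them remains. -/
theorem mem_univ_iff_exists_zero {m : ℕ} {a : Fin m → ℕ} {j k : Fin m} (hjk : j ≠ k)
    (hj : a j = 0) (hk : a k = 0) (i : Fin m) :
    i ∈ Finset.univ ↔ ∃ j, j ≠ i ∧ a j = 0 := by
  refine iff_of_true (Finset.mem_univ i) ?_
  by_cases h : j = i
  · exact ⟨k, fun hki => hjk (h.trans hki.symm), hk⟩
  · exact ⟨j, h, hj⟩

theorem produces_factorT6 :
    Produces factorT6 T6 (![T7, T8, T9, T10] : Fin 4 → Tiling) := by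
  refine produces_factor describedBy6 (by decide) cellsT6 ?_ (by decide +kernel)
    (by decide +kernel) (by decide +kernel) (by decide +kernel) ?_ ?_ ?_ ?_
  · rw [Fin.forall_fin_succ, Fin.forall_fin_succ, Fin.forall_fin_two]
    refine ⟨?_, ?_, ?_, ?_⟩ <;> ext <;> simp [partsT6, cellsT6]
  · intro l hl p hp
    simp only [drawnDesc, List.map_nil, List.nil_append, List.map_cons, List.mem_cons,
      List.not_mem_nil, or_false] at hl
    rcases hl with rfl | rfl <;> rw [List.mem_singleton.1 hp] <;>
      exact singleton_mem_range_toPat _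
  · intro i
    refine ⟨point ((![(0, 5), (1, 2), (4, 4), (5, 0)] : Fin 4 → Cell) i), le_rfl, ?_⟩
    revert i
    decide +kernel
  -- The factors simplifying to `T8` and `T9` both require a point, so neither has an object of size
  -- `0`.
  · exact fun H => mem_univ_iff_exists_zero (j := 1) (k := 2) (by decide)
      ((H 1).count_zero_eq_zero (by decide +kernel)) ((H 2).count_zero_eq_zero (by decide +kernel))
  · rw [Fin.forall_fin_succ, Fin.forall_fin_succ, Fin.forall_fin_two]
    exact ⟨fun _ h => simplifies_of_scale h describedBy7.mem_grid_iff 2 0 1 5 two_pos one_pos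
        (by decide +kernel),
      fun _ h => simplifies_of_scale h describedBy8.mem_grid_iff 2 1 1 1 two_pos one_pos
        (by decide +kernel),
      fun _ h => simplifies_of_scale h describedBy9.mem_grid_iff 1 4 1 4 one_pos one_pos
        (by decide +kernel),
      fun _ h => simplifies_of_scale h describedBy10.mem_grid_iff 1 5 1 0 one_pos one_pos
        (by decide +kernel)⟩

theorem produces_factorT12 : Produces factorT12 T12 (![T13, T10] : Fin 2 → Tiling) := by
  refine produces_factor describedBy12 le_rfl cellsT12 ?_ (by decide +kernel)
    (by decide +kernel) (by decide +kernel) (by decide +kernel) ?_ ?_ ?_ ?_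
  · rw [Fin.forall_fin_two]
    refine ⟨?_, ?_⟩ <;> ext <;> simp [partsT12, cellsT12]
  · intro l hl p hp
    simp only [drawnDesc, List.map_nil, List.nil_append, List.map_cons, List.mem_cons,
      List.not_mem_nil, or_false] at hl
    rw [hl] at hp
    rw [List.mem_singleton.1 hp]
    exact singleton_mem_range_toPat _
  · intro i
    refine ⟨point ((![(1, 2), (2, 0)] : Fin 2 → Cell) i), le_rfl, ?_⟩
    revert i
    decide +kernel
  · intro H
    have h0 := (H 0).count_zero_eq_zero (by decide +kernel)
    -- The second factor has no requirement and admits the empty permutation, whereas the first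
    -- requires a point; hence exactly the index `1` belongs to the reliance set.
    have h1 : (subtiling partsT12 T12 1).count 0 ≠ 0 :=
      ((H 1).count_pos (g := emptyPerm) (by decide +kernel)).ne'
    rw [Fin.forall_fin_two]
    constructor
    · refine iff_of_false (by decide) ?_
      rintro ⟨j, hj, h⟩
      rw [Fin.eq_one_of_ne_zero j hj] at h
      exact h1 h
    · exact iff_of_true (by decide) ⟨0, by decide, h0⟩
  · rw [Fin.forall_fin_two]
    exact ⟨fun _ h => simplifies_of_scale h describedBy13.mem_grid_iff 1 0 1 1 one_pos one_pos
        (by decide +kernel),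
      fun _ h => simplifies_of_scale h describedBy10.mem_grid_iff 1 2 1 0 one_pos one_pos
        (by decide +kernel)⟩

end CombExp
-- Verified sequences and validity
namespace CombExp

/-! ### Counting sequences of the verified tilings -/

variable {T : Tiling} {A : Desc}

theorem Tiling.count_eq_one {n : ℕ} {x : GriddedPerm}
    (h : ∀ g, g ∈ T.Grid ∧ g.size = n ↔ g = x) : T.count n = 1 := by
  rw [Tiling.count, show {g | g ∈ T.Grid ∧ g.size = n} = {x} from Set.ext h, Set.ncard_singleton]

theorem Tiling.count_eq_zero {n : ℕ} (h : ∀ g, g ∈ T.Grid → g.size ≠ n) : T.count n = 0 := by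
  rw [Tiling.count, Set.eq_empty_of_forall_notMem (s := {g | g ∈ T.Grid ∧ g.size = n})
    fun g hg => h g hg.1 hg.2, Set.ncard_empty]

theorem eq_emptyPerm {g : GriddedPerm} (h : g.size = 0) : g = emptyPerm :=
  toPat_injective (by rw [List.length_eq_zero_iff.1 ((toPat_length g).trans h)]; rfl)

theorem count_T2 (n : ℕ) : T2.count n = if n = 0 then 1 else 0 := by
  have hsize : ∀ g ∈ T2.Grid, g.size = 0 := fun g hg => by
    by_contra h
    have h1 := ((describedBy2.mem_grid_iff g).1 hg).1 ⟨0, Nat.pos_of_ne_zero h⟩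
    simp [drawnDesc] at h1
  split_ifs with hn
  · subst hn
    refine Tiling.count_eq_one fun g => ⟨fun h => eq_emptyPerm h.2, ?_⟩
    rintro rfl
    exact ⟨(describedBy2.mem_grid_iff _).2 (Desc.mem_of_accepts (by decide +kernel)), rfl⟩
  · exact Tiling.count_eq_zero fun g hg h => hn (h.symm.trans (hsize g hg))

theorem eq_localized {g : GriddedPerm} {n : ℕ} {c : Cell} (hn : g.size = n)
    (hc : ∀ i, g.cell i = c) : ∃ π : Equiv.Perm (Fin n), g = localized π c := by
  obtain ⟨m, π, d, hd⟩ := g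
  obtain rfl : m = n := hn
  exact ⟨π, GriddedPerm.mk_congr hc⟩

theorem localized_contains_iff {n k : ℕ} {π : Equiv.Perm (Fin n)} {σ : Equiv.Perm (Fin k)}
    {c : Cell} : (localized π c).Contains (localized σ c) ↔ PermContains π σ :=
  exists_congr fun _ => and_iff_left fun _ => rfl

/-- Avoiding `12` means being decreasing; composing with the reversal of values gives an increasing
bijection of `Fin n`, which is the identity. -/
theorem not_permContains_one_iff {n : ℕ} {π : Equiv.Perm (Fin n)} :
    ¬ PermContains π (1 : Equiv.Perm (Fin 2)) ↔ π = Fin.revPerm := by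
  constructor
  · intro h
    have hanti : ∀ i j, i < j → π j < π i := by
      intro i j hij
      by_contra hlt
      have hlt' : π i < π j := lt_of_le_of_ne (not_lt.1 hlt) (π.injective.ne hij.ne)
      refine h ⟨OrderEmbedding.ofStrictMono ![i, j] ?_, ?_⟩
      · rw [Fin.strictMono_iff_lt_succ]
        intro k
        rw [Subsingleton.elim k 0]
        exact hij
      · rw [Fin.forall_fin_two, Fin.forall_fin_two, Fin.forall_fin_two]
        exact ⟨⟨by simp, iff_of_true (by decide) hlt'⟩,
          iff_of_false (by decide) hlt'.asymm, by simp⟩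
    have hmono : StrictMono fun i => Fin.rev (π i) := fun i j hij =>
      Fin.rev_lt_rev.2 (hanti i j hij)
    have hsurj : Function.Surjective fun i => Fin.rev (π i) :=
      Fin.rev_surjective.comp π.surjective
    have := (StrictMono.range_inj hmono strictMono_id).1 (by rw [hsurj.range_eq, Set.range_id])
    ext i
    rw [← Fin.rev_rev (π i), show Fin.rev (π i) = i from congrFun this i, Fin.revPerm_apply]
  · rintro rfl ⟨f, hf⟩
    have h1 := (hf 0 1).1 (by decide)
    rw [Fin.revPerm_apply, Fin.revPerm_apply, Fin.rev_lt_rev, f.lt_iff_lt] at h1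
    exact absurd h1 (by decide)

theorem mem_desc10_iff {n : ℕ} {g : GriddedPerm} :
    desc10.Mem g ∧ g.size = n ↔ g = localized (Fin.revPerm : Equiv.Perm (Fin n)) (0, 0) := by
  have h12 : ∀ π : Equiv.Perm (Fin n), (localized π (0, 0)).Has [(0, (0, 0)), (1, (0, 0))] ↔
      PermContains π (1 : Equiv.Perm (Fin 2)) := fun π =>
    (contains_iff_has (h := localized (1 : Equiv.Perm (Fin 2)) (0, 0))).symm.trans
      localized_contains_iff
  constructor
  · rintro ⟨⟨h1, h2, -⟩, hn⟩
    obtain ⟨π, rfl⟩ := eq_localized hn fun i => List.mem_singleton.1 (h1 i)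
    have h3 := h2 [(0, (0, 0)), (1, (0, 0))] (by decide)
    rw [h12, not_permContains_one_iff] at h3
    rw [h3]
  · rintro rfl
    refine ⟨⟨fun i => List.mem_singleton_self _, fun o ho => ?_,
      fun _ h => absurd h List.not_mem_nil⟩, rfl⟩
    rw [List.mem_singleton.1 ho, h12, not_permContains_one_iff]

theorem count_T10 (n : ℕ) : T10.count n = 1 :=
  Tiling.count_eq_one fun g => by rw [describedBy10.mem_grid_iff, mem_desc10_iff]

theorem count_T4 (n : ℕ) : T4.count n = if n = 0 then 0 else 1 := by
  split_ifs with hn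
  · subst hn
    exact describedBy4.count_zero_eq_zero (by decide)
  · refine Tiling.count_eq_one (x := localized (Fin.revPerm (n := n)) (0, 0)) fun g => ?_
    rw [describedBy4.mem_grid_iff, ← mem_desc10_iff]
    constructor
    · rintro ⟨⟨h1, h2, -⟩, h3⟩
      exact ⟨⟨h1, h2, fun _ h => absurd h List.not_mem_nil⟩, h3⟩
    · rintro ⟨⟨h1, h2, -⟩, h3⟩
      refine ⟨⟨h1, h2, fun L hL => ?_⟩, h3⟩
      rw [List.mem_singleton.1 hL]
      exact ⟨_, List.mem_singleton_self _, has_singleton_iff.2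
        ⟨⟨0, by omega⟩, List.mem_singleton.1 (h1 _)⟩⟩

theorem count_T9 (n : ℕ) : T9.count n = if n = 1 then 1 else 0 := by
  have hpt : ∀ g ∈ T9.Grid, g = point (0, 0) := by
    intro g hg
    obtain ⟨h1, h2, h3⟩ := (describedBy9.mem_grid_iff g).1 hg
    have hc : ∀ i, g.cell i = (0, 0) := fun i => List.mem_singleton.1 (h1 i)
    have hsub : ∀ i j : Fin g.size, i = j := by
      intro i j
      by_contra hij
      rcases contains_localized_pair_or hij (hc i) (hc j) with h | h
      · exact h2 [(0, (0, 0)), (1, (0, 0))] (by decide) (contains_iff_has.1 h)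
      · exact h2 [(1, (0, 0)), (0, (0, 0))] (by decide) (contains_iff_has.1 h)
    obtain ⟨r, hr, hgr⟩ := h3 [[(0, (0, 0))]] (by decide)
    obtain ⟨k, -⟩ := has_singleton_iff.1 (List.mem_singleton.1 hr ▸ hgr)
    have hsize : g.size = 1 := le_antisymm
      (by
        by_contra hlt
        have := hsub ⟨0, by omega⟩ ⟨1, by omega⟩
        exact zero_ne_one (congrArg Fin.val this)) (Nat.one_le_iff_ne_zero.2 fun h => by
          have := k.2
          omega)
    obtain ⟨π, rfl⟩ := eq_localized hsize hc
    rw [Subsingleton.elim π 1]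
    rfl
  split_ifs with hn
  · subst hn
    refine Tiling.count_eq_one fun g => ⟨fun h => hpt g h.1, ?_⟩
    rintro rfl
    refine ⟨(describedBy9.mem_grid_iff _).2 (Desc.mem_of_accepts (by decide +kernel)), rfl⟩
  · exact Tiling.count_eq_zero fun g hg h => hn (h.symm.trans (by rw [hpt g hg]; rfl))

theorem count_T1 (n : ℕ) : T1.count n = (Av basis n).ncard := by
  have himage : {g | g ∈ T1.Grid ∧ g.size = n} = (fun π => localized π (0, 0)) '' Av basis n := by
    ext g
    constructor
    · rintro ⟨⟨hb, ho, -⟩, hn⟩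
      obtain ⟨π, rfl⟩ := eq_localized (c := (0, 0)) hn fun i =>
        Prod.ext (Nat.lt_one_iff.1 (hb i).1) (Nat.lt_one_iff.1 (hb i).2)
      exact ⟨π, fun σ hσ h => ho _ ⟨σ, hσ, rfl⟩ (localized_contains_iff.2 h), rfl⟩
    · rintro ⟨π, hπ, rfl⟩
      refine ⟨⟨fun _ => ⟨Nat.one_pos, Nat.one_pos⟩, ?_, fun _ h => absurd h (Set.notMem_empty _)⟩,
        rfl⟩
      rintro _ ⟨σ, hσ, rfl⟩ h
      exact hπ σ hσ (localized_contains_iff.1 h)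
  rw [Tiling.count, himage]
  refine Set.ncard_image_of_injective _ fun π σ h => Equiv.ext fun i => ?_
  have h' : (List.ofFn fun i => ((π i : ℕ), ((0, 0) : Cell))) =
      List.ofFn fun i => ((σ i : ℕ), ((0, 0) : Cell)) := congrArg GriddedPerm.toPat h
  exact Fin.ext (congrArg Prod.fst (congrFun (List.ofFn_injective h') i))

/-! ### Validity of the specification -/

theorem spec_isStrategy : ∀ v, (spec.strategy v).IsStrategy Tiling.count
  | .t1 => reqIns_isStrategy _
  | .t2 => verify_isStrategy count_T2
  | .e3 => reqIns_isStrategy _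
  | .t4 => verify_isStrategy count_T4
  | .e5 => factor_isStrategy _ _
  | .t7 => reqIns_isStrategy _
  | .t9 => verify_isStrategy count_T9
  | .t10 => verify_isStrategy count_T10
  | .e11 => factor_isStrategy _ _

theorem spec_strategy_isProductive : ∀ v, (spec.strategy v).IsProductive Tiling.count
  | .t1 => reqIns_isProductive _
  | .t2 => verify_isProductive _ _
  | .e3 => reqIns_isProductive _
  | .t4 => verify_isProductive _ _
  | .e5 => factor_isProductive _ _
  | .t7 => reqIns_isProductive _
  | .t9 => verify_isProductive _ _
  | .t10 => verify_isProductive _ _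
  | .e11 => factor_isProductive _ _

theorem Simplifies.equivalent {T T' : Tiling} (h : Simplifies T T') : Equivalent T T' :=
  .rel _ _ (.simplify _ _ h)

theorem equivalent_of_pointPl {h : GriddedPerm} {I : Fin h.size} {d : Direction} {T B : Tiling}
    (hp : Produces (pointPl h I d) T (![B] : Fin 1 → Tiling)) : Equivalent T B := by
  obtain ⟨B', hB, hs⟩ := hp
  exact .trans _ _ _ (.rel _ _ (.pointPl h I d T B' (0 : Fin 1) hB)) (hs (0 : Fin 1)).equivalent

theorem equivalent_of_rowSep {r : ℕ} {S : Set ℕ} {T B : Tiling}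
    (hp : Produces (rowSep r S) T (![B] : Fin 1 → Tiling)) : Equivalent T B := by
  obtain ⟨B', hB, hs⟩ := hp
  exact .trans _ _ _ (.rel _ _ (.rowSep r S T B' (0 : Fin 1) hB)) (hs (0 : Fin 1)).equivalent

theorem equivalent_of_colSep {q : ℕ} {S : Set ℕ} {T B : Tiling}
    (hp : Produces (colSep q S) T (![B] : Fin 1 → Tiling)) : Equivalent T B := by
  obtain ⟨B', hB, hs⟩ := hp
  exact .trans _ _ _ (.rel _ _ (.colSep q S T B' (0 : Fin 1) hB)) (hs (0 : Fin 1)).equivalent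

theorem equivalent_T8_T3 : Equivalent T8 T3 :=
  (equivalent_of_pointPl produces_pointPl_T8).symm _ _

theorem equivalent_T13_T3 : Equivalent T13 T3 :=
  (equivalent_of_pointPl produces_pointPl_T13).symm _ _

theorem equivalent_T6_T5 : Equivalent T6 T5 := by
  have h1 := equivalent_of_pointPl produces_pointPl_T5'
  have h2 := equivalent_of_pointPl produces_pointPl_T5''
  have h3 := equivalent_of_rowSep produces_rowSep_T5'''
  have h4 := equivalent_of_colSep produces_colSep_T6
  exact (h1.trans _ _ _ (h2.trans _ _ _ (h3.trans _ _ _ h4))).symm _ _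

theorem equivalent_T12_T11 : Equivalent T12 T11 := by
  have h1 := equivalent_of_pointPl produces_pointPl_T11'
  have h2 := equivalent_of_rowSep produces_rowSep_T12
  exact (h1.trans _ _ _ h2).symm _ _

/-- Children are produced only up to simplification, but simplification is part of the equivalence,
so the classes are unaffected. -/
theorem Produces.exists_rule {S : Strategy Tiling} {T R : Tiling} {B C : Fin S.arity → Tiling}
    (h : Produces S T B) (hT : Equivalent T R) (hB : ∀ i, Equivalent (B i) (C i)) :
    ∃ A B', Equivalent A R ∧ S.d A = some B' ∧ ∀ i, Equivalent (B' i) (C i) := by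
  obtain ⟨B', hB', hs⟩ := h
  exact ⟨T, B', hT, hB', fun i => (hs i).equivalent.trans _ _ _ (hB i)⟩

theorem spec_produced : ∀ v, ∃ A B, Equivalent A (spec.rep v) ∧ (spec.strategy v).d A = some B ∧
    ∀ i, Equivalent (B i) (spec.rep (spec.child v i))
  | .t1 => produces_insPoint.exists_rule (.refl _)
      (Fin.forall_fin_two.2 ⟨.refl _, .refl _⟩)
  | .t2 => (produces_verify T2 _).exists_rule (.refl _) fun i => (show Fin 0 from i).elim0
  | .e3 => produces_ins12.exists_rule (.refl _)
      (Fin.forall_fin_two.2 ⟨.refl _, .refl _⟩)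
  | .t4 => (produces_verify T4 _).exists_rule (.refl _) fun i => (show Fin 0 from i).elim0
  | .e5 => produces_factorT6.exists_rule equivalent_T6_T5 (Fin.forall_fin_succ.2 ⟨.refl _,
      Fin.forall_fin_succ.2 ⟨equivalent_T8_T3, Fin.forall_fin_two.2 ⟨.refl _, .refl _⟩⟩⟩)
  | .t7 => produces_insRightPoint.exists_rule (.refl _)
      (Fin.forall_fin_two.2 ⟨.refl _, .refl _⟩)
  | .t9 => (produces_verify T9 _).exists_rule (.refl _) fun i => (show Fin 0 from i).elim0
  | .t10 => (produces_verify T10 _).exists_rule (.refl _) fun i => (show Fin 0 from i).elim0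
  | .e11 => produces_factorT12.exists_rule equivalent_T12_T11
      (Fin.forall_fin_two.2 ⟨equivalent_T13_T3, .refl _⟩)

end CombExp
-- Solving the system
namespace CombExp

/-! ### The system of counting functions and the generating function equations -/

open PowerSeries in
theorem coeff_prod_mk {R : Type*} [CommSemiring R] {m : ℕ} (b : Fin m → ℕ → R) (n : ℕ) :
    coeff n (∏ i, mk (b i)) =
      ∑ k ∈ Finset.piAntidiag (Finset.univ : Finset (Fin m)) n, ∏ i, b i (k i) := by
  rw [coeff_prod]
  refine Finset.sum_nbij' (fun l => ⇑l) (fun k => Finsupp.equivFunOnFinite.symm k) ?_ ?_ ?_ ?_ ?_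
  · intro l hl
    rw [Finset.mem_finsuppAntidiag] at hl
    exact Finset.mem_piAntidiag.2 ⟨hl.1, fun i _ => Finset.mem_univ i⟩
  · intro k hk
    rw [Finset.mem_piAntidiag] at hk
    exact Finset.mem_finsuppAntidiag.2 ⟨hk.1, Finset.subset_univ _⟩
  · intro l _
    exact Finsupp.ext fun _ => rfl
  · intro k _
    rfl
  · intro l _
    simp only [coeff_mk]

/-- The counting functions commute with the embedding of the natural numbers. -/
theorem spec_c_natCast (v : V) (n : ℕ)
    (a : (i : Fin (spec.strategy v).arity) → Fin ((spec.strategy v).r n i + 1).toNat → ℕ) :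
    ((spec.strategy v).c ℕ n a : ℂ) = (spec.strategy v).c ℂ n fun i j => (a i j : ℂ) := by
  cases v
  case t1 => exact Nat.cast_add _ _
  case t2 => rfl
  case e3 => exact Nat.cast_add _ _
  case t4 => rfl
  case e5 =>
    simp only [spec, vertexStrategy, factorT6, factor, Nat.cast_sum, Nat.cast_ite, Nat.cast_prod,
      Nat.cast_zero]
  case t7 => exact Nat.cast_add _ _
  case t9 => rfl
  case t10 => rfl
  case e11 =>
    simp only [spec, vertexStrategy, factorT12, factor, Nat.cast_sum, Nat.cast_ite, Nat.cast_prod,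
      Nat.cast_zero]

/-- Each counting function is correct at the tiling where its rule is produced. Counts are constant
on classes, so the equation carries over to the representatives of parent and children. -/
theorem spec_isSolution_count : spec.IsSolution fun v n => ((spec.rep v).count n : ℂ) := by
  intro v n
  obtain ⟨A, B, hA, hB, hAB⟩ := spec_produced v
  have h1 := congrArg (Nat.cast (R := ℂ)) (spec_isStrategy v A B hB n)
  rw [equivalent_count hA] at h1
  refine h1.symm.trans ((spec_c_natCast v n _).trans ?_)
  refine congrArg _ (funext fun i => funext fun j => ?_)
  rw [equivalent_count (hAB i)]

theorem one_sub_X_inv : (1 - PowerSeries.X : ℂ⟦X⟧)⁻¹ = PowerSeries.mk 1 :=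
  ((PowerSeries.eq_inv_iff_mul_eq_one (by simp)).2
    (PowerSeries.mk_one_mul_one_sub_eq_one ℂ)).symm

section

variable {b : V → ℕ → ℂ}

/-- The sum over a product of finite initial segments is a coefficient of a product of power
series, if the missing terms vanish. -/
theorem factor_sum_eq_coeff {m : ℕ} (S : Finset (Fin m)) (a : Fin m → ℕ → ℂ) (n : ℕ)
    (h : ∀ i ∈ S, ∃ j, j ≠ i ∧ a j 0 = 0) :
    (∑ k : (i : Fin m) → Fin ((if i ∈ S then (n : ℤ) - 1 else n) + 1).toNat,
      if ∑ i, (k i : ℕ) = n then ∏ i, a i (k i) else 0) =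
      PowerSeries.coeff n (∏ i, PowerSeries.mk (a i)) := by
  rw [coeff_prod_mk]
  refine sum_pi_fin_eq_sum_piAntidiag
    (fun i => ((if i ∈ S then (n : ℤ) - 1 else n) + 1).toNat) n (fun k => ∏ i, a i (k i)) ?_
  rintro k hk ⟨i, hi⟩
  have hle := le_of_mem_piAntidiag hk i
  by_cases hiS : i ∈ S
  · simp only [hiS, if_true] at hi
    obtain ⟨j, hj, hj0⟩ := h i hiS
    refine Finset.prod_eq_zero (Finset.mem_univ j) ?_
    rw [eq_zero_of_mem_piAntidiag hk (show k i = n by omega) hj, hj0]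
  · simp only [hiS, if_false] at hi
    omega

theorem solution_e5_zero (h : spec.IsSolution b) : b .e5 0 = 0 := by
  refine (h .e5 0).trans ?_
  simp only [spec, vertexStrategy, factorT6, factor]
  -- At `n = 0` every factor has reliance `-1`, so the index type of the sum is empty. The vanishing
  -- is thus forced on arbitrary complex solutions, not only on counting sequences.
  exact Finset.sum_eq_zero fun k _ => absurd (k (0 : Fin 4)).2 (by simp)

theorem solution_e3_zero (h : spec.IsSolution b) : b .e3 0 = 0 := by
  refine (h .e3 0).trans ((congrArg₂ (· + ·) ?_ (solution_e5_zero h)).trans (add_zero 0))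
  exact (h .t4 0).trans (by simp [spec, vertexStrategy, verifyT4, verify])

/-- The truncated sums are coefficients of full products once the omitted terms vanish. For `e5`
this uses that both `e3` and `t9` start with `0`, for `e11` that `e3` does. -/
theorem gfSystem_of_isSolution (h : spec.IsSolution b) :
    GFSystem fun v => PowerSeries.mk (b v) := by
  have ht4 : ∀ n, b .t4 n = if n = 0 then 0 else 1 := fun n =>
    (h .t4 n).trans (by simp [spec, vertexStrategy, verifyT4, verify])
  have ht9 : ∀ n, b .t9 n = if n = 1 then 1 else 0 := fun n =>
    (h .t9 n).trans (by simp [spec, vertexStrategy, verifyT9, verify])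
  have ht10 : ∀ n, b .t10 n = 1 := fun n =>
    (h .t10 n).trans (by simp [spec, vertexStrategy, verifyT10, verify])
  have ht2 : ∀ n, b .t2 n = if n = 0 then 1 else 0 := fun n =>
    (h .t2 n).trans (by simp [spec, vertexStrategy, verifyT2, verify])
  refine ⟨?_, ?_, ?_, ?_, ?_, ?_, ?_, ?_, ?_⟩
  · ext n
    rw [map_add, PowerSeries.coeff_mk, PowerSeries.coeff_mk, PowerSeries.coeff_mk]
    exact h .t1 n
  · ext n
    rw [PowerSeries.coeff_mk, ht2, PowerSeries.coeff_one]
  · ext n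
    rw [map_add, PowerSeries.coeff_mk, PowerSeries.coeff_mk, PowerSeries.coeff_mk]
    exact h .e3 n
  · rw [one_sub_X_inv]
    ext n
    rw [PowerSeries.coeff_mk, ht4]
    cases n with
    | zero => simp
    | succ n => simp [PowerSeries.coeff_succ_X_mul]
  · have h9 : b .t9 0 = 0 := by simp [ht9]
    have h3 := solution_e3_zero h
    ext n
    rw [PowerSeries.coeff_mk]
    refine (h .e5 n).trans ((factor_sum_eq_coeff Finset.univ
      (fun i => b ((![.t7, .e3, .t9, .t10] : Fin 4 → V) i)) n fun i _ => ?_).trans ?_)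
    -- That lemma is about natural numbers, so the complex initial terms enter through an indicator
    -- of their vanishing.
    · refine (mem_univ_iff_exists_zero (a := fun i =>
          if b ((![.t7, .e3, .t9, .t10] : Fin 4 → V) i) 0 = 0 then 0 else 1)
        (j := 1) (k := 2) (by decide) ?_ ?_ i).1 (Finset.mem_univ i) |>.imp fun j hj => ⟨hj.1, ?_⟩
      · exact if_pos h3
      · exact if_pos h9
      · by_contra hne
        simp [hne] at hj
    · rw [Fin.prod_univ_four]
      rfl
  · ext n
    rw [map_add, PowerSeries.coeff_mk, PowerSeries.coeff_mk, PowerSeries.coeff_mk]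
    exact h .t7 n
  · ext n
    rw [PowerSeries.coeff_mk, ht9, PowerSeries.coeff_X]
  · rw [one_sub_X_inv]
    ext n
    rw [PowerSeries.coeff_mk, ht10]
    rfl
  · have h3 := solution_e3_zero h
    ext n
    rw [PowerSeries.coeff_mk]
    refine (h .e11 n).trans ((factor_sum_eq_coeff {1}
      (fun i => b ((![.e3, .t10] : Fin 2 → V) i)) n fun i hi => ?_).trans ?_)
    · rw [Finset.mem_singleton.1 hi]
      exact ⟨0, by decide, h3⟩
    · rw [Fin.prod_univ_two]
      rfl

end

namespace GFSystem

variable {F F' : V → ℂ⟦X⟧}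

theorem e3_eq (h : GFSystem F) : F .e3 = PowerSeries.X * (1 - PowerSeries.X)⁻¹ *
    (1 + F .e3 * (1 + F .e3 * (1 + (1 - PowerSeries.X)⁻¹))) := by
  obtain ⟨h1, h2, h3, h4, h5, h7, h9, h10, h11⟩ := h
  have : F .e3 = F .t4 + F .t7 * F .e3 * F .t9 * F .t10 := by rw [← h5, h3]
  rw [h7, h1, h2, h4, h9, h11, h10] at this
  refine this.trans ?_
  ring

/-- Subtracting the two quadratic equations lets `E - E'` factor out. Because of the factor `X` in
the equation, the cofactor has constant term `1` and cannot be zero, and power series over `ℂ` form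
a domain. -/
theorem eq_e3 (h : GFSystem F) (h' : GFSystem F') : F .e3 = F' .e3 := by
  have e := h.e3_eq
  have e' := h'.e3_eq
  set E := F .e3
  set E' := F' .e3
  set u := (1 - PowerSeries.X : ℂ⟦X⟧)⁻¹
  have hmul : (E - E') * (1 - PowerSeries.X * (u * (1 + (E + E') * (1 + u)))) = 0 := by
    have h1 : (E - E') * (1 - PowerSeries.X * (u * (1 + (E + E') * (1 + u)))) =
        (E - PowerSeries.X * u * (1 + E * (1 + E * (1 + u)))) -
          (E' - PowerSeries.X * u * (1 + E' * (1 + E' * (1 + u)))) := by ring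
    rw [h1, ← e, ← e', sub_self, sub_self, sub_self]
  rcases mul_eq_zero.1 hmul with h0 | h0
  · exact sub_eq_zero.1 h0
  · have := congrArg PowerSeries.constantCoeff h0
    simp at this

theorem unique (h : GFSystem F) (h' : GFSystem F') : F = F' := by
  have e3 := h.eq_e3 h'
  obtain ⟨h1, h2, h3, h4, h5, h7, h9, h10, h11⟩ := h
  obtain ⟨h1', h2', h3', h4', h5', h7', h9', h10', h11'⟩ := h'
  have e2 : F .t2 = F' .t2 := h2.trans h2'.symm
  have e4 : F .t4 = F' .t4 := h4.trans h4'.symm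
  have e9 : F .t9 = F' .t9 := h9.trans h9'.symm
  have e10 : F .t10 = F' .t10 := h10.trans h10'.symm
  have e1 : F .t1 = F' .t1 := by rw [h1, h1', e2, e3]
  have e11 : F .e11 = F' .e11 := by rw [h11, h11', e3, e10]
  have e7 : F .t7 = F' .t7 := by rw [h7, h7', e1, e11]
  have e5 : F .e5 = F' .e5 := by rw [h5, h5', e7, e3, e9, e10]
  funext v
  cases v <;> assumption

end GFSystem

theorem gfSystem_gf : GFSystem fun v => (vertexRep v).gf :=
  gfSystem_of_isSolution spec_isSolution_count

theorem gfSystem_iff (F : V → ℂ⟦X⟧) : GFSystem F ↔ F = fun v => (vertexRep v).gf :=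
  ⟨fun h => h.unique gfSystem_gf, fun h => h ▸ gfSystem_gf⟩

/-- Any two solutions satisfy the generating function system, whose solution is unique; comparing
coefficients finishes the proof. Productivity of the individual strategies is not used. -/
theorem spec_isProductive : spec.IsProductive := by
  refine ⟨_, spec_isSolution_count, fun b hb => ?_⟩
  have h := (gfSystem_of_isSolution hb).unique (gfSystem_of_isSolution spec_isSolution_count)
  funext v n
  have := congrArg (PowerSeries.coeff n) (congrFun h v)
  rwa [PowerSeries.coeff_mk, PowerSeries.coeff_mk] at this

/-! ### The classes are distinct -/

/-- The first terms of the counting sequences of the nine classes. -/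
def firstTerms : V → ℕ × ℕ × ℕ
  | .t1 => (1, 1, 2)
  | .t2 => (1, 0, 0)
  | .e3 => (0, 1, 2)
  | .t4 => (0, 1, 1)
  | .e5 => (0, 0, 1)
  | .t7 => (1, 2, 5)
  | .t9 => (0, 1, 0)
  | .t10 => (1, 1, 1)
  | .e11 => (0, 1, 3)

/-- Equivalent tilings are equinumerous, so distinctness of the classes follows from the
distinctness of these nine triples. -/
theorem firstTerms_injective : Function.Injective firstTerms := by
  intro v w h
  cases v <;> cases w <;> first | rfl | (exact absurd h (by decide))

theorem count_T3_small : T3.count 0 = 0 ∧ T3.count 1 = 1 ∧ T3.count 2 = 2 := by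
  have hE := gfSystem_gf.e3_eq
  change T3.gf = _ * (1 + T3.gf * (1 + T3.gf * _)) at hE
  set u := (1 - PowerSeries.X : ℂ⟦X⟧)⁻¹ with hu
  have hu' : u = PowerSeries.mk 1 := one_sub_X_inv
  -- Written as `E = X * G`, each coefficient of `E` is the preceding coefficient of `G`, which in
  -- turn involves only earlier coefficients of `E`.
  obtain ⟨G, hG⟩ : ∃ G, G = u * (1 + T3.gf * (1 + T3.gf * (1 + u))) := ⟨_, rfl⟩
  rw [mul_assoc, ← hG] at hE
  have hG0 : PowerSeries.coeff 0 G = 1 := by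
    rw [hG, hE, hu']
    simp
  have hG1 : PowerSeries.coeff 1 G = 2 := by
    rw [hG, hE, hu', PowerSeries.coeff_mul]
    rw [PowerSeries.coeff_zero_eq_constantCoeff_apply] at hG0
    simp [Finset.Nat.antidiagonal_succ, mul_assoc, hG0, PowerSeries.coeff_one,
      one_add_one_eq_two]
  have hc : ∀ n, (T3.count n : ℂ) = PowerSeries.coeff n (PowerSeries.X * G) := fun n => by
    rw [← hE, Tiling.gf, PowerSeries.coeff_mk]
  have h0 := hc 0
  have h1 := hc 1
  have h2 := hc 2
  rw [PowerSeries.coeff_zero_X_mul] at h0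
  rw [PowerSeries.coeff_succ_X_mul, hG0] at h1
  rw [PowerSeries.coeff_succ_X_mul, hG1] at h2
  exact ⟨by exact_mod_cast h0, by exact_mod_cast h1, by exact_mod_cast h2⟩

theorem count_T11_eq_sum (n : ℕ) : T11.count n = ∑ i ∈ Finset.range (n + 1), T3.count i := by
  have h := congrArg (PowerSeries.coeff n) gfSystem_gf.2.2.2.2.2.2.2.2
  have h10 : T10.gf = PowerSeries.mk 1 := PowerSeries.ext fun n => by
    rw [Tiling.gf, PowerSeries.coeff_mk, PowerSeries.coeff_mk, count_T10]
    simp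
  change PowerSeries.coeff n T11.gf = PowerSeries.coeff n (T3.gf * T10.gf) at h
  rw [h10, PowerSeries.coeff_mul, Finset.Nat.sum_antidiagonal_eq_sum_range_succ_mk] at h
  simp only [Tiling.gf, PowerSeries.coeff_mk, Pi.one_apply, mul_one] at h
  exact_mod_cast h

theorem count_eq_firstTerms (v : V) :
    ((vertexRep v).count 0, (vertexRep v).count 1, (vertexRep v).count 2) = firstTerms v := by
  have hadd : ∀ {A B C : Tiling}, A.gf = B.gf + C.gf → ∀ n, A.count n = B.count n + C.count n := by
    intro A B C h n
    have := congrArg (PowerSeries.coeff n) h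
    simp only [Tiling.gf, map_add, PowerSeries.coeff_mk] at this
    exact_mod_cast this
  have e1 := hadd (A := T1) (B := T2) (C := T3) gfSystem_gf.1
  have e3 := hadd (A := T3) (B := T4) (C := T5) gfSystem_gf.2.2.1
  have e7 := hadd (A := T7) (B := T1) (C := T11) gfSystem_gf.2.2.2.2.2.1
  obtain ⟨c0, c1, c2⟩ := count_T3_small
  have e30 := e3 0
  have e31 := e3 1
  have e32 := e3 2
  simp only [count_T4, c0, c1, c2] at e30 e31 e32
  cases v <;> refine Prod.ext ?_ (Prod.ext ?_ ?_) <;>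
    simp [vertexRep, firstTerms, e1, e7, count_T2, count_T4, count_T9, count_T10,
      count_T11_eq_sum, Finset.sum_range_succ, c0, c1, c2] <;> simp at e30 e31 e32 <;> omega

theorem spec_isValid : spec.IsValid Equivalent Tiling.count where
  equinumerous _ _ h := equivalent_count h
  distinct v w h := firstTerms_injective <| by
    have h1 : (vertexRep v).count = (vertexRep w).count := equivalent_count h
    exact (count_eq_firstTerms v).symm.trans (by rw [h1, count_eq_firstTerms w])
  isStrategy := spec_isStrategy
  produced := spec_produced

/-! ### The generating function of the class -/

theorem gf_T1_eq_classGF : T1.gf = classGF basis :=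
  congrArg PowerSeries.mk (funext fun n => congrArg Nat.cast (count_T1 n))

/-- The root `s` is defined by the last equation, so only its square has to be computed; constant
term `1` singles out the branch. -/
theorem exists_sqrt_classGF : ∃ s : ℂ⟦X⟧, PowerSeries.constantCoeff s = 1 ∧
    s ^ 2 = 1 - 6 * PowerSeries.X + 5 * PowerSeries.X ^ 2 ∧
    2 * PowerSeries.X * (2 - PowerSeries.X) * classGF basis = 1 + PowerSeries.X - s := by
  refine ⟨1 + PowerSeries.X - 2 * PowerSeries.X * (2 - PowerSeries.X) * classGF basis, by simp,
    ?_, by ring⟩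
  have hE := gfSystem_gf.e3_eq
  have hT : classGF basis = 1 + T3.gf := by
    rw [← gf_T1_eq_classGF]
    exact gfSystem_gf.1.trans (congrArg (· + T3.gf) gfSystem_gf.2.1)
  change T3.gf = _ * (1 + T3.gf * (1 + T3.gf * _)) at hE
  rw [hT]
  set E := T3.gf
  have hu : (1 - PowerSeries.X : ℂ⟦X⟧) * (1 - PowerSeries.X)⁻¹ = 1 :=
    PowerSeries.mul_inv_cancel _ (by simp)
  set u := (1 - PowerSeries.X : ℂ⟦X⟧)⁻¹
  set x : ℂ⟦X⟧ := PowerSeries.X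
  -- The quadratic for `E` after multiplication by `(1 - x) ^ 2`, which clears `u`.
  have key : x * (2 - x) * E ^ 2 - (1 - x) * (1 - 2 * x) * E + x * (1 - x) = 0 := by
    have h1 : (1 - x) ^ 2 * E = (1 - x) * x * ((1 - x) * u) + (1 - x) * x * E * ((1 - x) * u) +
        x * E ^ 2 * ((1 - x) * u) * ((1 - x) + (1 - x) * u) := by
      conv_lhs => rw [hE]
      ring
    rw [hu] at h1
    linear_combination -h1
  -- Completing the square: four times the leading coefficient `x * (2 - x)` times the quadratic.
  linear_combination 4 * x * (2 - x) * key

end CombExp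

open CombExp

theorem mainTheorem11 :
    -- the rules of the proof tree
    (Produces insPoint T1 (![T2, T3] : Fin 2 → Tiling) ∧
      Produces ins12 T3 (![T4, T5] : Fin 2 → Tiling) ∧
      Produces factorT6 T6 (![T7, T8, T9, T10] : Fin 4 → Tiling) ∧
      Produces insRightPoint T7 (![T1, T11] : Fin 2 → Tiling) ∧
      Produces factorT12 T12 (![T13, T10] : Fin 2 → Tiling) ∧
      Produces verifyT2 T2 (![] : Fin 0 → Tiling) ∧
      Produces verifyT4 T4 (![] : Fin 0 → Tiling) ∧
      Produces verifyT9 T9 (![] : Fin 0 → Tiling) ∧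
      Produces verifyT10 T10 (![] : Fin 0 → Tiling)) ∧
    -- the equivalences of the proof tree
    (Produces (pointPl (point (0, 0)) (0 : Fin 1) .left) T3 (![T8] : Fin 1 → Tiling) ∧
      Produces (pointPl (point (0, 0)) (0 : Fin 1) .right) T3 (![T13] : Fin 1 → Tiling) ∧
      Produces (pointPl req12 (1 : Fin 2) .right) T5 (![T5'] : Fin 1 → Tiling) ∧
      Produces (pointPl (point (0, 0)) (0 : Fin 1) .left) T5' (![T5''] : Fin 1 → Tiling) ∧
      Produces (rowSep 0 {4}) T5'' (![T5'''] : Fin 1 → Tiling) ∧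
      Produces (colSep 2 {5}) T5''' (![T6] : Fin 1 → Tiling) ∧
      Produces (pointPl (point (1, 0)) (0 : Fin 1) .left) T11 (![T11'] : Fin 1 → Tiling) ∧
      Produces (rowSep 0 {2}) T11' (![T12] : Fin 1 → Tiling)) ∧
    -- the specification is valid, all its strategies are productive, and it is productive
    spec.IsValid Equivalent Tiling.count ∧
    (∀ v, (spec.strategy v).IsProductive Tiling.count) ∧
    spec.IsProductive ∧
    spec.IsSolution (fun v n => ((spec.rep v).count n : ℂ)) ∧
    -- the root enumerates the class
    (∀ n, T1.count n = (Av basis n).ncard) ∧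
    -- the generating function equations have exactly one solution, given by the counting sequences
    (∀ F : V → PowerSeries ℂ, GFSystem F ↔ F = fun v => (vertexRep v).gf) ∧
    -- the generating function of the class; `s` is the square root of `1 - 6x + 5x²`
    (∃ s : PowerSeries ℂ, PowerSeries.constantCoeff s = 1 ∧
      s ^ 2 = 1 - 6 * PowerSeries.X + 5 * PowerSeries.X ^ 2 ∧
      2 * PowerSeries.X * (2 - PowerSeries.X) * classGF basis = 1 + PowerSeries.X - s) := by
  refine ⟨⟨produces_insPoint, produces_ins12, produces_factorT6, produces_insRightPoint,
      produces_factorT12, produces_verify _ _, produces_verify _ _, produces_verify _ _,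
      produces_verify _ _⟩,
    ⟨produces_pointPl_T8, produces_pointPl_T13, produces_pointPl_T5', produces_pointPl_T5'',
      produces_rowSep_T5''', produces_colSep_T6, produces_pointPl_T11', produces_rowSep_T12⟩,
    spec_isValid, spec_strategy_isProductive, spec_isProductive, spec_isSolution_count, count_T1,
    gfSystem_iff, exists_sqrt_classGF⟩
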